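/- Let $A$ be a complex symmetric $3\times 3$ matrix and let $X=\{z\in\mathbb{C}^3 : z^{T}Az=0\}$ be the (affine cone over the) projective conic represented by $A$. Let $q(z,w)=\sum_k z_k\overline{w_k}$ and $q_u(z)=q(u-z,u-z)$. For an irreducible variety $Y\subseteq\mathbb{C}^n$ of codimension $c$ with prime ideal $I_Y=\langle f_1,\dots,f_s\rangle\subseteq\mathbb{C}[z]$, let $J(f)$ be the Jacobian matrix, $I_{Y_{\mathrm{sing}}}=I_Y+\langle c\text{-minors of }J(f)\rangle$, and let $*$ be the ring automorphism of $\mathbb{C}[z,w,u,v]$ (each of $z,w,u,v$ denoting $n$ variables) with $z_k\leftrightarrow w_k$, $u_k\leftrightarrow v_k$ that conjugates the coefficients. With $I_Y'$ the ideal generated by the $(c+1)$-minors of $\begin{bmatrix} v-w\\ J(f)\end{bmatrix}$, the Hermitian critical ideal of $Y$ is $$\bigl(I_Y+(I_Y)^*+I_Y'+(I_Y')^*\bigr):\bigl(I_{Y_{\mathrm{sing}}}\cdot(I_{Y_{\mathrm{sing}}})^*\bigr)^{\infty}\subseteq\mathbb{C}[z,w,u,v].$$ The virtual Hermitian distance degree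 $\mathrm{vHD}(Y)$ is the number of its solutions $(z,w)$ for generic $(u,v)\in\mathbb{C}^n\times\mathbb{C}^n$, that is, for all $(u,v)$ in a non-empty Zariski open set. The Hermitian distance degree $\mathrm{HD}(Y)\subseteq\mathbb{N}$ is the set of all numbers $k$ such that $q_u$ has exactly $k$ critical points on the regular part $Y_{\mathrm{reg}}$ for all $u$ in some non-empty open subset of $\mathbb{C}^n$. For a reducible variety the solutions, respectively the critical points, are counted separately on each irreducible component and the numbers are added. Then the following hold. 1. If $\operatorname{rk}A=1$, then $\mathrm{vHD}(X)=1$ and $\mathrm{HD}(X)=\{1\}$. 2. If $\operatorname{rk}A=2$, then $\mathrm{vHD}(X)=2$ and $\mathrm{HD}(X)=\{2\}$. 3. If $A$ is nonsingular and has only one singular value, then $\mathrm{vHD}(X)=2$ and $\mathrm{HD}(X)=\{2\}$. 4. If $A$ is nonsingular and has exactly two different singular values, then $\mathrm{vHD}(X)=6$. 5. If $A$ is nonsingular and has three different singular values, then $\mathrm{vHD}(X)=8$. -/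

import Mathlib

namespace HermitianDistance

noncomputable section

open MvPolynomial

/-! ### The Hermitian form and the squared distance -/

/-- The canonical Hermitian inner product `∑ zₖ · conj wₖ` on `ℂⁿ`. Its topology is the usual
(product) topology of `Fin n → ℂ`. -/
def hermForm {n : ℕ} (z w : Fin n → ℂ) : ℂ := ∑ k, z k * (starRingEnd ℂ) (w k)

/-- The function `q_u(z) = q(u - z, u - z)`, which is real valued. -/
def sqDist {n : ℕ} (u z : Fin n → ℂ) : ℝ := (hermForm (u - z) (u - z)).re

/-! ### Ideals of minors, saturation, codimension, singular locus -/

/-- The ideal generated by all `k`-minors of a matrix (which may have infinitely many rows). -/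
def minorsIdeal {R ρ κ : Type*} [CommRing R] (k : ℕ) (M : Matrix ρ κ R) : Ideal R :=
  Ideal.span {d | ∃ (r : Fin k → ρ) (c : Fin k → κ), d = (M.submatrix r c).det}

/-- The saturation `I : J^∞`. -/
def saturation {R : Type*} [CommRing R] (I J : Ideal R) : Ideal R :=
  ⨆ k : ℕ, Submodule.colon I ((J ^ k : Ideal R) : Set R)

/-- The codimension of the irreducible variety `V(P)`, `P` a prime ideal of `ℂ[z₁, …, zₙ]`. -/
def codim {n : ℕ} (P : Ideal (MvPolynomial (Fin n) ℂ)) : ℕ := P.height.toNat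

/-- The Jacobian matrix, with one row of partial derivatives for each element of `P`. Modulo `P`
its rows are combinations of the rows that belong to any chosen system of generators of `P`. -/
def jacobian {n : ℕ} (P : Ideal (MvPolynomial (Fin n) ℂ)) :
    Matrix P (Fin n) (MvPolynomial (Fin n) ℂ) :=
  fun f k => pderiv k (f : MvPolynomial (Fin n) ℂ)

/-- The ideal of the singular locus: `P + ⟨c-minors of the Jacobian⟩`, `c` the codimension. -/
def singIdeal {n : ℕ} (P : Ideal (MvPolynomial (Fin n) ℂ)) : Ideal (MvPolynomial (Fin n) ℂ) :=
  P ⊔ minorsIdeal (codim P) (jacobian P)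

/-! ### The ring `ℂ[z, w, u, v]` and its conjugation `*` -/

/-- The four groups of variables; `w` and `v` stand for the conjugates of `z` and `u`. -/
inductive Block : Type
  | z : Block
  | w : Block
  | u : Block
  | v : Block

/-- The exchange `z ↔ w`, `u ↔ v`. -/
def Block.swap : Block → Block
  | .z => .w
  | .w => .z
  | .u => .v
  | .v => .u

/-- The polynomial ring `ℂ[z, w, u, v]` in `4n` variables. -/
abbrev Ring4 (n : ℕ) : Type := MvPolynomial (Block × Fin n) ℂ

/-- The map `*`: `zₖ ↔ wₖ`, `uₖ ↔ vₖ`, and complex conjugation on the coefficients. -/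
def starMap (n : ℕ) : Ring4 n →+* Ring4 n :=
  eval₂Hom (C.comp (starRingEnd ℂ)) (fun i => X (i.1.swap, i.2))

/-- The inclusion `ℂ[z] → ℂ[z, w, u, v]`. -/
def inclZ (n : ℕ) : MvPolynomial (Fin n) ℂ →+* Ring4 n :=
  (rename (fun k : Fin n => (Block.z, k))).toRingHom

/-- The point `(z, w, u, v)` of `ℂ⁴ⁿ`. -/
def point4 {n : ℕ} (z w u v : Fin n → ℂ) : Block × Fin n → ℂ
  | (.z, k) => z k
  | (.w, k) => w k
  | (.u, k) => u k
  | (.v, k) => v k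

/-! ### The Hermitian critical ideal of an irreducible variety -/

/-- The Jacobian matrix of `P` in the variables `z`, augmented by the row `v - w`. -/
def augJacobian {n : ℕ} (P : Ideal (MvPolynomial (Fin n) ℂ)) :
    Matrix (Option P) (Fin n) (Ring4 n)
  | none, k => X (Block.v, k) - X (Block.w, k)
  | some f, k => inclZ n (jacobian P f k)

/-- The ideal generated by the `(c+1)`-minors of the augmented Jacobian matrix. -/
def normalIdeal {n : ℕ} (P : Ideal (MvPolynomial (Fin n) ℂ)) : Ideal (Ring4 n) :=
  minorsIdeal (codim P + 1) (augJacobian P)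

/-- The Hermitian critical ideal of `V(P)`, `P` prime:
`(I + I* + I' + I'*) : (I_sing · I_sing*)^∞` in `ℂ[z, w, u, v]`. -/
def criticalIdeal {n : ℕ} (P : Ideal (MvPolynomial (Fin n) ℂ)) : Ideal (Ring4 n) :=
  let I := P.map (inclZ n)
  let S := (singIdeal P).map (inclZ n)
  saturation
    (I ⊔ I.map (starMap n) ⊔ normalIdeal P ⊔ (normalIdeal P).map (starMap n))
    (S * S.map (starMap n))

/-- The solutions `(z, w)` of the Hermitian critical ideal of `V(P)` for given `(u, v)`. -/
def virtualCriticalPairs {n : ℕ} (P : Ideal (MvPolynomial (Fin n) ℂ)) (u v : Fin n → ℂ) :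
    Set ((Fin n → ℂ) × (Fin n → ℂ)) :=
  {p | point4 p.1 p.2 u v ∈ zeroLocus ℂ (criticalIdeal P)}

/-! ### Critical points of the squared distance on an irreducible variety -/

/-- The regular points of `V(P)`. -/
def regularPoints {n : ℕ} (P : Ideal (MvPolynomial (Fin n) ℂ)) : Set (Fin n → ℂ) :=
  zeroLocus ℂ P \ zeroLocus ℂ (singIdeal P)

/-- The tangent space of `V(P)` at `z`: the common kernel of the differentials `df(z)`, `f ∈ P`. -/
def tangentSpace {n : ℕ} (P : Ideal (MvPolynomial (Fin n) ℂ)) (z : Fin n → ℂ) :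
    Set (Fin n → ℂ) :=
  {t | ∀ f ∈ P, ∑ k, eval z (pderiv k f) * t k = 0}

/-- The critical points of `q_u` on the manifold of regular points of `V(P)`: the real differential
of `q_u` at `z` vanishes on the tangent space. -/
def criticalPoints {n : ℕ} (P : Ideal (MvPolynomial (Fin n) ℂ)) (u : Fin n → ℂ) :
    Set (Fin n → ℂ) :=
  {z | z ∈ regularPoints P ∧ ∀ t ∈ tangentSpace P z, fderiv ℝ (sqDist u) z t = 0}

/-! ### The two degrees of a variety

Both counts are taken component by component, and added over the irreducible components. -/

/-- The prime ideals of the irreducible components of the variety `X`. -/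
def componentIdeals {n : ℕ} (X : Set (Fin n → ℂ)) : Set (Ideal (MvPolynomial (Fin n) ℂ)) :=
  (vanishingIdeal ℂ X).minimalPrimes

/-- The number of solutions of the Hermitian critical ideal of `X` for given `(u, v)`, added over
the irreducible components of `X`. -/
def virtualCount {n : ℕ} (X : Set (Fin n → ℂ)) (u v : Fin n → ℂ) : ℕ∞ :=
  {p : Ideal (MvPolynomial (Fin n) ℂ) × ((Fin n → ℂ) × (Fin n → ℂ)) |
    p.1 ∈ componentIdeals X ∧ p.2 ∈ virtualCriticalPairs p.1 u v}.encard

/-- The number of critical points of `q_u` on `X`, added over the irreducible components. -/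
def criticalCount {n : ℕ} (X : Set (Fin n → ℂ)) (u : Fin n → ℂ) : ℕ∞ :=
  {p : Ideal (MvPolynomial (Fin n) ℂ) × (Fin n → ℂ) |
    p.1 ∈ componentIdeals X ∧ p.2 ∈ criticalPoints p.1 u}.encard

/-- `vHD(X) = N`: for all `(u, v)` in a non-empty Zariski open (hence dense) subset of `ℂⁿ × ℂⁿ`
the Hermitian critical ideal has exactly `N` solutions. -/
def HasVirtualHD {n : ℕ} (X : Set (Fin n → ℂ)) (N : ℕ) : Prop :=
  ∃ g : MvPolynomial (Fin n ⊕ Fin n) ℂ, g ≠ 0 ∧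
    ∀ u v : Fin n → ℂ, eval (Sum.elim u v) g ≠ 0 → virtualCount X u v = N

/-- The number in `HasVirtualHD` is unique. -/
theorem HasVirtualHD.unique {n : ℕ} {X : Set (Fin n → ℂ)} {N M : ℕ}
    (hN : HasVirtualHD X N) (hM : HasVirtualHD X M) : N = M := by
  obtain ⟨g, hg, hgN⟩ := hN
  obtain ⟨h, hh, hhM⟩ := hM
  obtain ⟨x, hx⟩ : ∃ x, eval x (g * h) ≠ 0 := by
    by_contra hcon
    push Not at hcon
    exact mul_ne_zero hg hh (MvPolynomial.funext (fun x => by simpa using hcon x))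
  rw [map_mul] at hx
  have hxe : Sum.elim (x ∘ Sum.inl) (x ∘ Sum.inr) = x := Sum.elim_comp_inl_inr x
  have h1 := hgN (x ∘ Sum.inl) (x ∘ Sum.inr) (by rw [hxe]; exact left_ne_zero_of_mul hx)
  have h2 := hhM (x ∘ Sum.inl) (x ∘ Sum.inr) (by rw [hxe]; exact right_ne_zero_of_mul hx)
  exact_mod_cast h1.symm.trans h2

/-- The Hermitian distance degree `HD(X)`: the numbers of critical points of `q_u` that do not vary
for `u` in some non-empty open set. -/
def HD {n : ℕ} (X : Set (Fin n → ℂ)) : Set ℕ :=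
  {k | ∃ U : Set (Fin n → ℂ), IsOpen U ∧ U.Nonempty ∧ ∀ u ∈ U, criticalCount X u = k}

/-! ### Conics and singular values -/

/-- The affine cone `{z ∈ ℂ³ | zᵀ A z = 0}` of the projective conic with matrix `A`. -/
def conic (A : Matrix (Fin 3) (Fin 3) ℂ) : Set (Fin 3 → ℂ) :=
  {z | z ⬝ᵥ (A.mulVec z) = 0}

/-- The set of singular values of a `3 × 3` matrix. -/
def singularValueSet (A : Matrix (Fin 3) (Fin 3) ℂ) : Set ℝ :=
  Set.range (fun i : Fin 3 => (Matrix.toEuclideanLin A).singularValues i)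

end

end HermitianDistance

namespace HermitianDistance

open MvPolynomial

/-! By Takagi factorization (`exists_takagi`) `A = Uᵀ diag(a) U` with `U` unitary, and the `aᵢ ≥ 0`
are the singular values. In rank 1 the cone is a plane, in rank 2 a union of two planes. On a plane
the equations for `z` and `w` decouple into orthogonal projections, so each component contributes
exactly one solution.

Let `A` be nonsingular and `cᵢ = aᵢ²`. The coordinates `x = diag(√a) U z`, `y = diag(1/√a) Ū w` turn
the conic into `∑ xᵢ² = 0`, its conjugate into `∑ cᵢ yᵢ² = 0`, and the normality conditions into `vᵢ
- yᵢ = l xᵢ`, `uᵢ - xᵢ = m cᵢ yᵢ` (`diagPairs`). With `s = l m` and `bᵢ = 1 - s cᵢ`, these give `xᵢ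
= (uᵢ - m cᵢ vᵢ) / bᵢ` and `yᵢ = (vᵢ - l uᵢ) / bᵢ`, which leaves two quadratic equations for `l` and
`m`. Elimination yields one equation `eliminant = 0` in `s`; for generic `(u, v)` each zero
determines `l` and `m`, so critical pairs correspond to zeros (`Admissible.encard_diagPairs`).

If there are `k + 1` distinct `cᵢ`, the numerator of the eliminant has degree at most `6k + 2`. It
is divisible by `bᵢ²` whenever `cᵢ` differs from the other two (`sq_dvd_eliminant_numerator`). The
quotient `F` has degree at most `14 - 6 = 8`, `8 - 2 = 6` or `2` for three, two or one distinct
values.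

It remains to see that generically `F` attains this degree, has simple roots, and has no root at
`0`, at a pole or at a zero of the simple pole sums. These are open conditions, expressed by
resultants and a leading coefficient, so special parameters suffice (`generic_encard_diagPairs`).
For two or three distinct values `F` is a constant times a square at the convenient parameters; a
first order deformation splits its double roots (`exists_isCoprime_derivative`).

The pairs `(u, ū)` are Zariski dense. For a single singular value every generic solution over `(u,
ū)` has `w = z̄` (`eq_star_of_isotropic`), so the number of critical points equals the virtual count
2. -/

instance : Finite Block :=
  Finite.of_injective (fun b : Block => match b with
    | .z => (0 : Fin 4) | .w => 1 | .u => 2 | .v => 3) (by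
    intro a b h; cases a <;> cases b <;> simp_all)

/-- The gradient of a polynomial at a point. -/
noncomputable def grad {n : ℕ} (f : MvPolynomial (Fin n) ℂ) (z : Fin n → ℂ) : Fin n → ℂ :=
  fun k => eval z (pderiv k f)

/-! ### Zero loci of sums, products and saturations of ideals -/

section ZeroLocus

variable {σ τ : Type*}

lemma mem_zeroLocus_eval {I : Ideal (MvPolynomial σ ℂ)} {x : σ → ℂ} :
    x ∈ zeroLocus ℂ I ↔ ∀ p ∈ I, eval x p = 0 := by
  simp [mem_zeroLocus_iff, aeval_eq_eval]

lemma mem_zeroLocus_iff_le {I : Ideal (MvPolynomial σ ℂ)} {x : σ → ℂ} :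
    x ∈ zeroLocus ℂ I ↔ I ≤ RingHom.ker (eval x) := by
  rw [mem_zeroLocus_eval]; rfl

lemma mem_zeroLocus_sup {I J : Ideal (MvPolynomial σ ℂ)} {x : σ → ℂ} :
    x ∈ zeroLocus ℂ (I ⊔ J) ↔ x ∈ zeroLocus ℂ I ∧ x ∈ zeroLocus ℂ J := by
  rw [mem_zeroLocus_iff_le, mem_zeroLocus_iff_le, mem_zeroLocus_iff_le, sup_le_iff]

lemma mem_zeroLocus_map {I : Ideal (MvPolynomial τ ℂ)}
    (φ : MvPolynomial τ ℂ →+* MvPolynomial σ ℂ) {x : σ → ℂ} :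
    x ∈ zeroLocus ℂ (I.map φ) ↔ ∀ p ∈ I, eval x (φ p) = 0 := by
  rw [mem_zeroLocus_iff_le, Ideal.map_le_iff_le_comap]; rfl

lemma mem_zeroLocus_span {S : Set (MvPolynomial σ ℂ)} {x : σ → ℂ} :
    x ∈ zeroLocus ℂ (Ideal.span S) ↔ ∀ p ∈ S, eval x p = 0 := by
  rw [mem_zeroLocus_iff_le, Ideal.span_le]; rfl

lemma mem_zeroLocus_mul {I J : Ideal (MvPolynomial σ ℂ)} {x : σ → ℂ} :
    x ∈ zeroLocus ℂ (I * J) ↔ x ∈ zeroLocus ℂ I ∨ x ∈ zeroLocus ℂ J := by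
  simp only [mem_zeroLocus_iff_le]
  exact (RingHom.ker_isPrime (eval x)).mul_le

lemma mem_saturation {R : Type*} [CommRing R] {I J : Ideal R} {p : R} (k : ℕ)
    (h : ∀ q ∈ J ^ k, p * q ∈ I) : p ∈ saturation I J :=
  Submodule.mem_iSup_of_mem k (Submodule.mem_colon.2 h)

lemma saturation_le {R : Type*} [CommRing R] {I J K : Ideal R}
    (h : ∀ (k : ℕ) (p : R), (∀ q ∈ J ^ k, p * q ∈ I) → p ∈ K) : saturation I J ≤ K :=
  iSup_le fun k _ hp => h k _ (Submodule.mem_colon.1 hp)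

lemma le_saturation {R : Type*} [CommRing R] (I J : Ideal R) : I ≤ saturation I J :=
  fun _ hp => mem_saturation 0 fun q _ => Ideal.mul_mem_right q _ hp

lemma zeroLocus_saturation_subset {I J : Ideal (MvPolynomial σ ℂ)} {x : σ → ℂ}
    (hx : x ∈ zeroLocus ℂ (saturation I J)) : x ∈ zeroLocus ℂ I :=
  zeroLocus_anti_mono (le_saturation I J) hx

lemma mem_zeroLocus_saturation {I J : Ideal (MvPolynomial σ ℂ)} {x : σ → ℂ}
    (hI : x ∈ zeroLocus ℂ I) (hJ : x ∉ zeroLocus ℂ J) : x ∈ zeroLocus ℂ (saturation I J) := by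
  rw [mem_zeroLocus_eval] at hI hJ
  push Not at hJ
  obtain ⟨j, hj, hjx⟩ := hJ
  rw [mem_zeroLocus_iff_le]
  refine saturation_le fun k p hp => ?_
  have h := hI _ (hp (j ^ k) (Ideal.pow_mem_pow hj k))
  rw [map_mul, map_pow] at h
  exact (mul_eq_zero.1 h).resolve_right (pow_ne_zero _ hjx)

/-- A polynomial that vanishes on `V(I) \ V(J)` vanishes on the variety of `I : J^∞`. -/
lemma eval_eq_zero_of_mem_zeroLocus_saturation [Finite σ] {I J : Ideal (MvPolynomial σ ℂ)}
    {h : MvPolynomial σ ℂ}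
    (hh : ∀ y, y ∈ zeroLocus ℂ I → y ∉ zeroLocus ℂ J → eval y h = 0) {x : σ → ℂ}
    (hx : x ∈ zeroLocus ℂ (saturation I J)) : eval x h = 0 := by
  -- `h J` vanishes on `V(I)`, so the Nullstellensatz places it in the radical. As it is finitely
  -- generated, some power `hⁿ Jⁿ` lies in `I`, that is, `hⁿ ∈ I : J^∞`.
  have hle : Ideal.span {h} * J ≤ I.radical := by
    rw [Ideal.span_singleton_mul_le_iff]
    intro j hj
    rw [← vanishingIdeal_zeroLocus_eq_radical (K := ℂ), mem_vanishingIdeal_iff]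
    intro y hy
    rw [aeval_eq_eval, map_mul]
    by_cases hyJ : y ∈ zeroLocus ℂ J
    · rw [mem_zeroLocus_eval.1 hyJ j hj, mul_zero]
    · rw [hh y hy hyJ, zero_mul]
  obtain ⟨n, hn⟩ := Ideal.exists_pow_le_of_le_radical_of_fg hle
    (IsNoetherian.noetherian (Ideal.span {h} * J))
  have hmem : h ^ n ∈ saturation I J := by
    refine mem_saturation n fun q hq => hn ?_
    rw [mul_pow]
    exact Ideal.mul_mem_mul (Ideal.pow_mem_pow (Ideal.mem_span_singleton_self h) n) hq
  have := mem_zeroLocus_eval.1 hx _ hmem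
  rw [map_pow] at this
  exact eq_zero_of_pow_eq_zero this

end ZeroLocus

/-! ### Evaluation in `ℂ[z, w, u, v]` -/

variable {n : ℕ}

lemma eval_inclZ (z w u v : Fin n → ℂ) (f : MvPolynomial (Fin n) ℂ) :
    eval (point4 z w u v) (inclZ n f) = eval z f := by
  simp only [inclZ, AlgHom.toRingHom_eq_coe, RingHom.coe_coe, eval_rename]
  rfl

/-- Conjugating coefficients amounts to conjugating both the argument and the value. This converts
every condition on the starred ideals into the original condition at `(w̄, z̄, v̄, ū)`. -/
lemma eval_starMap (z w u v : Fin n → ℂ) (p : Ring4 n) :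
    eval (point4 z w u v) (starMap n p) =
      star (eval (point4 (star w) (star z) (star v) (star u)) p) := by
  induction p using MvPolynomial.induction_on with
  | C a => simp [starMap]
  | add p q hp hq => simp only [map_add, hp, hq, star_add]
  | mul_X p i hp =>
    rw [map_mul, map_mul, hp, map_mul, star_mul, mul_comm]
    congr 1
    obtain ⟨b, k⟩ := i
    cases b <;> simp [starMap, point4, Block.swap]

lemma mem_zeroLocus_map_starMap {I : Ideal (Ring4 n)} {z w u v : Fin n → ℂ} :
    point4 z w u v ∈ zeroLocus ℂ (I.map (starMap n)) ↔
      point4 (star w) (star z) (star v) (star u) ∈ zeroLocus ℂ I := by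
  rw [mem_zeroLocus_map, mem_zeroLocus_eval]
  simp only [eval_starMap, star_eq_zero]

lemma mem_zeroLocus_map_inclZ {P : Ideal (MvPolynomial (Fin n) ℂ)} {z w u v : Fin n → ℂ} :
    point4 z w u v ∈ zeroLocus ℂ (P.map (inclZ n)) ↔ z ∈ zeroLocus ℂ P := by
  rw [mem_zeroLocus_map, mem_zeroLocus_eval]
  simp only [eval_inclZ]

/-! ### The critical ideal of a hypersurface `f = 0` -/

section Principal

variable {f : MvPolynomial (Fin n) ℂ}

lemma codim_span_singleton (hf : Prime f) : codim (Ideal.span {f}) = 1 := by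
  rw [codim, Ideal.height_span_singleton_eq_one_of_mem_nonZeroDivisors
    (mem_nonZeroDivisors_of_ne_zero hf.ne_zero) hf.not_isUnit]
  rfl

/-- In the Leibniz rule the term containing `f` drops out. Hence all rows of the Jacobian of the
ideal `⟨f⟩` are multiples of the gradient of `f` at points of the hypersurface. -/
lemma grad_mul_of_eval_eq_zero {z : Fin n → ℂ} (hz : eval z f = 0)
    (q : MvPolynomial (Fin n) ℂ) (k : Fin n) :
    eval z (pderiv k (f * q)) = eval z q * grad f z k := by
  simp [grad, Derivation.leibniz, hz]

lemma mem_zeroLocus_span_singleton {z : Fin n → ℂ} :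
    z ∈ zeroLocus ℂ (Ideal.span {f}) ↔ eval z f = 0 := by
  rw [mem_zeroLocus_span]; simp only [Set.mem_singleton_iff, forall_eq]

lemma mem_zeroLocus_singIdeal (hf : Prime f) {z : Fin n → ℂ} :
    z ∈ zeroLocus ℂ (singIdeal (Ideal.span {f})) ↔ eval z f = 0 ∧ grad f z = 0 := by
  rw [singIdeal, mem_zeroLocus_sup, mem_zeroLocus_span_singleton, codim_span_singleton hf,
    minorsIdeal, mem_zeroLocus_span]
  refine and_congr_right fun hz => ⟨fun h => ?_, ?_⟩
  · ext k
    have := h _ ⟨fun _ => ⟨f, Ideal.mem_span_singleton_self f⟩, fun _ => k, rfl⟩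
    simpa [Matrix.det_fin_one, jacobian, grad] using this
  · rintro h _ ⟨r, c, rfl⟩
    obtain ⟨q, hq⟩ := Ideal.mem_span_singleton.1 (r 0).2
    rw [Matrix.det_fin_one, Matrix.submatrix_apply, jacobian, hq, grad_mul_of_eval_eq_zero hz, h]
    simp

/-- `v - w` is proportional to the gradient at the point `z` of the hypersurface `f = 0`. -/
def HalfCritical (f : MvPolynomial (Fin n) ℂ) (z w v : Fin n → ℂ) : Prop :=
  eval z f = 0 ∧ ∀ i j, (v i - w i) * grad f z j = (v j - w j) * grad f z i

lemma mem_zeroLocus_normalIdeal (hf : Prime f) {z w u v : Fin n → ℂ} (hz : eval z f = 0) :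
    point4 z w u v ∈ zeroLocus ℂ (normalIdeal (Ideal.span {f})) ↔
      ∀ i j, (v i - w i) * grad f z j = (v j - w j) * grad f z i := by
  rw [normalIdeal, codim_span_singleton hf, one_add_one_eq_two, minorsIdeal,
    mem_zeroLocus_span]
  -- Up to scalars only two rows occur, `v - w` and `grad f z`. Thus every 2-minor is zero or a
  -- multiple of a minor of these two.
  have hrow : ∀ r : Option (Ideal.span {f}), (∀ k, eval (point4 z w u v)
      (augJacobian (Ideal.span {f}) r k) = v k - w k) ∨ ∃ a, ∀ k, eval (point4 z w u v)
      (augJacobian (Ideal.span {f}) r k) = a * grad f z k := by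
    rintro (_ | ⟨g, hg⟩)
    · exact Or.inl fun k => by simp [augJacobian, point4]
    · obtain ⟨q, rfl⟩ := Ideal.mem_span_singleton.1 hg
      exact Or.inr ⟨eval z q, fun k => by
        rw [augJacobian, eval_inclZ, jacobian, grad_mul_of_eval_eq_zero hz]⟩
  constructor
  · intro h i j
    have := h _ ⟨![none, some ⟨f, Ideal.mem_span_singleton_self f⟩], ![i, j], rfl⟩
    simp only [Matrix.det_fin_two, Matrix.submatrix_apply, Matrix.cons_val_zero,
      Matrix.cons_val_one, map_sub, map_mul, augJacobian, eval_inclZ, eval_X, point4,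
      jacobian] at this
    simp only [grad]
    linear_combination this
  · rintro h _ ⟨r, c, rfl⟩
    have hc := h (c 0) (c 1)
    simp only [Matrix.det_fin_two, Matrix.submatrix_apply, map_sub, map_mul]
    rcases hrow (r 0) with h0 | ⟨a, h0⟩ <;> rcases hrow (r 1) with h1 | ⟨b, h1⟩ <;>
      simp only [h0, h1]
    · ring
    · linear_combination b * hc
    · linear_combination (-a) * hc
    · ring

lemma mem_zeroLocus_baseIdeal (hf : Prime f) {z w u v : Fin n → ℂ} :
    point4 z w u v ∈ zeroLocus ℂ ((Ideal.span {f}).map (inclZ n) ⊔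
      ((Ideal.span {f}).map (inclZ n)).map (starMap n) ⊔ normalIdeal (Ideal.span {f}) ⊔
      (normalIdeal (Ideal.span {f})).map (starMap n)) ↔
      HalfCritical f z w v ∧ HalfCritical f (star w) (star z) (star u) := by
  rw [mem_zeroLocus_sup, mem_zeroLocus_sup, mem_zeroLocus_sup, mem_zeroLocus_map_starMap,
    mem_zeroLocus_map_starMap, mem_zeroLocus_map_inclZ, mem_zeroLocus_map_inclZ,
    mem_zeroLocus_span_singleton, mem_zeroLocus_span_singleton, HalfCritical, HalfCritical]
  constructor
  · rintro ⟨⟨⟨h1, h2⟩, h3⟩, h4⟩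
    exact ⟨⟨h1, (mem_zeroLocus_normalIdeal hf h1).1 h3⟩, h2,
      (mem_zeroLocus_normalIdeal hf h2).1 h4⟩
  · rintro ⟨⟨h1, h3⟩, h2, h4⟩
    exact ⟨⟨⟨h1, h2⟩, (mem_zeroLocus_normalIdeal hf h1).2 h3⟩,
      (mem_zeroLocus_normalIdeal hf h2).2 h4⟩

lemma mem_zeroLocus_singProduct (hf : Prime f) {z w u v : Fin n → ℂ}
    (hz : eval z f = 0) (hw : eval (star w) f = 0) :
    point4 z w u v ∈ zeroLocus ℂ ((singIdeal (Ideal.span {f})).map (inclZ n) *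
      ((singIdeal (Ideal.span {f})).map (inclZ n)).map (starMap n)) ↔
      grad f z = 0 ∨ grad f (star w) = 0 := by
  rw [mem_zeroLocus_mul, mem_zeroLocus_map_starMap, mem_zeroLocus_map_inclZ,
    mem_zeroLocus_map_inclZ, mem_zeroLocus_singIdeal hf, mem_zeroLocus_singIdeal hf]
  simp only [hz, hw, true_and]

lemma mem_virtualCriticalPairs_of_grad_ne_zero (hf : Prime f) {z w u v : Fin n → ℂ}
    (h1 : HalfCritical f z w v) (h2 : HalfCritical f (star w) (star z) (star u))
    (hz : grad f z ≠ 0) (hw : grad f (star w) ≠ 0) :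
    (z, w) ∈ virtualCriticalPairs (Ideal.span {f}) u v :=
  mem_zeroLocus_saturation ((mem_zeroLocus_baseIdeal hf).2 ⟨h1, h2⟩) (by
    rw [mem_zeroLocus_singProduct hf h1.1 h2.1]; tauto)

lemma halfCritical_of_mem_virtualCriticalPairs (hf : Prime f) {z w u v : Fin n → ℂ}
    (h : (z, w) ∈ virtualCriticalPairs (Ideal.span {f}) u v) :
    HalfCritical f z w v ∧ HalfCritical f (star w) (star z) (star u) :=
  (mem_zeroLocus_baseIdeal hf).1 (zeroLocus_saturation_subset h)

lemma point4_eta (x : Block × Fin n → ℂ) : x = point4 (fun k => x (.z, k)) (fun k => x (.w, k))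
    (fun k => x (.u, k)) (fun k => x (.v, k)) := by
  ext ⟨b, k⟩; cases b <;> rfl

/-- Polynomials that vanish at all critical points with nonzero gradients vanish at the solutions
of the critical ideal. -/
lemma eval_eq_zero_of_mem_virtualCriticalPairs (hf : Prime f) {h : Ring4 n}
    (hh : ∀ z w u v : Fin n → ℂ, HalfCritical f z w v →
      HalfCritical f (star w) (star z) (star u) → grad f z ≠ 0 → grad f (star w) ≠ 0 →
      eval (point4 z w u v) h = 0) {z w u v : Fin n → ℂ}
    (hmem : (z, w) ∈ virtualCriticalPairs (Ideal.span {f}) u v) :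
    eval (point4 z w u v) h = 0 := by
  refine eval_eq_zero_of_mem_zeroLocus_saturation (fun y hy hyS => ?_) hmem
  rw [point4_eta y] at hy hyS ⊢
  obtain ⟨h1, h2⟩ := (mem_zeroLocus_baseIdeal hf).1 hy
  rw [mem_zeroLocus_singProduct hf h1.1 h2.1] at hyS
  push Not at hyS
  exact hh _ _ _ _ h1 h2 hyS.1 hyS.2

lemma mem_regularPoints (hf : Prime f) {z : Fin n → ℂ} :
    z ∈ regularPoints (Ideal.span {f}) ↔ eval z f = 0 ∧ grad f z ≠ 0 := by
  rw [regularPoints, Set.mem_sdiff, mem_zeroLocus_span_singleton, mem_zeroLocus_singIdeal hf]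
  tauto

lemma mem_tangentSpace {z t : Fin n → ℂ} (hz : eval z f = 0) :
    t ∈ tangentSpace (Ideal.span {f}) z ↔ ∑ k, grad f z k * t k = 0 := by
  constructor
  · exact fun h => h f (Ideal.mem_span_singleton_self f)
  · intro h g hg
    obtain ⟨q, rfl⟩ := Ideal.mem_span_singleton.1 hg
    simp only [grad_mul_of_eval_eq_zero hz, mul_assoc, ← Finset.mul_sum, h, mul_zero]

end Principal

/-! ### The differential of the squared distance and its critical points -/

lemma sqDist_eq (u z : Fin n → ℂ) : sqDist u z = ∑ k, ‖u k - z k‖ ^ 2 := by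
  simp only [sqDist, hermForm, Pi.sub_apply, Complex.mul_conj, Complex.normSq_eq_norm_sq]
  rw [← Complex.ofReal_sum, Complex.ofReal_re]

lemma fderiv_sqDist (u z t : Fin n → ℂ) :
    fderiv ℝ (sqDist u) z t = -2 * (∑ k, t k * star (u k - z k)).re := by
  have hfun : sqDist u = fun z => ∑ k, ‖u k - z k‖ ^ 2 := funext (sqDist_eq u)
  have hd : ∀ k, HasFDerivAt (fun z : Fin n → ℂ => ‖u k - z k‖ ^ 2)
      (2 • (innerSL ℝ (u k - z k)).comp
        (-(ContinuousLinearMap.proj k : (Fin n → ℂ) →L[ℝ] ℂ))) z := by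
    intro k
    have h1 : HasFDerivAt (fun z : Fin n → ℂ => u k - z k)
        (-(ContinuousLinearMap.proj k : (Fin n → ℂ) →L[ℝ] ℂ)) z :=
      (ContinuousLinearMap.proj (R := ℝ) (φ := fun _ : Fin n => ℂ) k).hasFDerivAt.const_sub (u k)
    exact h1.norm_sq
  rw [hfun, (HasFDerivAt.fun_sum fun k _ => hd k).fderiv]
  simp only [sum_apply, Complex.re_sum, Finset.mul_sum]
  refine Finset.sum_congr rfl fun k _ => ?_
  simp [Complex.inner, innerSL_apply_apply]
  ring

variable {n : ℕ}

section CriticalPoints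

variable {f : MvPolynomial (Fin n) ℂ}

lemma mem_criticalPoints (hf : Prime f) {u z : Fin n → ℂ} :
    z ∈ criticalPoints (Ideal.span {f}) u ↔ HalfCritical f z (star z) (star u) ∧ grad f z ≠ 0 := by
  simp only [criticalPoints, Set.mem_ofPred_eq, mem_regularPoints hf, HalfCritical]
  constructor
  · rintro ⟨⟨hz, hg⟩, h⟩
    refine ⟨⟨hz, fun i j => ?_⟩, hg⟩
    have key : ∀ t : Fin n → ℂ, ∑ k, grad f z k * t k = 0 →
        ∑ k, t k * star (u k - z k) = 0 := by
      intro t ht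
      -- The tangent space is complex: the real differential on `t` gives the real part of the
      -- complex equation, and on `i t` the imaginary part.
      have h1 := h t ((mem_tangentSpace hz).2 ht)
      have h2 := h (fun k => Complex.I * t k) ((mem_tangentSpace hz).2 (by
        rw [← mul_zero Complex.I, ← ht, Finset.mul_sum]
        exact Finset.sum_congr rfl fun k _ => by ring))
      rw [fderiv_sqDist] at h1 h2
      simp only [mul_assoc, ← Finset.mul_sum] at h2
      refine Complex.ext ?_ ?_
      · simpa using h1
      · simpa using h2
    by_cases hij : i = j
    · subst hij; rfl
    -- The tangent vector `gⱼ eᵢ - gᵢ eⱼ`, `g` the gradient, produces the minor of the columns `i`,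
    -- `j`.
    have h3 := key (fun k => if k = i then grad f z j else if k = j then -grad f z i else 0) (by
      rw [← Finset.add_sum_erase _ _ (Finset.mem_univ i),
        ← Finset.add_sum_erase _ _ (Finset.mem_erase.2 ⟨Ne.symm hij, Finset.mem_univ j⟩),
        Finset.sum_eq_zero]
      · simp [Ne.symm hij]; ring
      · intro k hk; simp at hk; simp [hk])
    rw [← Finset.add_sum_erase _ _ (Finset.mem_univ i),
        ← Finset.add_sum_erase _ _ (Finset.mem_erase.2 ⟨Ne.symm hij, Finset.mem_univ j⟩),
        Finset.sum_eq_zero (by intro k hk; simp at hk; simp [hk])] at h3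
    simp only [if_true, if_neg (Ne.symm hij), star_sub, add_zero] at h3
    simp only [Pi.star_apply]
    linear_combination h3
  · rintro ⟨⟨hz, h⟩, hg⟩
    refine ⟨⟨hz, hg⟩, fun t ht => ?_⟩
    rw [mem_tangentSpace hz] at ht
    obtain ⟨j, hj⟩ := Function.ne_iff.1 hg
    rw [fderiv_sqDist]
    have : (∑ k, t k * star (u k - z k)) * grad f z j = 0 := by
      rw [Finset.sum_mul, ← mul_zero (star (u j - z j)), ← ht, Finset.mul_sum]
      refine Finset.sum_congr rfl fun k _ => ?_
      have := h k j
      simp only [Pi.star_apply] at this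
      simp only [star_sub]
      linear_combination t k * this
    rw [(mul_eq_zero.1 this).resolve_right hj]
    simp

end CriticalPoints

/-! ### Hyperplanes and orthogonal projection -/

section LinearForm

/-- The linear form with coefficients `ℓ`. -/
noncomputable def linForm (ℓ : Fin n → ℂ) : MvPolynomial (Fin n) ℂ := ∑ k, C (ℓ k) * X k

@[simp] lemma eval_linForm (ℓ z : Fin n → ℂ) : eval z (linForm ℓ) = ℓ ⬝ᵥ z := by
  simp [linForm, dotProduct]

@[simp] lemma grad_linForm (ℓ z : Fin n → ℂ) : grad (linForm ℓ) z = ℓ := by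
  ext k
  simp [grad, linForm, pderiv_X, Pi.single_apply]

lemma prime_linForm {ℓ : Fin n → ℂ} (hℓ : ℓ ≠ 0) : Prime (linForm ℓ) := by
  obtain ⟨k, hk⟩ := Function.ne_iff.1 hℓ
  have h : linForm ℓ = sumSMulX (Finsupp.equivFunOnFinite.symm ℓ) := by
    rw [sumSMulX, Finsupp.linearCombination_apply, Finsupp.sum_fintype _ _ (by simp)]
    simp [linForm, smul_eq_C_mul]
  rw [h]
  refine (irreducible_sumSMulX _ ⟨k, by simpa using hk⟩ fun r hr => ?_).prime
  rw [isUnit_iff_ne_zero]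
  rintro rfl
  exact hk (by simpa using hr k)

open scoped ComplexOrder in
lemma star_dotProduct_self_ne_zero {ℓ : Fin n → ℂ} (hℓ : ℓ ≠ 0) : star ℓ ⬝ᵥ ℓ ≠ 0 := by
  rwa [Ne, dotProduct_star_self_eq_zero]

/-- The orthogonal projection to the complement of `ℓ`. -/
noncomputable def orthProj (ℓ v : Fin n → ℂ) : Fin n → ℂ :=
  v - ((star ℓ ⬝ᵥ v) / (star ℓ ⬝ᵥ ℓ)) • ℓ

/-- `v - w` is a multiple of `ℓ`, and pairing with `ℓ̄`, which annihilates `w`, determines the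
factor. -/
lemma eq_orthProj_iff {ℓ : Fin n → ℂ} (hℓ : ℓ ≠ 0) {v w : Fin n → ℂ} :
    (star ℓ ⬝ᵥ w = 0 ∧ ∀ i j, (v i - w i) * ℓ j = (v j - w j) * ℓ i) ↔ w = orthProj ℓ v := by
  have hN := star_dotProduct_self_ne_zero hℓ
  constructor
  · rintro ⟨h0, h⟩
    ext i
    have h1 : (v i - w i) * (star ℓ ⬝ᵥ ℓ) = ℓ i * (star ℓ ⬝ᵥ v) := by
      have : star ℓ ⬝ᵥ v = star ℓ ⬝ᵥ (v - w) := by rw [dotProduct_sub, h0, sub_zero]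
      rw [this, dotProduct, dotProduct, Finset.mul_sum, Finset.mul_sum]
      refine Finset.sum_congr rfl fun j _ => ?_
      simp only [Pi.sub_apply]
      linear_combination star ℓ j * h i j
    simp only [orthProj, Pi.sub_apply, Pi.smul_apply, smul_eq_mul]
    field_simp
    linear_combination -h1
  · rintro rfl
    refine ⟨?_, fun i j => ?_⟩
    · rw [orthProj, dotProduct_sub, dotProduct_smul, smul_eq_mul]
      field_simp
      simp
    · simp only [orthProj, Pi.sub_apply, Pi.smul_apply, smul_eq_mul]
      ring

lemma dotProduct_eq_zero_iff_star (ℓ z : Fin n → ℂ) :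
    ℓ ⬝ᵥ z = 0 ↔ star ℓ ⬝ᵥ star z = 0 := by
  rw [← star_eq_zero, ← Matrix.star_dotProduct_star, dotProduct_comm]

/-- The gradient is the constant `ℓ ≠ 0`, so the saturation removes nothing. The gradient does not
involve `z` or `w`, hence the equations decouple into two projections. -/
lemma virtualCriticalPairs_linForm {ℓ : Fin n → ℂ} (hℓ : ℓ ≠ 0) (u v : Fin n → ℂ) :
    virtualCriticalPairs (Ideal.span {linForm ℓ}) u v =
      {(star (orthProj ℓ (star u)), orthProj ℓ v)} := by
  have hp := prime_linForm hℓ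
  ext ⟨z, w⟩
  have key : HalfCritical (linForm ℓ) z w v ∧
      HalfCritical (linForm ℓ) (star w) (star z) (star u) ↔
      star z = orthProj ℓ (star u) ∧ w = orthProj ℓ v := by
    rw [← eq_orthProj_iff hℓ, ← eq_orthProj_iff hℓ, ← dotProduct_eq_zero_iff_star]
    simp only [HalfCritical, eval_linForm, grad_linForm, dotProduct_eq_zero_iff_star ℓ (star w),
      star_star]
    tauto
  rw [Set.mem_singleton_iff, Prod.mk.injEq, ← star_inj (x := z), star_star, ← key]
  refine ⟨halfCritical_of_mem_virtualCriticalPairs hp, fun h => ?_⟩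
  exact mem_virtualCriticalPairs_of_grad_ne_zero hp h.1 h.2 (by simpa using hℓ) (by simpa using hℓ)

lemma criticalPoints_linForm {ℓ : Fin n → ℂ} (hℓ : ℓ ≠ 0) (u : Fin n → ℂ) :
    criticalPoints (Ideal.span {linForm ℓ}) u = {star (orthProj ℓ (star u))} := by
  ext z
  rw [mem_criticalPoints (prime_linForm hℓ), Set.mem_singleton_iff, ← star_inj (x := z), star_star,
    ← eq_orthProj_iff hℓ, ← dotProduct_eq_zero_iff_star]
  simp [HalfCritical, hℓ]

end LinearForm

/-! ### Irreducible components and addition of the counts -/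

section Components

lemma vanishingIdeal_of_prime {f : MvPolynomial (Fin n) ℂ} (hf : Prime f) :
    vanishingIdeal ℂ {z : Fin n → ℂ | eval z f = 0} = Ideal.span {f} := by
  have : (Ideal.span {f}).IsPrime := (Ideal.span_singleton_prime hf.ne_zero).2 hf
  have h : {z : Fin n → ℂ | eval z f = 0} = zeroLocus ℂ (Ideal.span {f}) := by
    ext z; rw [mem_zeroLocus_span_singleton]; rfl
  rw [h, IsPrime.vanishingIdeal_zeroLocus]

lemma componentIdeals_of_prime {f : MvPolynomial (Fin n) ℂ} (hf : Prime f)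
    {Y : Set (Fin n → ℂ)} (hY : Y = {z | eval z f = 0}) :
    componentIdeals Y = {Ideal.span {f}} := by
  have : (Ideal.span {f}).IsPrime := (Ideal.span_singleton_prime hf.ne_zero).2 hf
  rw [componentIdeals, hY, vanishingIdeal_of_prime hf, Ideal.minimalPrimes_eq_subsingleton_self]

lemma componentIdeals_of_prime_mul {f g : MvPolynomial (Fin n) ℂ} (hf : Prime f) (hg : Prime g)
    (hfg : ¬ f ∣ g) {Y : Set (Fin n → ℂ)} (hY : Y = {z | eval z f * eval z g = 0}) :
    componentIdeals Y = {Ideal.span {f}, Ideal.span {g}} := by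
  have hfp : (Ideal.span {f}).IsPrime := (Ideal.span_singleton_prime hf.ne_zero).2 hf
  have hgp : (Ideal.span {g}).IsPrime := (Ideal.span_singleton_prime hg.ne_zero).2 hg
  have hgf : ¬ g ∣ f := fun h => hfg ((hg.dvd_prime_iff_associated hf).1 h).symm.dvd
  have hle : ∀ {a b : MvPolynomial (Fin n) ℂ}, Ideal.span {a} ≤ Ideal.span {b} → b ∣ a :=
    fun h => Ideal.span_singleton_le_span_singleton.1 h
  have hvan : vanishingIdeal ℂ Y = Ideal.span {f} ⊓ Ideal.span {g} := by
    rw [← vanishingIdeal_of_prime hf, ← vanishingIdeal_of_prime hg, hY]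
    ext p
    simp only [mem_vanishingIdeal_iff, Ideal.mem_inf, Set.mem_ofPred_eq, mul_eq_zero]
    exact ⟨fun h => ⟨fun x hx => h x (Or.inl hx), fun x hx => h x (Or.inr hx)⟩,
      fun h x hx => hx.elim (h.1 x) (h.2 x)⟩
  rw [componentIdeals, hvan]
  ext p
  simp only [Ideal.minimalPrimes, Set.mem_ofPred_eq, Set.mem_insert_iff, Set.mem_singleton_iff]
  constructor
  · rintro ⟨⟨hp, hpl⟩, hmin⟩
    rcases (hp.inf_le).1 hpl with h | h
    · exact Or.inl (le_antisymm (hmin ⟨hfp, inf_le_left⟩ h) h)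
    · exact Or.inr (le_antisymm (hmin ⟨hgp, inf_le_right⟩ h) h)
  · rintro (rfl | rfl)
    · refine ⟨⟨hfp, inf_le_left⟩, fun q ⟨hq, hql⟩ hqp => ?_⟩
      rcases (hq.inf_le).1 hql with h | h
      · exact h
      · exact absurd (hle (h.trans hqp)) hfg
    · refine ⟨⟨hgp, inf_le_right⟩, fun q ⟨hq, hql⟩ hqp => ?_⟩
      rcases (hq.inf_le).1 hql with h | h
      · exact absurd (hle (h.trans hqp)) hgf
      · exact h

lemma encard_fiber {α β : Type*} (a : α) (S : α → Set β) :
    {p : α × β | p.1 = a ∧ p.2 ∈ S p.1}.encard = (S a).encard := by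
  have : {p : α × β | p.1 = a ∧ p.2 ∈ S p.1} = Prod.mk a '' S a := by
    ext ⟨x, y⟩
    simp only [Set.mem_ofPred_eq, Set.mem_image, Prod.mk.injEq]
    constructor
    · rintro ⟨rfl, h⟩; exact ⟨y, h, rfl, rfl⟩
    · rintro ⟨y', h, rfl, rfl⟩; exact ⟨rfl, h⟩
  rw [this, (Prod.mk_right_injective a).encard_image]

lemma encard_fiber_pair {α β : Type*} {a b : α} (hab : a ≠ b) (S : α → Set β) :
    {p : α × β | p.1 ∈ ({a, b} : Set α) ∧ p.2 ∈ S p.1}.encard =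
      (S a).encard + (S b).encard := by
  rw [← encard_fiber a, ← encard_fiber b, ← Set.encard_union_eq]
  · congr 1
    ext p
    simp only [Set.mem_ofPred_eq, Set.mem_insert_iff, Set.mem_singleton_iff, Set.mem_union]
    tauto
  · rw [Set.disjoint_left]
    rintro p ⟨h1, -⟩ ⟨h2, -⟩
    exact hab (h1.symm.trans h2)

lemma virtualCount_of_component {Y : Set (Fin n → ℂ)} {P : Ideal (MvPolynomial (Fin n) ℂ)}
    (h : componentIdeals Y = {P}) (u v : Fin n → ℂ) :
    virtualCount Y u v = (virtualCriticalPairs P u v).encard := by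
  simp only [virtualCount, h, Set.mem_singleton_iff]
  exact encard_fiber P fun P => virtualCriticalPairs P u v

lemma criticalCount_of_component {Y : Set (Fin n → ℂ)} {P : Ideal (MvPolynomial (Fin n) ℂ)}
    (h : componentIdeals Y = {P}) (u : Fin n → ℂ) :
    criticalCount Y u = (criticalPoints P u).encard := by
  simp only [criticalCount, h, Set.mem_singleton_iff]
  exact encard_fiber P fun P => criticalPoints P u

lemma hasVirtualHD_of_forall {Y : Set (Fin n → ℂ)} {N : ℕ} (h : ∀ u v, virtualCount Y u v = N) :
    HasVirtualHD Y N := ⟨1, one_ne_zero, fun u v _ => h u v⟩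

lemma HD_of_forall {Y : Set (Fin n → ℂ)} {N : ℕ} (h : ∀ u, criticalCount Y u = N) :
    HD Y = {N} := by
  ext k
  simp only [HD, Set.mem_ofPred_eq, Set.mem_singleton_iff]
  constructor
  · rintro ⟨U, -, ⟨u, hu⟩, hk⟩
    exact_mod_cast (hk u hu).symm.trans (h u)
  · rintro rfl
    exact ⟨Set.univ, isOpen_univ, Set.univ_nonempty, fun u _ => h u⟩

/-- The degrees of a hyperplane. -/
lemma degrees_of_linForm {ℓ : Fin n → ℂ} (hℓ : ℓ ≠ 0) {Y : Set (Fin n → ℂ)}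
    (hY : Y = {z | ℓ ⬝ᵥ z = 0}) : HasVirtualHD Y 1 ∧ HD Y = {1} := by
  have hc := componentIdeals_of_prime (prime_linForm hℓ) (Y := Y) (by simpa using hY)
  refine ⟨hasVirtualHD_of_forall fun u v => ?_, HD_of_forall fun u => ?_⟩
  · rw [virtualCount_of_component hc, virtualCriticalPairs_linForm hℓ]; simp
  · rw [criticalCount_of_component hc, criticalPoints_linForm hℓ]; simp

/-- The degrees of a union of two hyperplanes. -/
lemma degrees_of_linForm_mul {ℓ m : Fin n → ℂ} (hℓ : ℓ ≠ 0) (hm : m ≠ 0)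
    (hind : ∃ z, ℓ ⬝ᵥ z = 0 ∧ m ⬝ᵥ z ≠ 0) {Y : Set (Fin n → ℂ)}
    (hY : Y = {z | (ℓ ⬝ᵥ z) * (m ⬝ᵥ z) = 0}) : HasVirtualHD Y 2 ∧ HD Y = {2} := by
  have hdvd : ¬ linForm ℓ ∣ linForm m := by
    rintro ⟨q, hq⟩
    obtain ⟨z, h1, h2⟩ := hind
    have := congrArg (eval z) hq
    rw [map_mul, eval_linForm, eval_linForm, h1, zero_mul] at this
    exact h2 this
  have hne : Ideal.span {linForm ℓ} ≠ Ideal.span {linForm m} := fun h =>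
    hdvd (Ideal.span_singleton_le_span_singleton.1 h.ge)
  have hc := componentIdeals_of_prime_mul (prime_linForm hℓ) (prime_linForm hm) hdvd (Y := Y)
    (by simpa using hY)
  refine ⟨hasVirtualHD_of_forall fun u v => ?_, HD_of_forall fun u => ?_⟩
  · rw [virtualCount, hc, encard_fiber_pair hne fun P => virtualCriticalPairs P u v,
      virtualCriticalPairs_linForm hℓ, virtualCriticalPairs_linForm hm]
    simp only [Set.encard_singleton]; norm_num
  · rw [criticalCount, hc, encard_fiber_pair hne fun P => criticalPoints P u,
      criticalPoints_linForm hℓ, criticalPoints_linForm hm]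
    simp only [Set.encard_singleton]; norm_num

end Components

/-! ### Quadratic forms -/

section Quadric

variable {n : ℕ}

/-- The quadratic form with matrix `A`. -/
noncomputable def quadForm (A : Matrix (Fin n) (Fin n) ℂ) : MvPolynomial (Fin n) ℂ :=
  ∑ i, ∑ j, C (A i j) * (X i * X j)

@[simp] lemma eval_quadForm (A : Matrix (Fin n) (Fin n) ℂ) (z : Fin n → ℂ) :
    eval z (quadForm A) = z ⬝ᵥ A.mulVec z := by
  simp only [quadForm, map_sum, map_mul, eval_C, eval_X, dotProduct, Matrix.mulVec,
    Finset.mul_sum]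
  exact Finset.sum_congr rfl fun i _ => Finset.sum_congr rfl fun j _ => by ring

lemma pderiv_quadForm {A : Matrix (Fin n) (Fin n) ℂ} (hA : A.IsSymm) (k : Fin n) :
    pderiv k (quadForm A) = C 2 * linForm (A k) := by
  have h : ∀ i j : Fin n, pderiv k (C (A i j) * (X i * X j) : MvPolynomial (Fin n) ℂ) =
      (if i = k then C (A i j) * X j else 0) + if j = k then C (A i j) * X i else 0 := by
    intro i j
    rw [pderiv_C_mul, Derivation.leibniz, pderiv_X, pderiv_X]
    simp only [Pi.single_apply, smul_eq_mul]
    split_ifs <;> ring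
  simp only [quadForm, map_sum, h, Finset.sum_add_distrib]
  rw [Finset.sum_comm]
  simp only [Finset.sum_ite_eq', Finset.mem_univ, if_true, linForm]
  rw [← Finset.sum_add_distrib, Finset.mul_sum]
  refine Finset.sum_congr rfl fun i _ => ?_
  rw [hA.apply k i, map_ofNat C 2]
  ring

lemma grad_quadForm {A : Matrix (Fin n) (Fin n) ℂ} (hA : A.IsSymm) (z : Fin n → ℂ) :
    grad (quadForm A) z = (2 : ℂ) • A.mulVec z := by
  ext k
  simp only [grad, pderiv_quadForm hA, map_mul, eval_C, eval_linForm, Pi.smul_apply, smul_eq_mul,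
    Matrix.mulVec]

lemma exists_pderiv_eq_C {σ : Type*} {g : MvPolynomial σ ℂ} (hg : g.totalDegree ≤ 1) (i : σ) :
    ∃ a, pderiv i g = C a := by
  classical
  rw [g.as_sum, map_sum]
  have : ∀ d ∈ g.support, ∃ a : ℂ, pderiv i (monomial d (coeff d g)) = C a := by
    intro d hd
    have hdeg := (le_totalDegree hd).trans hg
    rw [pderiv_monomial]
    by_cases hi : d i = 0
    · exact ⟨0, by simp [hi]⟩
    · refine ⟨coeff d g * d i, ?_⟩
      have hle : Finsupp.single i 1 ≤ d := by
        rw [Finsupp.single_le_iff]; omega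
      have h0 : d - Finsupp.single i 1 = 0 := by
        rw [← Finsupp.degree_eq_zero_iff]
        have h1 : (d - Finsupp.single i 1).degree + (Finsupp.single i 1 : σ →₀ ℕ).degree =
            d.degree := by
          rw [← map_add, tsub_add_cancel_of_le hle]
        rw [Finsupp.degree_single] at h1
        have h2 : d.degree ≤ 1 := hdeg
        omega
      rw [h0]; rfl
  choose! a ha using this
  exact ⟨∑ d ∈ g.support, a d, by rw [map_sum]; exact Finset.sum_congr rfl ha⟩

end Quadric

/-- In a proper factorization both factors have degree 1, with constant gradients `l` and `m`.
Comparing second derivatives gives `2A = l mᵀ + m lᵀ`, a matrix of rank at most 2, against `det A ≠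
0`. -/
lemma prime_quadForm {A : Matrix (Fin 3) (Fin 3) ℂ} (hA : A.IsSymm) (hdet : A.det ≠ 0) :
    Prime (quadForm A) := by
  have hder : ∀ i j, pderiv j (pderiv i (quadForm A)) = C (2 * A i j) := by
    intro i j
    rw [pderiv_quadForm hA, pderiv_C_mul, C_mul]
    congr 1
    simp [linForm, pderiv_X, Pi.single_apply]
  have hconst : ∀ r, quadForm A ≠ C r := by
    intro r h
    refine hdet ?_
    have : A = 0 := by
      ext i j
      have := hder i j
      rw [h, pderiv_C, map_zero] at this
      simpa using (C_eq_zero.1 this.symm)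
    rw [this, Matrix.det_zero]
  have hne : quadForm A ≠ 0 := by simpa using hconst 0
  have hdeg : (quadForm A).totalDegree ≤ 2 := by
    refine (totalDegree_finsetSum _ _).trans (Finset.sup_le fun i _ => ?_)
    refine (totalDegree_finsetSum _ _).trans (Finset.sup_le fun j _ => ?_)
    refine (totalDegree_mul _ _).trans ?_
    rw [totalDegree_C, zero_add]
    refine (totalDegree_mul _ _).trans ?_
    simp
  have hlow : ∀ {g h : MvPolynomial (Fin 3) ℂ}, quadForm A = g * h → g.totalDegree ≤ 1 →
      h.totalDegree ≤ 1 → False := by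
    intro g h hgh hg hh
    choose l hl using exists_pderiv_eq_C hg
    choose m hm using exists_pderiv_eq_C hh
    have hA2 : ∀ i j, 2 * A i j = l i * m j + l j * m i := by
      intro i j
      rw [← (C_injective (Fin 3) ℂ).eq_iff, ← hder, hgh, Derivation.leibniz, map_add]
      simp only [hl, hm, smul_eq_mul, Derivation.leibniz, pderiv_C, map_add, map_mul]
      ring
    refine hdet ?_
    have : (8 : ℂ) * A.det = 0 := by
      rw [Matrix.det_fin_three]
      have e : ∀ i j, A i j = (l i * m j + l j * m i) / 2 := fun i j => by
        rw [← hA2]; ring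
      simp only [e]
      ring
    simpa using this
  have hunit : ∀ {g h : MvPolynomial (Fin 3) ℂ}, quadForm A = g * h → g.totalDegree = 0 →
      IsUnit g := by
    intro g h hgh hg
    rw [totalDegree_eq_zero_iff_eq_C] at hg
    rw [hg, isUnit_map_iff, isUnit_iff_ne_zero]
    rintro h0
    rw [h0, C_0] at hg
    rw [hg, zero_mul] at hgh
    exact hne hgh
  refine Irreducible.prime ⟨fun hu => ?_, fun g h hgh => ?_⟩
  · rw [MvPolynomial.isUnit_iff_eq_C_of_isReduced] at hu
    obtain ⟨r, -, hr⟩ := hu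
    exact hconst r hr
  · have hg0 : g ≠ 0 := by rintro rfl; exact hne (by rw [hgh, zero_mul])
    have hh0 : h ≠ 0 := by rintro rfl; exact hne (by rw [hgh, mul_zero])
    rw [hgh, totalDegree_mul_of_isDomain hg0 hh0] at hdeg
    by_cases h1 : g.totalDegree = 0
    · exact Or.inl (hunit hgh h1)
    by_cases h2 : h.totalDegree = 0
    · exact Or.inr (hunit (hgh.trans (mul_comm g h)) h2)
    exact (hlow hgh (by omega) (by omega)).elim

/-- The pairs of nonsingular points with `v - w` normal to the conic at `z` and `u - z` normal
to the conjugate conic at `w`. -/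
def normalPairs (A : Matrix (Fin 3) (Fin 3) ℂ) (u v : Fin 3 → ℂ) :
    Set ((Fin 3 → ℂ) × (Fin 3 → ℂ)) :=
  {p | p.1 ≠ 0 ∧ p.2 ≠ 0 ∧ p.1 ⬝ᵥ A.mulVec p.1 = 0 ∧ star p.2 ⬝ᵥ A.mulVec (star p.2) = 0 ∧
    (∃ l : ℂ, v - p.2 = l • A.mulVec p.1) ∧ ∃ m : ℂ, star u - star p.1 = m • A.mulVec (star p.2)}

lemma minors_iff_exists_smul {n : ℕ} {d g : Fin n → ℂ} (hg : g ≠ 0) :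
    (∀ i j, d i * g j = d j * g i) ↔ ∃ l : ℂ, d = l • g := by
  constructor
  · intro h
    obtain ⟨j, hj⟩ := Function.ne_iff.1 hg
    simp only [Pi.zero_apply] at hj
    refine ⟨d j / g j, funext fun i => ?_⟩
    simp only [Pi.smul_apply, smul_eq_mul]
    field_simp
    linear_combination h i j
  · rintro ⟨l, rfl⟩ i j
    simp only [Pi.smul_apply, smul_eq_mul]
    ring

/-! ### Critical pairs of a nonsingular conic -/

section Conic

variable {A : Matrix (Fin 3) (Fin 3) ℂ}

lemma grad_quadForm_ne_zero (hA : A.IsSymm) (hdet : A.det ≠ 0) {z : Fin 3 → ℂ} :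
    grad (quadForm A) z ≠ 0 ↔ z ≠ 0 := by
  rw [grad_quadForm hA, Ne, smul_eq_zero, or_iff_right two_ne_zero, not_iff_not]
  exact ⟨Matrix.eq_zero_of_mulVec_eq_zero hdet, fun h => by rw [h, Matrix.mulVec_zero]⟩

lemma halfCritical_quadForm (hA : A.IsSymm) (hdet : A.det ≠ 0) {z w v : Fin 3 → ℂ} (hz : z ≠ 0) :
    HalfCritical (quadForm A) z w v ↔
      z ⬝ᵥ A.mulVec z = 0 ∧ ∃ l : ℂ, v - w = l • A.mulVec z := by
  rw [HalfCritical, eval_quadForm]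
  refine and_congr_right fun _ => ?_
  have := minors_iff_exists_smul (d := v - w) ((grad_quadForm_ne_zero hA hdet).2 hz)
  simp only [Pi.sub_apply] at this
  rw [this, grad_quadForm hA]
  constructor
  · rintro ⟨l, hl⟩; exact ⟨l * 2, by rw [hl, smul_smul]⟩
  · rintro ⟨l, hl⟩; exact ⟨l / 2, by rw [hl, smul_smul]; congr 1; ring⟩

lemma mem_normalPairs (hA : A.IsSymm) (hdet : A.det ≠ 0) {z w u v : Fin 3 → ℂ} :
    (z, w) ∈ normalPairs A u v ↔ z ≠ 0 ∧ w ≠ 0 ∧ HalfCritical (quadForm A) z w v ∧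
      HalfCritical (quadForm A) (star w) (star z) (star u) := by
  simp only [normalPairs, Set.mem_ofPred_eq]
  refine and_congr_right fun hz => and_congr_right fun hw => ?_
  rw [halfCritical_quadForm hA hdet hz, halfCritical_quadForm hA hdet (star_ne_zero.2 hw)]
  tauto

/-- The saturation could still contain limit points with `z = 0` or `w = 0`. At the points kept, `v
- w = l A z` lies on the dual conic: `(v - w)ᵀ A⁻¹ (v - w) = l² zᵀ A z = 0`. This equation persists
in the saturation, and `w = 0` would put `v` on the dual conic; likewise for `z` and `ū`. -/
lemma virtualCriticalPairs_quadForm (hA : A.IsSymm) (hdet : A.det ≠ 0) {u v : Fin 3 → ℂ}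
    (hu : star u ⬝ᵥ A⁻¹.mulVec (star u) ≠ 0) (hv : v ⬝ᵥ A⁻¹.mulVec v ≠ 0) :
    virtualCriticalPairs (Ideal.span {quadForm A}) u v = normalPairs A u v := by
  have hp := prime_quadForm hA hdet
  have hinv : ∀ x, A⁻¹.mulVec (A.mulVec x) = x := fun x => by
    rw [Matrix.mulVec_mulVec, Matrix.nonsing_inv_mul A (isUnit_iff_ne_zero.2 hdet),
      Matrix.one_mulVec]
  set h : Ring4 3 := ∑ i, ∑ j, C (A⁻¹ i j) * ((X (Block.v, i) - X (Block.w, i)) *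
    (X (Block.v, j) - X (Block.w, j))) with h_def
  have heval : ∀ z w u v : Fin 3 → ℂ,
      eval (point4 z w u v) h = (v - w) ⬝ᵥ A⁻¹.mulVec (v - w) := by
    intro z w u v
    simp only [h_def, map_sum, map_mul, map_sub, eval_C, eval_X, dotProduct, Matrix.mulVec,
      Finset.mul_sum, point4, Pi.sub_apply]
    exact Finset.sum_congr rfl fun i _ => Finset.sum_congr rfl fun j _ => by ring
  have hvan : ∀ z w v : Fin 3 → ℂ, HalfCritical (quadForm A) z w v →
      grad (quadForm A) z ≠ 0 → (v - w) ⬝ᵥ A⁻¹.mulVec (v - w) = 0 := by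
    intro z w v hz hg
    rw [grad_quadForm_ne_zero hA hdet] at hg
    obtain ⟨h0, l, hl⟩ := (halfCritical_quadForm hA hdet hg).1 hz
    rw [hl, Matrix.mulVec_smul, hinv, smul_dotProduct, dotProduct_smul, dotProduct_comm, h0,
      smul_zero, smul_zero]
  ext ⟨z, w⟩
  rw [mem_normalPairs hA hdet]
  constructor
  · intro hm
    obtain ⟨h1, h2⟩ := halfCritical_of_mem_virtualCriticalPairs hp hm
    have e1 : (v - w) ⬝ᵥ A⁻¹.mulVec (v - w) = 0 := by
      rw [← heval z w u v]
      refine eval_eq_zero_of_mem_virtualCriticalPairs hp (fun z w u v a b c d => ?_) hm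
      rw [heval]; exact hvan z w v a c
    have e2 : (star u - star z) ⬝ᵥ A⁻¹.mulVec (star u - star z) = 0 := by
      rw [← star_eq_zero, ← heval (star w) (star z) (star v) (star u), ← eval_starMap]
      refine eval_eq_zero_of_mem_virtualCriticalPairs hp (fun z w u v a b c d => ?_) hm
      rw [eval_starMap, heval, star_eq_zero]; exact hvan _ _ _ b d
    refine ⟨?_, ?_, h1, h2⟩
    · rintro rfl; exact hu (by simpa using e2)
    · rintro rfl; exact hv (by simpa using e1)
  · rintro ⟨hz, hw, h1, h2⟩
    exact mem_virtualCriticalPairs_of_grad_ne_zero hp h1 h2 ((grad_quadForm_ne_zero hA hdet).2 hz)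
      ((grad_quadForm_ne_zero hA hdet).2 (star_ne_zero.2 hw))

lemma criticalPoints_quadForm (hA : A.IsSymm) (hdet : A.det ≠ 0) (u : Fin 3 → ℂ) :
    criticalPoints (Ideal.span {quadForm A}) u = {z | (z, star z) ∈ normalPairs A u (star u)} := by
  ext z
  rw [mem_criticalPoints (prime_quadForm hA hdet), grad_quadForm_ne_zero hA hdet,
    Set.mem_ofPred_eq, mem_normalPairs hA hdet, star_star, star_ne_zero]
  tauto

lemma componentIdeals_conic (hA : A.IsSymm) (hdet : A.det ≠ 0) :
    componentIdeals (conic A) = {Ideal.span {quadForm A}} :=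
  componentIdeals_of_prime (prime_quadForm hA hdet) (by simp [conic])

lemma virtualCount_conic (hA : A.IsSymm) (hdet : A.det ≠ 0) {u v : Fin 3 → ℂ}
    (hu : star u ⬝ᵥ A⁻¹.mulVec (star u) ≠ 0) (hv : v ⬝ᵥ A⁻¹.mulVec v ≠ 0) :
    virtualCount (conic A) u v = (normalPairs A u v).encard := by
  rw [virtualCount_of_component (componentIdeals_conic hA hdet),
    virtualCriticalPairs_quadForm hA hdet hu hv]

lemma criticalCount_conic (hA : A.IsSymm) (hdet : A.det ≠ 0) (u : Fin 3 → ℂ) :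
    criticalCount (conic A) u = {z | (z, star z) ∈ normalPairs A u (star u)}.encard := by
  rw [criticalCount_of_component (componentIdeals_conic hA hdet),
    criticalPoints_quadForm hA hdet]

end Conic

/-! ### Takagi factorization and singular values -/

section Takagi

variable {n : ℕ} {A : Matrix (Fin n) (Fin n) ℂ}

lemma star_dotProduct_self (y : Fin n → ℂ) :
    star y ⬝ᵥ y = ((∑ k, Complex.normSq (y k) : ℝ) : ℂ) := by
  rw [dotProduct, Complex.ofReal_sum]
  exact Finset.sum_congr rfl fun k _ => (Complex.normSq_eq_conj_mul_self).symm

lemma dotProduct_mulVec_comm (hA : A.IsSymm) (x y : Fin n → ℂ) :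
    x ⬝ᵥ A.mulVec y = y ⬝ᵥ A.mulVec x := by
  rw [Matrix.dotProduct_mulVec, ← Matrix.mulVec_transpose, hA.eq, dotProduct_comm]

/-- The antilinear map `x ↦ conj (A x)` has an eigenvector with nonnegative eigenvalue in every
nonzero invariant subspace. -/
lemma exists_coneigenvector (hA : A.IsSymm) (W : Submodule ℂ (Fin n → ℂ)) (hW : W ≠ ⊥)
    (hinv : ∀ x ∈ W, star (A.mulVec x) ∈ W) :
    ∃ x ∈ W, x ≠ 0 ∧ ∃ σ : ℝ, 0 ≤ σ ∧ A.mulVec x = (σ : ℂ) • star x := by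
  -- The square of the antilinear map is the linear map `Ā A`, which has an eigenvector in the
  -- invariant subspace.
  have hM : ∀ x, (A.map star * A).mulVec x = star (A.mulVec (star (A.mulVec x))) := by
    intro x
    rw [← Matrix.mulVec_mulVec]
    ext i
    simp [Matrix.mulVec, dotProduct]
  have hMW : ∀ x ∈ W, (A.map star * A).mulVecLin x ∈ W := fun x hx => by
    rw [Matrix.mulVecLin_apply, hM]; exact hinv _ (hinv _ hx)
  have : Nontrivial W := Submodule.nontrivial_iff_ne_bot.2 hW
  obtain ⟨τ, hτ⟩ := Module.End.exists_eigenvalue ((A.map star * A).mulVecLin.restrict hMW)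
  obtain ⟨⟨x, hxW⟩, hx⟩ := hτ.exists_hasEigenvector
  have hx0 : x ≠ 0 := fun h => hx.2 (Subtype.ext h)
  have hxe : star (A.mulVec (star (A.mulVec x))) = τ • x := by
    rw [← hM]; exact congrArg Subtype.val hx.apply_eq_smul
  -- Symmetry of `A` gives `τ ‖x‖² = ‖A x‖²`.
  have hτr : ∃ r : ℝ, 0 ≤ r ∧ τ = r := by
    have h1 : τ * (star x ⬝ᵥ x) = star (A.mulVec x) ⬝ᵥ A.mulVec x := by
      rw [← smul_eq_mul, ← dotProduct_smul, ← hxe, Matrix.star_dotProduct_star, dotProduct_comm,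
        dotProduct_mulVec_comm hA, star_dotProduct_self, Complex.star_def, Complex.conj_ofReal]
    have hpos : star x ⬝ᵥ x ≠ 0 := star_dotProduct_self_ne_zero hx0
    rw [star_dotProduct_self] at hpos
    rw [star_dotProduct_self, star_dotProduct_self] at h1
    refine ⟨(∑ k, Complex.normSq (A.mulVec x k)) / ∑ k, Complex.normSq (x k), ?_, ?_⟩
    · exact div_nonneg (Finset.sum_nonneg fun _ _ => Complex.normSq_nonneg _)
        (Finset.sum_nonneg fun _ _ => Complex.normSq_nonneg _)
    · rw [Complex.ofReal_div, eq_div_iff hpos, h1]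
  obtain ⟨r, hr0, rfl⟩ := hτr
  have hsq : ((√r : ℝ) : ℂ) * (√r : ℝ) = r := by rw [← Complex.ofReal_mul, Real.mul_self_sqrt hr0]
  have hreal : star ((√r : ℝ) : ℂ) = (√r : ℝ) := Complex.conj_ofReal _
  -- The antilinear map `S` satisfies `S² x = r x`, so `S x + √r x` is an eigenvector for `√r`
  -- unless it vanishes. If it vanishes, then `S x = -√r x`, and `i x` has the eigenvalue `√r`
  -- because `S` is antilinear.
  by_cases hy : star (A.mulVec x) + ((√r : ℝ) : ℂ) • x = 0
  · refine ⟨Complex.I • x, W.smul_mem _ hxW, smul_ne_zero Complex.I_ne_zero hx0, √r,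
      Real.sqrt_nonneg r, ?_⟩
    have : A.mulVec x = -(((√r : ℝ) : ℂ) • star x) := by
      rw [← star_star (A.mulVec x), eq_neg_of_add_eq_zero_left hy, star_neg, star_smul, hreal]
    rw [Matrix.mulVec_smul, this, star_smul, Complex.star_def, Complex.conj_I, smul_neg, neg_smul,
      smul_neg, smul_comm]
  · refine ⟨_, W.add_mem (hinv x hxW) (W.smul_mem _ hxW), hy, √r, Real.sqrt_nonneg r, ?_⟩
    rw [Matrix.mulVec_add, Matrix.mulVec_smul, star_add, star_star, star_smul, hreal, smul_add,
      smul_smul, hsq, add_comm]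
    congr 1
    rw [← star_star (A.mulVec (star (A.mulVec x))), hxe, star_smul]
    simp

/-- The orthogonal complement of the vectors already found is invariant under `x ↦ conj (A x)`: the
product of `vᵢ` with `conj (A x)` is the conjugate of `vᵢᵀ A x = xᵀ A vᵢ = aᵢ xᵀ v̄ᵢ = 0`. So the
next vector can be taken there. -/
lemma exists_orthonormal_coneigenvectors (hA : A.IsSymm) (k : ℕ) (hk : k ≤ n) :
    ∃ (v : Fin k → Fin n → ℂ) (a : Fin k → ℝ),
      (∀ i j, star (v i) ⬝ᵥ v j = if i = j then 1 else 0) ∧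
      ∀ i, 0 ≤ a i ∧ A.mulVec (v i) = (a i : ℂ) • star (v i) := by
  induction k with
  | zero => exact ⟨Fin.elim0, Fin.elim0, fun i => i.elim0, fun i => i.elim0⟩
  | succ k ih =>
    obtain ⟨v, a, hv, ha⟩ := ih (by omega)
    set V : Matrix (Fin k) (Fin n) ℂ := Matrix.of fun i => star (v i)
    have hmem : ∀ x, x ∈ LinearMap.ker V.mulVecLin ↔ ∀ i, star (v i) ⬝ᵥ x = 0 := by
      intro x
      rw [LinearMap.mem_ker, funext_iff]
      rfl
    have hne : LinearMap.ker V.mulVecLin ≠ ⊥ := by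
      refine LinearMap.ker_ne_bot_of_finrank_lt ?_
      rw [Module.finrank_fin_fun, Module.finrank_fin_fun]; omega
    have hinv : ∀ x ∈ LinearMap.ker V.mulVecLin,
        star (A.mulVec x) ∈ LinearMap.ker V.mulVecLin := by
      intro x hx
      rw [hmem] at hx ⊢
      intro i
      rw [Matrix.star_dotProduct_star, dotProduct_comm, dotProduct_mulVec_comm hA, (ha i).2,
        dotProduct_smul, dotProduct_comm, hx i, smul_zero, star_zero]
    obtain ⟨x, hxW, hx0, σ, hσ, hx⟩ := exists_coneigenvector hA _ hne hinv
    rw [hmem] at hxW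
    set N : ℝ := ∑ k, Complex.normSq (x k) with hN
    have hNN : star x ⬝ᵥ x = (N : ℂ) := star_dotProduct_self x
    have hN0 : 0 < N := by
      refine lt_of_le_of_ne (Finset.sum_nonneg fun _ _ => Complex.normSq_nonneg _) fun h => ?_
      have := star_dotProduct_self_ne_zero hx0
      rw [hNN, ← h] at this
      exact this Complex.ofReal_zero
    set c : ℝ := (√N)⁻¹ with hc
    have hcc : (c : ℂ) * (c * N) = 1 := by
      rw [← Complex.ofReal_mul, ← Complex.ofReal_mul, ← Complex.ofReal_one, Complex.ofReal_inj, hc]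
      have := (Real.sqrt_pos.2 hN0).ne'
      field_simp
      exact (Real.sq_sqrt hN0.le).symm
    have hstar : star ((c : ℂ) • x) = (c : ℂ) • star x := by
      rw [star_smul, Complex.star_def, Complex.conj_ofReal]
    refine ⟨Fin.cons ((c : ℂ) • x) v, Fin.cons σ a, ?_, ?_⟩
    · intro i j
      refine Fin.cases ?_ (fun i => ?_) i <;> refine Fin.cases ?_ (fun j => ?_) j
      · simp only [Fin.cons_zero, if_true, hstar, smul_dotProduct, dotProduct_smul, hNN,
          smul_eq_mul, hcc]
      · rw [Fin.cons_zero, Fin.cons_succ, hstar, smul_dotProduct, Matrix.star_dotProduct,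
          hxW j, star_zero, smul_zero, if_neg (Fin.succ_ne_zero j).symm]
      · rw [Fin.cons_zero, Fin.cons_succ, dotProduct_smul, hxW i, smul_zero,
          if_neg (Fin.succ_ne_zero i)]
      · simp only [Fin.cons_succ, hv, Fin.succ_inj]
    · intro i
      refine Fin.cases ?_ (fun i => ?_) i
      · simp only [Fin.cons_zero]
        refine ⟨hσ, ?_⟩
        rw [Matrix.mulVec_smul, hx, hstar, smul_comm]
      · simpa only [Fin.cons_succ] using ha i

/-- **Takagi factorization** of a complex symmetric matrix. -/
theorem exists_takagi (hA : A.IsSymm) : ∃ (U : Matrix (Fin n) (Fin n) ℂ) (a : Fin n → ℝ),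
    U * U.conjTranspose = 1 ∧ (∀ i, 0 ≤ a i) ∧
      A = U.transpose * Matrix.diagonal (fun i => (a i : ℂ)) * U := by
  obtain ⟨v, a, hv, ha⟩ := exists_orthonormal_coneigenvectors hA n le_rfl
  set U : Matrix (Fin n) (Fin n) ℂ := Matrix.of fun i => star (v i) with hU
  have h1 : U * U.conjTranspose = 1 := by
    ext i j
    rw [Matrix.mul_apply, Matrix.one_apply, ← hv i j]
    simp [hU, dotProduct]
  have h2 : A * U.conjTranspose = U.transpose * Matrix.diagonal (fun i => (a i : ℂ)) := by
    ext i j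
    rw [Matrix.mul_diagonal]
    have := congrFun (ha j).2 i
    simp only [Matrix.mulVec, dotProduct, Pi.smul_apply, smul_eq_mul, Pi.star_apply] at this
    rw [Matrix.mul_apply]
    simp only [hU, Matrix.conjTranspose_apply, Matrix.transpose_apply, Matrix.of_apply,
      Pi.star_apply, star_star]
    rw [this, mul_comm]
  refine ⟨U, a, h1, fun i => (ha i).1, ?_⟩
  rw [← h2, mul_assoc, mul_eq_one_comm.1 h1, mul_one]

variable {U : Matrix (Fin n) (Fin n) ℂ} {a : Fin n → ℝ}

lemma isUnit_det_of_mul_conjTranspose (hU : U * U.conjTranspose = 1) : IsUnit U.det :=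
  (Matrix.isUnit_iff_isUnit_det U).1 (IsUnit.of_mul_eq_one _ hU)

lemma rank_takagi (hU : U * U.conjTranspose = 1)
    (hAU : A = U.transpose * Matrix.diagonal (fun i => (a i : ℂ)) * U) :
    A.rank = Fintype.card {i // a i ≠ 0} := by
  classical
  have hdet := isUnit_det_of_mul_conjTranspose hU
  rw [hAU, Matrix.rank_mul_eq_left_of_isUnit_det _ _ hdet,
    Matrix.rank_mul_eq_right_of_isUnit_det _ _ (by rwa [Matrix.det_transpose]),
    Matrix.rank_diagonal]
  exact Fintype.card_congr (Equiv.subtypeEquivRight fun i => by simp)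

lemma conjTranspose_mul_self_takagi (hU : U * U.conjTranspose = 1)
    (hAU : A = U.transpose * Matrix.diagonal (fun i => (a i : ℂ)) * U) :
    A.conjTranspose * A = U.conjTranspose * Matrix.diagonal (fun i => (a i : ℂ) ^ 2) * U := by
  have h1 : U.transpose.conjTranspose * U.transpose = 1 := by
    have := congrArg Matrix.transpose hU
    rw [Matrix.transpose_mul, Matrix.transpose_one] at this
    exact this
  have h2 : (Matrix.diagonal (fun i => (a i : ℂ))).conjTranspose =
      Matrix.diagonal (fun i => (a i : ℂ)) := by
    rw [Matrix.diagonal_conjTranspose]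
    congr 1
    ext i
    exact Complex.conj_ofReal _
  have h3 : Matrix.diagonal (fun i => (a i : ℂ) ^ 2) =
      Matrix.diagonal (fun i => (a i : ℂ)) * Matrix.diagonal (fun i => (a i : ℂ)) := by
    rw [Matrix.diagonal_mul_diagonal]; simp [sq]
  rw [hAU, Matrix.conjTranspose_mul, Matrix.conjTranspose_mul, h2, h3]
  calc U.conjTranspose * (Matrix.diagonal (fun i => (a i : ℂ)) * U.transpose.conjTranspose) *
      (U.transpose * Matrix.diagonal (fun i => (a i : ℂ)) * U)
      = U.conjTranspose * Matrix.diagonal (fun i => (a i : ℂ)) *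
        (U.transpose.conjTranspose * U.transpose) * Matrix.diagonal (fun i => (a i : ℂ)) * U := by
        simp only [Matrix.mul_assoc]
    _ = _ := by rw [h1, Matrix.mul_one]; simp only [Matrix.mul_assoc]

end Takagi

/-- `A* A = U* diag(a²) U` has the eigenvalues `aᵢ²`, with the columns of `U*` as eigenvectors.
Squares determine nonnegative numbers. -/
lemma singularValueSet_takagi {A U : Matrix (Fin 3) (Fin 3) ℂ} {a : Fin 3 → ℝ}
    (hU : U * U.conjTranspose = 1) (ha : ∀ i, 0 ≤ a i)
    (hAU : A = U.transpose * Matrix.diagonal (fun i => (a i : ℂ)) * U) :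
    singularValueSet A = Set.range a := by
  set T := Matrix.toEuclideanLin A with hT
  have hadj : ∀ x : EuclideanSpace ℂ (Fin 3), (LinearMap.adjoint T ∘ₗ T) x =
      WithLp.toLp 2 ((A.conjTranspose * A).mulVec x.ofLp) := by
    intro x
    rw [LinearMap.comp_apply, hT, ← Matrix.toEuclideanLin_conjTranspose_eq_adjoint,
      Matrix.toLpLin_apply, Matrix.toLpLin_apply, Matrix.mulVec_mulVec]
  have hUU := mul_eq_one_comm.1 hU
  have hM := conjTranspose_mul_self_takagi hU hAU
  have hfin : Module.finrank ℂ (EuclideanSpace ℂ (Fin 3)) = 3 := by simp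
  ext σ
  constructor
  · rintro ⟨i, rfl⟩
    obtain ⟨x, hx⟩ := (LinearMap.hasEigenvalue_adjoint_comp_self_sq_singularValues T
      (n := i) (by rw [hfin]; exact i.2)).exists_hasEigenvector
    have h1 := hx.apply_eq_smul
    rw [hadj] at h1
    have h2 : (A.conjTranspose * A).mulVec x.ofLp = ((T.singularValues i : ℂ) ^ 2) • x.ofLp := by
      have := congrArg WithLp.ofLp h1
      simpa using this
    have h3 : (Matrix.diagonal (fun i => (a i : ℂ) ^ 2)).mulVec (U.mulVec x.ofLp) =
        ((T.singularValues i : ℂ) ^ 2) • U.mulVec x.ofLp := by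
      rw [← Matrix.mulVec_smul, ← h2, hM, Matrix.mulVec_mulVec, Matrix.mulVec_mulVec,
        ← Matrix.mul_assoc, ← Matrix.mul_assoc, hU, Matrix.one_mul]
    have hne : U.mulVec x.ofLp ≠ 0 := by
      intro h
      have : x.ofLp = 0 := Matrix.eq_zero_of_mulVec_eq_zero
        (isUnit_det_of_mul_conjTranspose hU).ne_zero h
      exact hx.2 (by ext i; simp [this])
    obtain ⟨j, hj⟩ := Function.ne_iff.1 hne
    have h4 := congrFun h3 j
    rw [Matrix.mulVec_diagonal, Pi.smul_apply, smul_eq_mul] at h4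
    have h5 := mul_right_cancel₀ hj h4
    refine ⟨j, ?_⟩
    have h6 : a j ^ 2 = T.singularValues i ^ 2 := by exact_mod_cast h5
    exact (sq_eq_sq₀ (ha j) (T.singularValues_nonneg i)).1 h6
  · rintro ⟨j, rfl⟩
    have hev : Module.End.HasEigenvalue (LinearMap.adjoint T ∘ₗ T) ((a j : ℂ) ^ 2) := by
      refine Module.End.hasEigenvalue_of_hasEigenvector
        (x := WithLp.toLp 2 (U.conjTranspose.mulVec (Pi.single j 1))) ⟨?_, ?_⟩
      · rw [Module.End.mem_eigenspace_iff, hadj, hM]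
        have : (U.conjTranspose * Matrix.diagonal (fun i => (a i : ℂ) ^ 2) * U).mulVec
            (U.conjTranspose.mulVec (Pi.single j 1)) =
            ((a j : ℂ) ^ 2) • U.conjTranspose.mulVec (Pi.single j 1) := by
          rw [Matrix.mulVec_mulVec, Matrix.mul_assoc, hU, Matrix.mul_one, ← Matrix.mulVec_mulVec,
            ← Matrix.mulVec_smul]
          congr 1
          ext i
          rw [Matrix.mulVec_diagonal]
          by_cases hij : i = j
          · subst hij; simp
          · simp [hij]
        rw [this]; rfl
      · intro h
        have h1 : U.conjTranspose.mulVec (Pi.single j 1) = 0 := congrArg WithLp.ofLp h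
        have h2 := congrArg U.mulVec h1
        rw [Matrix.mulVec_mulVec, hU, Matrix.one_mulVec, Matrix.mulVec_zero] at h2
        simpa using congrFun h2 j
    obtain ⟨i, hi⟩ := T.isSymmetric_adjoint_comp_self.exists_eigenvalues_eq hfin hev
    refine ⟨i, ?_⟩
    have h1 := T.sq_singularValues_fin hfin i
    have h2 : T.singularValues i ^ 2 = a j ^ 2 := by
      rw [h1]
      exact RCLike.ofReal_injective (K := ℂ) (by rw [hi]; push_cast; rfl)
    exact (sq_eq_sq₀ (T.singularValues_nonneg i) (ha j)).1 h2

/-! ### Conditions that hold on a non-empty Zariski open set -/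

section Generic

variable {n : ℕ}

/-- `Q u v` holds for all `(u, v)` in a non-empty Zariski open set. -/
def Generic (Q : (Fin n → ℂ) → (Fin n → ℂ) → Prop) : Prop :=
  ∃ g : MvPolynomial (Fin n ⊕ Fin n) ℂ, g ≠ 0 ∧
    ∀ u v : Fin n → ℂ, eval (Sum.elim u v) g ≠ 0 → Q u v

variable {Q Q' : (Fin n → ℂ) → (Fin n → ℂ) → Prop}

lemma Generic.mono (h : Generic Q) (hQ : ∀ u v, Q u v → Q' u v) : Generic Q' := by
  obtain ⟨g, hg, h⟩ := h
  exact ⟨g, hg, fun u v huv => hQ u v (h u v huv)⟩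

lemma Generic.and (h : Generic Q) (h' : Generic Q') : Generic fun u v => Q u v ∧ Q' u v := by
  obtain ⟨g, hg, h⟩ := h
  obtain ⟨g', hg', h'⟩ := h'
  refine ⟨g * g', mul_ne_zero hg hg', fun u v huv => ?_⟩
  rw [map_mul] at huv
  exact ⟨h u v (left_ne_zero_of_mul huv), h' u v (right_ne_zero_of_mul huv)⟩

lemma Generic.of_eval (g : MvPolynomial (Fin n ⊕ Fin n) ℂ) {u₀ v₀ : Fin n → ℂ}
    (h₀ : eval (Sum.elim u₀ v₀) g ≠ 0) : Generic fun u v => eval (Sum.elim u v) g ≠ 0 :=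
  ⟨g, fun h => h₀ (by rw [h, map_zero]), fun _ _ h => h⟩

/-- Genericity is invariant under invertible linear changes of the coordinates. -/
lemma Generic.comp_mulVec (h : Generic Q) {L K L' K' : Matrix (Fin n) (Fin n) ℂ}
    (hL : L * L' = 1) (hK : K * K' = 1) : Generic fun u v => Q (L.mulVec u) (K.mulVec v) := by
  obtain ⟨g, hg, h⟩ := h
  set φ : Fin n ⊕ Fin n → MvPolynomial (Fin n ⊕ Fin n) ℂ :=
    Sum.elim (fun i => rename Sum.inl (linForm (L i))) (fun i => rename Sum.inr (linForm (K i)))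
    with hφ
  have hev : ∀ u v, eval (Sum.elim u v) (bind₁ φ g) =
      eval (Sum.elim (L.mulVec u) (K.mulVec v)) g := by
    intro u v
    rw [← aeval_eq_eval, aeval_bind₁, ← aeval_eq_eval]
    congr 1
    congr 1
    ext i
    rcases i with i | i <;>
      simp [hφ, aeval_eq_eval, eval_rename, Matrix.mulVec]
  refine ⟨bind₁ φ g, fun h0 => hg ?_, fun u v huv => h _ _ (by rwa [← hev])⟩
  refine MvPolynomial.funext fun x => ?_
  have h1 := hev (L'.mulVec (x ∘ Sum.inl)) (K'.mulVec (x ∘ Sum.inr))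
  rw [h0, map_zero, Matrix.mulVec_mulVec, Matrix.mulVec_mulVec, hL, hK, Matrix.one_mulVec,
    Matrix.one_mulVec, Sum.elim_comp_inl_inr] at h1
  rw [← h1, map_zero]

end Generic

/-- The pairs in coordinates in which the conic is `∑ zᵢ² = 0` and the conjugate conic is
`∑ cᵢ wᵢ² = 0`. -/
def diagPairs (c : Fin 3 → ℝ) (u v : Fin 3 → ℂ) : Set ((Fin 3 → ℂ) × (Fin 3 → ℂ)) :=
  {p | p.1 ≠ 0 ∧ p.2 ≠ 0 ∧ ∑ i, p.1 i ^ 2 = 0 ∧ ∑ i, (c i : ℂ) * p.2 i ^ 2 = 0 ∧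
    (∃ l : ℂ, ∀ i, v i - p.2 i = l * p.1 i) ∧ ∃ m : ℂ, ∀ i, u i - p.1 i = m * (c i * p.2 i)}

/-! ### Coordinates that diagonalize the conic and its conjugate -/

section Diagonalization

variable {A L K : Matrix (Fin 3) (Fin 3) ℂ} {c : Fin 3 → ℝ}

/-- `z ↦ L z`, `w ↦ K w` are coordinates in which the conic and its conjugate are diagonal. -/
structure Diagonalizes (A L K : Matrix (Fin 3) (Fin 3) ℂ) (c : Fin 3 → ℝ) : Prop where
  eq_mul : A = L.transpose * L
  mul_transpose : K * L.transpose = 1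
  mulVec_star : ∀ w i, L.mulVec (star (A.mulVec (star w))) i = c i * K.mulVec w i

namespace Diagonalizes

variable (h : Diagonalizes A L K c)

include h

lemma transpose_mul : L.transpose * K = 1 := mul_eq_one_comm.1 h.mul_transpose

lemma L_mul : L * K.transpose = 1 := by
  have := congrArg Matrix.transpose h.mul_transpose
  rwa [Matrix.transpose_mul, Matrix.transpose_transpose, Matrix.transpose_one] at this

lemma K_mulVec (x : Fin 3 → ℂ) : K.mulVec (A.mulVec x) = L.mulVec x := by
  rw [h.eq_mul, Matrix.mulVec_mulVec, ← Matrix.mul_assoc, h.mul_transpose, Matrix.one_mul]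

lemma L_injective : Function.Injective L.mulVec := fun x y hxy => by
  have := congrArg K.transpose.mulVec hxy
  simpa [Matrix.mulVec_mulVec, mul_eq_one_comm.1 h.L_mul] using this

lemma K_injective : Function.Injective K.mulVec := fun x y hxy => by
  have := congrArg L.transpose.mulVec hxy
  simpa [Matrix.mulVec_mulVec, h.transpose_mul] using this

lemma isSymm : A.IsSymm := by
  rw [Matrix.IsSymm, h.eq_mul, Matrix.transpose_mul, Matrix.transpose_transpose]

lemma det_ne_zero : A.det ≠ 0 := by
  rw [h.eq_mul, Matrix.det_mul, Matrix.det_transpose]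
  have : L.det * K.transpose.det = 1 := by rw [← Matrix.det_mul, h.L_mul, Matrix.det_one]
  exact mul_self_ne_zero.2 (left_ne_zero_of_mul_eq_one this)

/-- `K` is inverse to `Lᵀ`, so `K` maps the normal vector `A z = Lᵀ L z` to `L z`. The last field of
`Diagonalizes` does the same for the conjugate normal vector, whose multiplier becomes `star m`. -/
lemma mem_normalPairs_iff {z w u v : Fin 3 → ℂ} :
    (z, w) ∈ normalPairs A u v ↔
      (L.mulVec z, K.mulVec w) ∈ diagPairs c (L.mulVec u) (K.mulVec v) := by
  have hz : z ≠ 0 ↔ L.mulVec z ≠ 0 := by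
    rw [← h.L_injective.ne_iff, Matrix.mulVec_zero]
  have hw : w ≠ 0 ↔ K.mulVec w ≠ 0 := by
    rw [← h.K_injective.ne_iff, Matrix.mulVec_zero]
  have hz2 : z ⬝ᵥ A.mulVec z = ∑ i, L.mulVec z i ^ 2 := by
    rw [h.eq_mul, ← Matrix.mulVec_mulVec, Matrix.dotProduct_mulVec, Matrix.vecMul_transpose,
      dotProduct]
    exact Finset.sum_congr rfl fun i _ => (sq _).symm
  have hw2 : star w ⬝ᵥ A.mulVec (star w) = star (∑ i, (c i : ℂ) * K.mulVec w i ^ 2) := by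
    have h1 : w ⬝ᵥ star (A.mulVec (star w)) = ∑ i, (c i : ℂ) * K.mulVec w i ^ 2 := by
      have h2 : w = L.transpose.mulVec (K.mulVec w) := by
        rw [Matrix.mulVec_mulVec, h.transpose_mul, Matrix.one_mulVec]
      have h3 : w ⬝ᵥ star (A.mulVec (star w)) =
          K.mulVec w ⬝ᵥ L.mulVec (star (A.mulVec (star w))) := by
        rw [Matrix.dotProduct_mulVec (K.mulVec w), ← Matrix.mulVec_transpose, ← h2]
      rw [h3, dotProduct]
      exact Finset.sum_congr rfl fun i _ => by rw [h.mulVec_star]; ring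
    rw [← h1, Matrix.star_dotProduct, dotProduct_comm]
  have hl : ∀ l : ℂ, v - w = l • A.mulVec z ↔
      ∀ i, K.mulVec v i - K.mulVec w i = l * L.mulVec z i := by
    intro l
    rw [← h.K_injective.eq_iff, Matrix.mulVec_sub, Matrix.mulVec_smul, h.K_mulVec, _root_.funext_iff]
    rfl
  have hm : ∀ m : ℂ, star u - star z = m • A.mulVec (star w) ↔
      ∀ i, L.mulVec u i - L.mulVec z i = star m * (c i * K.mulVec w i) := by
    intro m
    rw [← star_inj, star_sub, star_star, star_star, star_smul, ← h.L_injective.eq_iff,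
      Matrix.mulVec_sub, Matrix.mulVec_smul, _root_.funext_iff]
    simp only [Pi.sub_apply, Pi.smul_apply, smul_eq_mul, h.mulVec_star]
  simp only [normalPairs, diagPairs, Set.mem_ofPred_eq]
  rw [hz, hw, hz2, hw2, star_eq_zero]
  simp only [hl, hm]
  refine and_congr_right fun _ => and_congr_right fun _ => and_congr_right fun _ =>
    and_congr_right fun _ => and_congr_right fun _ => ⟨?_, ?_⟩
  · rintro ⟨m, hm⟩; exact ⟨star m, hm⟩
  · rintro ⟨m, hm⟩; exact ⟨star m, by simpa using hm⟩

lemma encard_normalPairs (u v : Fin 3 → ℂ) :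
    (normalPairs A u v).encard = (diagPairs c (L.mulVec u) (K.mulVec v)).encard := by
  have hset : diagPairs c (L.mulVec u) (K.mulVec v) =
      Prod.map L.mulVec K.mulVec '' normalPairs A u v := by
    ext ⟨x, y⟩
    constructor
    · intro hxy
      have hx : L.mulVec (K.transpose.mulVec x) = x := by
        rw [Matrix.mulVec_mulVec, h.L_mul, Matrix.one_mulVec]
      have hy : K.mulVec (L.transpose.mulVec y) = y := by
        rw [Matrix.mulVec_mulVec, h.mul_transpose, Matrix.one_mulVec]
      refine ⟨(K.transpose.mulVec x, L.transpose.mulVec y), ?_, by rw [Prod.map_apply, hx, hy]⟩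
      rw [h.mem_normalPairs_iff, hx, hy]
      exact hxy
    · rintro ⟨⟨z, w⟩, hzw, heq⟩
      rw [← heq]
      exact h.mem_normalPairs_iff.1 hzw
  rw [hset, (h.L_injective.prodMap h.K_injective).encard_image]

/-- The excluded locus is where `ū` or `v` lies on the dual conic; its equation is nonzero because
`A⁻¹` and its conjugate are nonsingular. -/
lemma generic_virtualCount :
    Generic fun u v => virtualCount (conic A) u v =
      (diagPairs c (L.mulVec u) (K.mulVec v)).encard := by
  have hB : (A⁻¹).IsSymm := by
    rw [Matrix.IsSymm, Matrix.transpose_nonsing_inv, h.isSymm.eq]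
  have hBdet : (A⁻¹).det ≠ 0 := by
    rw [Matrix.det_nonsing_inv, Ring.inverse_eq_inv']
    exact inv_ne_zero h.det_ne_zero
  have hB' : ((A⁻¹).map star).IsSymm := by
    rw [Matrix.IsSymm, ← Matrix.transpose_map, hB.eq]
  have hB'det : ((A⁻¹).map star).det ≠ 0 := by
    have : ((A⁻¹).map (starRingEnd ℂ)).det = starRingEnd ℂ (A⁻¹).det :=
      (RingHom.map_det (starRingEnd ℂ) A⁻¹).symm
    change ((A⁻¹).map (starRingEnd ℂ)).det ≠ 0
    rw [this]
    simpa using hBdet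
  refine ⟨rename Sum.inl (quadForm ((A⁻¹).map star)) * rename Sum.inr (quadForm A⁻¹),
    mul_ne_zero ?_ ?_, fun u v huv => ?_⟩
  · exact (map_ne_zero_iff _ (rename_injective _ Sum.inl_injective)).2
      (prime_quadForm hB' hB'det).ne_zero
  · exact (map_ne_zero_iff _ (rename_injective _ Sum.inr_injective)).2
      (prime_quadForm hB hBdet).ne_zero
  · rw [map_mul, eval_rename, eval_rename, Sum.elim_comp_inl, Sum.elim_comp_inr, eval_quadForm,
      eval_quadForm] at huv
    rw [← h.encard_normalPairs, virtualCount_conic h.isSymm h.det_ne_zero ?_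
      (right_ne_zero_of_mul huv)]
    intro h0
    refine left_ne_zero_of_mul huv ?_
    rw [← star_eq_zero, ← h0]
    simp [dotProduct, Matrix.mulVec, Finset.mul_sum]

lemma hasVirtualHD {N : ℕ} (hN : Generic fun u v => (diagPairs c u v).encard = N) :
    HasVirtualHD (conic A) N :=
  (h.generic_virtualCount.and (hN.comp_mulVec h.L_mul h.mul_transpose)).mono
    fun _ _ ⟨h1, h2⟩ => h1.trans h2

end Diagonalizes

/-- Scaling `U z` by `√a` absorbs `diag(a)`, which forces `1/√a` on the side of `w`. The conjugate
form `∑ aᵢ (Ū w)ᵢ²` therefore gets the coefficients `aᵢ · aᵢ`. -/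
lemma diagonalizes_takagi {A U : Matrix (Fin 3) (Fin 3) ℂ} {a : Fin 3 → ℝ}
    (hU : U * U.conjTranspose = 1) (ha : ∀ i, 0 < a i)
    (hAU : A = U.transpose * Matrix.diagonal (fun i => (a i : ℂ)) * U) :
    Diagonalizes A (Matrix.diagonal (fun i => (√(a i) : ℂ)) * U)
      (Matrix.diagonal (fun i => ((√(a i))⁻¹ : ℂ)) * U.map star) (fun i => a i ^ 2) := by
  have hs : ∀ i, (√(a i) : ℂ) * √(a i) = a i := fun i => by
    rw [← Complex.ofReal_mul, Real.mul_self_sqrt (ha i).le]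
  have hs0 : ∀ i, (√(a i) : ℂ) ≠ 0 := fun i =>
    Complex.ofReal_ne_zero.2 (Real.sqrt_pos.2 (ha i)).ne'
  have hU' : U.map star * U.transpose = 1 := by
    have := congrArg Matrix.transpose hU
    rw [Matrix.transpose_mul, Matrix.transpose_one] at this
    exact this
  refine ⟨?_, ?_, fun w i => ?_⟩
  · rw [hAU, Matrix.transpose_mul, Matrix.diagonal_transpose, Matrix.mul_assoc, Matrix.mul_assoc,
      ← Matrix.mul_assoc (Matrix.diagonal _), Matrix.diagonal_mul_diagonal]
    simp only [hs]
  · rw [Matrix.transpose_mul, Matrix.diagonal_transpose, Matrix.mul_assoc, ← Matrix.mul_assoc _ _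
      (Matrix.diagonal _), hU', Matrix.one_mul, Matrix.diagonal_mul_diagonal, ← Matrix.diagonal_one]
    congr 1
    ext i
    exact inv_mul_cancel₀ (hs0 i)
  · have h1 : star (A.mulVec (star w)) =
        U.conjTranspose.mulVec (fun i => (a i : ℂ) * (U.map star).mulVec w i) := by
      rw [hAU, Matrix.mul_assoc, ← Matrix.mulVec_mulVec, Matrix.star_mulVec, ← Matrix.mulVec_transpose]
      have : U.transpose.conjTranspose.transpose = U.conjTranspose := rfl
      rw [this]
      congr 1
      ext i
      rw [← Matrix.mulVec_mulVec, Pi.star_apply, Matrix.mulVec_diagonal, star_mul']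
      simp [Matrix.mulVec, dotProduct]
    rw [h1, ← Matrix.mulVec_mulVec, Matrix.mulVec_diagonal, Matrix.mulVec_mulVec, hU,
      Matrix.one_mulVec, ← Matrix.mulVec_mulVec, Matrix.mulVec_diagonal]
    have h2 := hs i
    have h3 := hs0 i
    push_cast
    rw [← h2]
    field_simp

end Diagonalization

/-! ### Elimination of the multipliers -/

section Elimination

/-- The sum `∑ xᵢ / (1 - s cᵢ)ᵏ`. -/
noncomputable def poleSum (c : Fin 3 → ℝ) (s : ℂ) (k : ℕ) (x : Fin 3 → ℂ) : ℂ :=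
  ∑ i, x i / (1 - s * c i) ^ k

/-- The function of `s = l * m` which vanishes at the critical pairs with multipliers `l`, `m`. -/
noncomputable def eliminant (c : Fin 3 → ℝ) (u v : Fin 3 → ℂ) (s : ℂ) : ℂ :=
  4 * s * poleSum c s 1 (fun i => u i ^ 2) * poleSum c s 1 (fun i => c i * v i ^ 2) *
    poleSum c s 2 (fun i => c i * (u i * v i)) ^ 2 -
  (poleSum c s 2 (fun i => c i * v i ^ 2) * poleSum c s 1 (fun i => u i ^ 2) +
    s * poleSum c s 1 (fun i => c i * v i ^ 2) * poleSum c s 2 (fun i => c i * u i ^ 2)) ^ 2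

variable {c : Fin 3 → ℝ} {u v : Fin 3 → ℂ} {s : ℂ}

lemma poleSum_one_u (hb : ∀ i, 1 - s * c i ≠ 0) :
    poleSum c s 1 (fun i => u i ^ 2) =
      poleSum c s 2 (fun i => u i ^ 2) - s * poleSum c s 2 (fun i => c i * u i ^ 2) := by
  simp only [poleSum, Finset.mul_sum, ← Finset.sum_sub_distrib]
  refine Finset.sum_congr rfl fun i _ => ?_
  have := hb i
  field_simp

lemma poleSum_one_v (hb : ∀ i, 1 - s * c i ≠ 0) :
    poleSum c s 1 (fun i => c i * v i ^ 2) =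
      poleSum c s 2 (fun i => c i * v i ^ 2) - s * poleSum c s 2 (fun i => c i ^ 2 * v i ^ 2) := by
  simp only [poleSum, Finset.mul_sum, ← Finset.sum_sub_distrib]
  refine Finset.sum_congr rfl fun i _ => ?_
  have := hb i
  field_simp

lemma sum_sq_z (m : ℂ) :
    ∑ i, ((u i - m * (c i * v i)) / (1 - s * c i)) ^ 2 =
      poleSum c s 2 (fun i => u i ^ 2) - 2 * m * poleSum c s 2 (fun i => c i * (u i * v i)) +
        m ^ 2 * poleSum c s 2 (fun i => c i ^ 2 * v i ^ 2) := by
  simp only [poleSum, Finset.mul_sum, ← Finset.sum_sub_distrib, ← Finset.sum_add_distrib]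
  refine Finset.sum_congr rfl fun i _ => ?_
  rw [div_pow]
  ring

lemma sum_sq_w (l : ℂ) :
    ∑ i, (c i : ℂ) * ((v i - l * u i) / (1 - s * c i)) ^ 2 =
      poleSum c s 2 (fun i => c i * v i ^ 2) - 2 * l * poleSum c s 2 (fun i => c i * (u i * v i)) +
        l ^ 2 * poleSum c s 2 (fun i => c i * u i ^ 2) := by
  simp only [poleSum, Finset.mul_sum, ← Finset.sum_sub_distrib, ← Finset.sum_add_distrib]
  refine Finset.sum_congr rfl fun i _ => ?_
  rw [div_pow]
  ring

/-- The points with multipliers `l`, `m`. -/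
noncomputable def multPair (c : Fin 3 → ℝ) (u v : Fin 3 → ℂ) (l m : ℂ) :
    (Fin 3 → ℂ) × (Fin 3 → ℂ) :=
  (fun i => (u i - m * (c i * v i)) / (1 - l * m * c i),
    fun i => (v i - l * u i) / (1 - l * m * c i))

/-- The multiplier `l` that belongs to a zero of the eliminant. -/
noncomputable def multL (c : Fin 3 → ℝ) (u v : Fin 3 → ℂ) (s : ℂ) : ℂ :=
  (poleSum c s 2 (fun i => c i * v i ^ 2) * poleSum c s 1 (fun i => u i ^ 2) +
    s * poleSum c s 1 (fun i => c i * v i ^ 2) * poleSum c s 2 (fun i => c i * u i ^ 2)) /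
    (2 * poleSum c s 2 (fun i => c i * (u i * v i)) * poleSum c s 1 (fun i => u i ^ 2))

/-- The conditions on `(u, v)` under which the critical pairs are parametrized by the zeros of
the eliminant. -/
structure Admissible (c : Fin 3 → ℝ) (u v : Fin 3 → ℂ) : Prop where
  u_sq : ∑ i, u i ^ 2 ≠ 0
  v_sq : ∑ i, v i ^ 2 ≠ 0
  u_dual : ∑ i, u i ^ 2 / (c i : ℂ) ≠ 0
  v_dual : ∑ i, (c i : ℂ) * v i ^ 2 ≠ 0
  pole : ∀ (z w : Fin 3 → ℂ) (l m : ℂ), ∑ i, z i ^ 2 = 0 → ∑ i, (c i : ℂ) * w i ^ 2 = 0 →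
    (∀ i, v i - w i = l * z i) → (∀ i, u i - z i = m * (c i * w i)) → ∀ i, 1 - l * m * c i ≠ 0
  zero : ∀ s : ℂ, s ≠ 0 → (∀ i, 1 - s * c i ≠ 0) → eliminant c u v s = 0 →
    poleSum c s 1 (fun i => u i ^ 2) ≠ 0 ∧ poleSum c s 1 (fun i => c i * v i ^ 2) ≠ 0 ∧
      poleSum c s 2 (fun i => c i * (u i * v i)) ≠ 0

/-- With `bᵢ = 1 - s cᵢ`, the letters stand for the sums with denominators `bᵢ²` and numerators
`uᵢ²`, `cᵢuᵢvᵢ`, `cᵢ²vᵢ²` (the `P`s) and `cᵢvᵢ²`, `cᵢuᵢ²` (the `Q`s); `R`, `T` have denominators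
`bᵢ`. The combination `l² e1 - l m e2` cancels `P1`. Squaring the second conclusion and inserting
the first gives the eliminant. -/
lemma elimination_forward {P0 P1 P2 Q0 Q2 R T l m : ℂ} (hR : R = P0 - l * m * Q2)
    (hT : T = Q0 - l * m * P2) (e1 : P0 - 2 * m * P1 + m ^ 2 * P2 = 0)
    (e2 : Q0 - 2 * l * P1 + l ^ 2 * Q2 = 0) :
    l ^ 2 * R = l * m * T ∧ l * (2 * P1 * R) = Q0 * R + l * m * T * Q2 := by
  have h1 : l ^ 2 * R = l * m * T := by
    rw [hR, hT]; linear_combination l ^ 2 * e1 - l * m * e2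
  exact ⟨h1, by linear_combination (-R) * e2 + Q2 * h1⟩

lemma elimination_backward {P0 P1 P2 Q0 Q2 R T l m s : ℂ} (hs : l * m = s)
    (hR : R = P0 - s * Q2) (hT : T = Q0 - s * P2) (hR0 : R ≠ 0) (hl0 : l ≠ 0)
    (hl : l * (2 * P1 * R) = Q0 * R + s * T * Q2) (h1 : l ^ 2 * R = s * T) :
    P0 - 2 * m * P1 + m ^ 2 * P2 = 0 ∧ Q0 - 2 * l * P1 + l ^ 2 * Q2 = 0 := by
  have e2 : Q0 - 2 * l * P1 + l ^ 2 * Q2 = 0 := by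
    refine (mul_eq_zero.1 (?_ : R * _ = 0)).resolve_left hR0
    linear_combination -hl + Q2 * h1
  refine ⟨(mul_eq_zero.1 (?_ : l ^ 2 * _ = 0)).resolve_left (pow_ne_zero 2 hl0), e2⟩
  subst hs
  rw [hR, hT] at h1
  linear_combination h1 + l * m * e2

lemma eq_multPair {z w : Fin 3 → ℂ} {l m : ℂ} (hb : ∀ i, 1 - l * m * c i ≠ 0)
    (hl : ∀ i, v i - w i = l * z i) (hm : ∀ i, u i - z i = m * (c i * w i)) :
    (z, w) = multPair c u v l m := by
  refine Prod.ext (funext fun i => ?_) (funext fun i => ?_)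
  · simp only [multPair]
    rw [eq_div_iff (hb i)]
    linear_combination -hm i + m * c i * hl i
  · simp only [multPair]
    rw [eq_div_iff (hb i)]
    linear_combination -hl i + l * hm i

lemma multPair_equations {l m : ℂ} (hb : ∀ i, 1 - l * m * c i ≠ 0) :
    (∀ i, v i - (multPair c u v l m).2 i = l * (multPair c u v l m).1 i) ∧
      ∀ i, u i - (multPair c u v l m).1 i = m * (c i * (multPair c u v l m).2 i) := by
  constructor <;> intro i <;> simp only [multPair] <;> have := hb i <;>
    generalize hB : 1 - l * m * (c i : ℂ) = B at this ⊢ <;> field_simp <;> rw [← hB] <;> ring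

/-- The zeros of the eliminant at which no pole occurs. -/
def eliminantZeros (c : Fin 3 → ℝ) (u v : Fin 3 → ℂ) : Set ℂ :=
  {s | s ≠ 0 ∧ (∀ i, 1 - s * c i ≠ 0) ∧ eliminant c u v s = 0}

/-- By the definition of `multL` the eliminant factors as `4 P² R (s T - l² R)`, and `P`, `R` are
nonzero. Then `l ≠ 0` because `s T ≠ 0`. -/
lemma Admissible.multL_spec (h : Admissible c u v) (hs : s ∈ eliminantZeros c u v) :
    multL c u v s ≠ 0 ∧
    multL c u v s * (2 * poleSum c s 2 (fun i => c i * (u i * v i)) *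
      poleSum c s 1 (fun i => u i ^ 2)) =
    poleSum c s 2 (fun i => c i * v i ^ 2) * poleSum c s 1 (fun i => u i ^ 2) +
      s * poleSum c s 1 (fun i => c i * v i ^ 2) * poleSum c s 2 (fun i => c i * u i ^ 2) ∧
    multL c u v s ^ 2 * poleSum c s 1 (fun i => u i ^ 2) =
      s * poleSum c s 1 (fun i => c i * v i ^ 2) := by
  obtain ⟨hs0, hb, hE⟩ := hs
  obtain ⟨hR, hT, hP⟩ := h.zero s hs0 hb hE
  have h2 : multL c u v s * (2 * poleSum c s 2 (fun i => c i * (u i * v i)) *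
      poleSum c s 1 (fun i => u i ^ 2)) =
    poleSum c s 2 (fun i => c i * v i ^ 2) * poleSum c s 1 (fun i => u i ^ 2) +
      s * poleSum c s 1 (fun i => c i * v i ^ 2) * poleSum c s 2 (fun i => c i * u i ^ 2) :=
    div_mul_cancel₀ _ (mul_ne_zero (mul_ne_zero two_ne_zero hP) hR)
  have h3 : multL c u v s ^ 2 * poleSum c s 1 (fun i => u i ^ 2) =
      s * poleSum c s 1 (fun i => c i * v i ^ 2) := by
    rw [eliminant, ← h2] at hE
    have h4 : (4 : ℂ) ≠ 0 := by norm_num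
    refine mul_left_cancel₀ (mul_ne_zero (mul_ne_zero h4 hR) (pow_ne_zero 2 hP)) ?_
    linear_combination -hE
  refine ⟨fun h0 => ?_, h2, h3⟩
  rw [h0, zero_pow two_ne_zero, zero_mul] at h3
  exact mul_ne_zero hs0 hT h3.symm

/-- Only `z ≠ 0` and `w ≠ 0` are at stake. `z = 0` gives `uᵢ = m cᵢ wᵢ` and `∑ uᵢ²/cᵢ = 0`; `w = 0`
gives `v = l z` and `∑ vᵢ² = 0`. -/
lemma multPair_mem (h : Admissible c u v) (hc : ∀ i, c i ≠ 0) {l m : ℂ}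
    (hb : ∀ i, 1 - l * m * c i ≠ 0)
    (e1 : ∑ i, (multPair c u v l m).1 i ^ 2 = 0)
    (e2 : ∑ i, (c i : ℂ) * (multPair c u v l m).2 i ^ 2 = 0) :
    multPair c u v l m ∈ diagPairs c u v := by
  obtain ⟨hl, hm⟩ := multPair_equations (u := u) (v := v) hb
  refine ⟨fun h0 => h.u_dual ?_, fun h0 => h.v_sq ?_, e1, e2, ⟨l, hl⟩, m, hm⟩
  · rw [← mul_zero (m ^ 2), ← e2, Finset.mul_sum]
    refine Finset.sum_congr rfl fun i _ => ?_
    have h1 := hm i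
    rw [h0, Pi.zero_apply, sub_zero] at h1
    have := Complex.ofReal_ne_zero.2 (hc i)
    rw [h1]
    field_simp
  · rw [← mul_zero (l ^ 2), ← e1, Finset.mul_sum]
    refine Finset.sum_congr rfl fun i _ => ?_
    have h1 := hl i
    rw [h0, Pi.zero_apply, sub_zero] at h1
    rw [h1]
    ring

/-- The critical pairs are in bijection with the zeros of the eliminant. -/
lemma Admissible.diagPairs_eq_image (h : Admissible c u v) (hc : ∀ i, c i ≠ 0) :
    diagPairs c u v = (fun s => multPair c u v (multL c u v s) (s / multL c u v s)) ''
      eliminantZeros c u v := by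
  ext ⟨z, w⟩
  constructor
  · rintro ⟨hz, hw, hz2, hw2, ⟨l, hl⟩, m, hm⟩
    have hb := h.pole z w l m hz2 hw2 hl hm
    have heq := eq_multPair hb hl hm
    -- `l = 0` means `w = v`, which would put `v` on the conjugate conic; similarly `m = 0` would
    -- put `u` on the conic.
    have hl0 : l ≠ 0 := by
      rintro rfl
      refine h.v_dual ?_
      rw [← hw2]
      refine Finset.sum_congr rfl fun i _ => ?_
      have h1 := hl i
      rw [zero_mul, sub_eq_zero] at h1
      rw [h1]
    have hm0 : m ≠ 0 := by
      rintro rfl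
      refine h.u_sq ?_
      rw [← hz2]
      refine Finset.sum_congr rfl fun i _ => ?_
      have h1 := hm i
      rw [zero_mul, sub_eq_zero] at h1
      rw [h1]
    have heq' : (z, w) = multPair c u v l m := heq
    have e1 := hz2
    have e2 := hw2
    rw [heq'] at e1 e2
    simp only [multPair] at e1 e2
    rw [sum_sq_z] at e1
    rw [sum_sq_w] at e2
    obtain ⟨h1, h2⟩ := elimination_forward (poleSum_one_u hb) (poleSum_one_v hb) e1 e2
    have hE : eliminant c u v (l * m) = 0 := by
      rw [eliminant, ← h2]
      linear_combination (-4 * poleSum c (l * m) 1 (fun i => u i ^ 2) *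
        poleSum c (l * m) 2 (fun i => c i * (u i * v i)) ^ 2) * h1
    have hmem : l * m ∈ eliminantZeros c u v := ⟨mul_ne_zero hl0 hm0, hb, hE⟩
    obtain ⟨hR, -, hP⟩ := h.zero _ hmem.1 hb hE
    have hL : multL c u v (l * m) = l := by
      rw [multL, ← h2, mul_div_cancel_right₀]
      exact mul_ne_zero (mul_ne_zero two_ne_zero hP) hR
    refine ⟨l * m, hmem, ?_⟩
    simp only [hL, mul_div_cancel_left₀ m hl0]
    exact heq.symm
  · rintro ⟨s, hs, hzw⟩
    obtain ⟨hl0, h2, h1⟩ := h.multL_spec hs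
    rw [← hzw]
    have hlm : multL c u v s * (s / multL c u v s) = s := mul_div_cancel₀ s hl0
    obtain ⟨e1, e2⟩ := elimination_backward hlm (poleSum_one_u hs.2.1) (poleSum_one_v hs.2.1)
      (h.zero s hs.1 hs.2.1 hs.2.2).1 hl0 h2 h1
    refine multPair_mem h hc (by rw [hlm]; exact hs.2.1) ?_ ?_
    · simp only [multPair, hlm]
      rw [sum_sq_z, e1]
    · simp only [multPair, hlm]
      rw [sum_sq_w, e2]

/-- Distinct zeros give distinct pairs: a nonzero coordinate of `z` recovers `l`, one of `w`
recovers `m`, and `s = l m`. -/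
lemma Admissible.encard_diagPairs (h : Admissible c u v) (hc : ∀ i, c i ≠ 0) :
    (diagPairs c u v).encard = (eliminantZeros c u v).encard := by
  rw [h.diagPairs_eq_image hc, Set.InjOn.encard_image]
  intro s hs t ht hst
  have hst : multPair c u v (multL c u v s) (s / multL c u v s) =
    multPair c u v (multL c u v t) (t / multL c u v t) := hst
  have hmem : multPair c u v (multL c u v s) (s / multL c u v s) ∈ diagPairs c u v := by
    rw [h.diagPairs_eq_image hc]; exact ⟨s, hs, rfl⟩
  have hlms : multL c u v s * (s / multL c u v s) = s := mul_div_cancel₀ s (h.multL_spec hs).1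
  have hlmt : multL c u v t * (t / multL c u v t) = t := mul_div_cancel₀ t (h.multL_spec ht).1
  obtain ⟨hl, hm⟩ := multPair_equations (c := c) (u := u) (v := v) (l := multL c u v s)
    (m := s / multL c u v s) (by rw [hlms]; exact hs.2.1)
  obtain ⟨hl', hm'⟩ := multPair_equations (c := c) (u := u) (v := v) (l := multL c u v t)
    (m := t / multL c u v t) (by rw [hlmt]; exact ht.2.1)
  rw [← hst] at hl' hm'
  obtain ⟨i, hi⟩ := Function.ne_iff.1 hmem.1
  obtain ⟨j, hj⟩ := Function.ne_iff.1 hmem.2.1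
  have e1 : multL c u v s = multL c u v t := mul_right_cancel₀ hi ((hl i).symm.trans (hl' i))
  have e2 : s / multL c u v s = t / multL c u v t :=
    mul_right_cancel₀ (mul_ne_zero (Complex.ofReal_ne_zero.2 (hc j)) hj)
      ((hm j).symm.trans (hm' j))
  rw [← hlms, ← hlmt, e2, e1]

end Elimination

/-! ### Coprimality as an open condition -/

section Resultant

lemma isCoprime_map_of_resultant_ne_zero {R : Type*} [CommRing R] (φ : R →+* ℂ)
    {F Q : Polynomial R} (hpos : F.natDegree ≠ 0) (h : φ (F.resultant Q) ≠ 0) :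
    IsCoprime (F.map φ) (Q.map φ) := by
  rw [← Polynomial.resultant_map_map] at h
  obtain ⟨p, q, -, -, hpq⟩ := Polynomial.exists_mul_add_mul_eq_C_resultant (F.map φ)
    (Q.map φ) (m := F.natDegree) (n := Q.natDegree) Polynomial.natDegree_map_le
    Polynomial.natDegree_map_le (Or.inl hpos)
  set r := (F.map φ).resultant (Q.map φ) F.natDegree Q.natDegree
  refine ⟨Polynomial.C r⁻¹ * p, Polynomial.C r⁻¹ * q, ?_⟩
  calc _ = Polynomial.C r⁻¹ * (F.map φ * p + Q.map φ * q) := by ring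
    _ = 1 := by rw [hpq, ← Polynomial.C_mul, inv_mul_cancel₀ h, Polynomial.C_1]

lemma resultant_ne_zero_of_isCoprime_map {R : Type*} [CommRing R] (φ : R →+* ℂ)
    {F Q : Polynomial R} (hdeg : (F.map φ).natDegree = F.natDegree)
    (hpos : F.natDegree ≠ 0) (hco : IsCoprime (F.map φ) (Q.map φ)) : φ (F.resultant Q) ≠ 0 := by
  rw [← Polynomial.resultant_map_map]
  obtain ⟨k, hk⟩ := Nat.exists_eq_add_of_le (Polynomial.natDegree_map_le (f := φ) (p := Q))
  -- A drop of the degree of `Q` under specialization changes the resultant by a sign and a power of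
  -- the leading coefficient of `F`, which survives by `hdeg`.
  rw [hk, Polynomial.resultant_add_right_deg _ _ _ _ _ le_rfl, ← hdeg]
  refine mul_ne_zero (pow_ne_zero _ ?_) (Polynomial.resultant_ne_zero _ _ hco)
  rw [Polynomial.coeff_natDegree, Polynomial.leadingCoeff_ne_zero]
  intro h0
  rw [h0, Polynomial.natDegree_zero] at hdeg
  exact hpos hdeg.symm

/-- Coprimality of specialized polynomials is an open condition, if the degree of one of them does
not drop. -/
lemma Generic.isCoprime {n : ℕ} {F Q : Polynomial (MvPolynomial (Fin n ⊕ Fin n) ℂ)}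
    {u₀ v₀ : Fin n → ℂ}
    (hdeg : (F.map (eval (Sum.elim u₀ v₀))).natDegree = F.natDegree)
    (hpos : F.natDegree ≠ 0)
    (hco : IsCoprime (F.map (eval (Sum.elim u₀ v₀))) (Q.map (eval (Sum.elim u₀ v₀)))) :
    Generic fun u v => IsCoprime (F.map (eval (Sum.elim u v))) (Q.map (eval (Sum.elim u v))) := by
  exact (Generic.of_eval (F.resultant Q) (resultant_ne_zero_of_isCoprime_map _ hdeg hpos hco)).mono
    fun u v huv => isCoprime_map_of_resultant_ne_zero _ hpos huv

end Resultant

/-! ### Splitting multiple roots by a deformation -/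

section Deformation

/-- A monic family without points `α` at which it vanishes to second order in the parameter has no
multiple factors. -/
lemma separable_of_not_X_sq_dvd_eval {F : Polynomial (PowerSeries ℂ)} (hm : F.Monic)
    (hF : ∀ α : ℂ, ¬ PowerSeries.X ^ 2 ∣ F.eval (PowerSeries.C α)) :
    (F.map (algebraMap (PowerSeries ℂ) (FractionRing (PowerSeries ℂ)))).Separable := by
  have hinj := IsFractionRing.injective (PowerSeries ℂ) (FractionRing (PowerSeries ℂ))
  have : CharZero (PowerSeries ℂ) :=
    charZero_of_injective_ringHom (f := PowerSeries.C (R := ℂ)) PowerSeries.C_injective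
  have : CharZero (FractionRing (PowerSeries ℂ)) := charZero_of_injective_ringHom hinj
  rw [PerfectField.separable_iff_squarefree]
  intro g hg
  by_contra hgu
  have hm' := hm.map (algebraMap (PowerSeries ℂ) (FractionRing (PowerSeries ℂ)))
  have hg0 : g ≠ 0 := by
    rintro rfl
    rw [zero_mul, zero_dvd_iff] at hg
    exact hm'.ne_zero hg
  -- Power series form an integrally closed domain, so up to a constant the multiple factor comes
  -- from a monic `G` with `G²` dividing `F`. At a root `α` of `G` modulo `X`, `F(α)` is divisible
  -- by `X²`.
  obtain ⟨G, hG⟩ := IsIntegrallyClosed.eq_map_mul_C_of_dvd (FractionRing (PowerSeries ℂ)) hm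
    (dvd_of_mul_left_dvd hg)
  have hGm : G.Monic := by
    have h1 := congrArg Polynomial.leadingCoeff hG
    rw [Polynomial.leadingCoeff_mul, Polynomial.leadingCoeff_C,
      Polynomial.leadingCoeff_map_of_injective hinj] at h1
    have h2 := mul_right_cancel₀ (Polynomial.leadingCoeff_ne_zero.2 hg0)
      (h1.trans (one_mul _).symm)
    exact hinj (by rw [h2, map_one])
  have hdvd : G * G ∣ F := by
    rw [← Polynomial.map_dvd_map _ hinj (hGm.mul hGm), Polynomial.map_mul]
    refine dvd_trans ⟨Polynomial.C g.leadingCoeff * Polynomial.C g.leadingCoeff, ?_⟩ hg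
    calc g * g = (G.map (algebraMap _ _) * Polynomial.C g.leadingCoeff) *
        (G.map (algebraMap _ _) * Polynomial.C g.leadingCoeff) := by rw [hG]
      _ = _ := by ring
  have hdeg : G.natDegree ≠ 0 := by
    intro h0
    have : G = 1 := hGm.natDegree_eq_zero.1 h0
    rw [this, Polynomial.map_one, one_mul] at hG
    refine hgu ?_
    rw [← hG]
    exact Polynomial.isUnit_C.2 (isUnit_iff_ne_zero.2 (Polynomial.leadingCoeff_ne_zero.2 hg0))
  obtain ⟨α, hα⟩ := IsAlgClosed.exists_root (G.map (PowerSeries.constantCoeff (R := ℂ))) (by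
    rw [Polynomial.degree_eq_natDegree (hGm.map _).ne_zero, hGm.natDegree_map]
    exact_mod_cast hdeg)
  have hXG : PowerSeries.X ∣ G.eval (PowerSeries.C α) := by
    rw [PowerSeries.X_dvd_iff, ← Polynomial.eval_map_apply, PowerSeries.constantCoeff_C]
    exact hα
  obtain ⟨H, hH⟩ := hdvd
  refine hF α ?_
  rw [hH, Polynomial.eval_mul, Polynomial.eval_mul, sq]
  exact Dvd.dvd.mul_right (mul_dvd_mul hXG hXG) _

/-- If `F₁` does not vanish at the zeros of `F₀`, then some member of the family
`F₀ + e F₁ + e² F₂` has no multiple roots. -/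
lemma exists_isCoprime_derivative {F₀ F₁ F₂ : Polynomial ℂ} (hpos : F₀.natDegree ≠ 0)
    (h₁ : F₁.natDegree ≤ F₀.natDegree) (h₂ : F₂.natDegree ≤ F₀.natDegree)
    (h : ∀ α, F₀.eval α = 0 → F₁.eval α ≠ 0) :
    ∃ e : ℂ, (F₀ + Polynomial.C e * F₁ + Polynomial.C (e ^ 2) * F₂).natDegree = F₀.natDegree ∧
      IsCoprime (F₀ + Polynomial.C e * F₁ + Polynomial.C (e ^ 2) * F₂)
        (Polynomial.derivative (F₀ + Polynomial.C e * F₁ + Polynomial.C (e ^ 2) * F₂)) := by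
  set d := F₀.natDegree with hd
  set F : Polynomial (Polynomial ℂ) := F₀.map Polynomial.C +
    Polynomial.C Polynomial.X * F₁.map Polynomial.C +
    Polynomial.C (Polynomial.X ^ 2) * F₂.map Polynomial.C with hF
  have hFe : ∀ e, F.map (Polynomial.evalRingHom e) =
      F₀ + Polynomial.C e * F₁ + Polynomial.C (e ^ 2) * F₂ := by
    intro e
    have hid : (Polynomial.evalRingHom e).comp Polynomial.C = RingHom.id ℂ := by
      ext x; simp
    simp [hF, Polynomial.map_map, hid]
  have hdegle : F.natDegree ≤ d := by
    refine Polynomial.natDegree_add_le_of_degree_le (Polynomial.natDegree_add_le_of_degree_le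
      Polynomial.natDegree_map_le ?_) ?_
    · exact (Polynomial.natDegree_C_mul_le _ _).trans (Polynomial.natDegree_map_le.trans h₁)
    · exact (Polynomial.natDegree_C_mul_le _ _).trans (Polynomial.natDegree_map_le.trans h₂)
  have hF₀ : F₀ ≠ 0 := by rintro h0; rw [hd, h0] at hpos; exact hpos rfl
  have hL0 : (F.coeff d).eval 0 ≠ 0 := by
    simpa only [hF, Polynomial.coeff_add, Polynomial.coeff_C_mul, Polynomial.coeff_map,
      Polynomial.eval_add, Polynomial.eval_mul, Polynomial.eval_C, Polynomial.eval_X,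
      Polynomial.eval_pow, zero_pow two_ne_zero, zero_mul, add_zero, hd, Polynomial.coeff_natDegree,
      Polynomial.leadingCoeff_ne_zero] using hF₀
  have hLne : F.coeff d ≠ 0 := fun h0 => hL0 (by rw [h0, Polynomial.eval_zero])
  have hdeg : F.natDegree = d := le_antisymm hdegle (Polynomial.le_natDegree_of_ne_zero hLne)
  have hres : F.resultant (Polynomial.derivative F) ≠ 0 := by
    -- Over power series in `e` the leading coefficient becomes a unit, since it does not vanish at
    -- `e = 0`; after normalization the monic criterion applies. Its hypothesis holds because `F(α)
    -- ≡ F₀(α) + e F₁(α)` modulo `e²`.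
    set ψ : Polynomial ℂ →+* PowerSeries ℂ := Polynomial.coeToPowerSeries.ringHom
    have hψ : Function.Injective ψ := Polynomial.coe_injective ℂ
    have hunit : IsUnit (ψ (F.coeff d)) := by
      rw [PowerSeries.isUnit_iff_constantCoeff, isUnit_iff_ne_zero]
      have : PowerSeries.constantCoeff (ψ (F.coeff d)) = (F.coeff d).eval 0 := by
        rw [← Polynomial.coeff_zero_eq_eval_zero, ← PowerSeries.coeff_zero_eq_constantCoeff_apply]
        exact Polynomial.coeff_coe (F.coeff d) 0
      rwa [this]
    obtain ⟨t, ht⟩ := hunit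
    have hmon : (Polynomial.C ((t⁻¹ : (PowerSeries ℂ)ˣ) : PowerSeries ℂ) * F.map ψ).Monic := by
      rw [Polynomial.Monic, Polynomial.leadingCoeff_mul, Polynomial.leadingCoeff_C,
        Polynomial.leadingCoeff_map_of_injective hψ, Polynomial.leadingCoeff, hdeg, ← ht,
        Units.inv_mul]
    have hsep := separable_of_not_X_sq_dvd_eval hmon (fun α hα => by
      rw [Polynomial.eval_mul, Polynomial.eval_C, (Units.isUnit _).dvd_mul_left] at hα
      have he : Polynomial.eval (PowerSeries.C α) (F.map ψ) =
          ψ (Polynomial.C (F₀.eval α) + Polynomial.X * Polynomial.C (F₁.eval α) +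
            Polynomial.X ^ 2 * Polynomial.C (F₂.eval α)) := by
        have : (PowerSeries.C α : PowerSeries ℂ) = ψ (Polynomial.C α) :=
          (Polynomial.coe_C α).symm
        rw [this, Polynomial.eval_map_apply]
        congr 1
        simp only [hF, Polynomial.eval_add, Polynomial.eval_mul, Polynomial.eval_C,
          Polynomial.eval_map_apply]
      rw [he, PowerSeries.X_pow_dvd_iff] at hα
      have c0 := hα 0 (by norm_num)
      have c1 := hα 1 (by norm_num)
      have hcoe : ∀ (k : ℕ) (p : Polynomial ℂ), PowerSeries.coeff k (ψ p) = p.coeff k :=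
        fun k p => Polynomial.coeff_coe p k
      rw [hcoe] at c0 c1
      simp [Polynomial.coeff_C] at c0 c1
      exact h α c0 c1)
    set θ := (algebraMap (PowerSeries ℂ) (FractionRing (PowerSeries ℂ))).comp ψ with hθ
    have hθi : Function.Injective θ :=
      (IsFractionRing.injective (PowerSeries ℂ) (FractionRing (PowerSeries ℂ))).comp hψ
    have hsep' : (F.map θ).Separable := by
      refine hsep.of_dvd ?_
      rw [Polynomial.map_mul, Polynomial.map_map]
      exact dvd_mul_left _ _
    rw [Polynomial.separable_def, Polynomial.derivative_map] at hsep'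
    have := Polynomial.resultant_ne_zero _ _ hsep'
    rw [Polynomial.natDegree_map_eq_of_injective hθi, Polynomial.natDegree_map_eq_of_injective hθi,
      Polynomial.resultant_map_map] at this
    intro h0
    exact this (by rw [h0, map_zero])
  -- Avoiding the zeros of both the discriminant and the leading coefficient keeps the roots simple
  -- and the degree equal to `d`.
  obtain ⟨e, he⟩ : ∃ e : ℂ, (F.resultant (Polynomial.derivative F) * F.coeff d).eval e ≠ 0 := by
    by_contra hcon
    push Not at hcon
    exact mul_ne_zero hres hLne (Polynomial.funext fun e => by simpa using hcon e)
  rw [Polynomial.eval_mul] at he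
  refine ⟨e, ?_, ?_⟩
  · rw [← hFe]
    refine le_antisymm (Polynomial.natDegree_map_le.trans hdegle)
      (Polynomial.le_natDegree_of_ne_zero ?_)
    rw [Polynomial.coeff_map]
    exact right_ne_zero_of_mul he
  · rw [← hFe, Polynomial.derivative_map]
    exact isCoprime_map_of_resultant_ne_zero _ (by rwa [hdeg]) (left_ne_zero_of_mul he)

lemma encard_zeros_of_isCoprime {f : Polynomial ℂ} (h : IsCoprime f (Polynomial.derivative f))
    (hf : f ≠ 0) : {s : ℂ | f.eval s = 0}.encard = f.natDegree := by
  classical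
  have h1 : {s : ℂ | f.eval s = 0} = f.roots.toFinset := by
    ext s; simp [hf]
  have hs : f.Separable := h
  rw [h1, Set.encard_coe_eq_coe_finsetCard, Multiset.toFinset_card_of_nodup (Polynomial.nodup_roots hs),
    ← (IsAlgClosed.splits f).natDegree_eq_card_roots]

end Deformation

/-! ### Numerators of the pole sums and of the eliminant -/

section Numerators

variable {S S' : Type*} [CommRing S] [CommRing S']

/-- The numerator of `∑ uᵢ² / bᵢ` over a common denominator, `wᵢ` the cofactors. -/
def elimR (w u : Fin 3 → S) : S := ∑ i, u i ^ 2 * w i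

/-- The numerator of `∑ cᵢ vᵢ² / bᵢ`. -/
def elimT (w c v : Fin 3 → S) : S := ∑ i, c i * v i ^ 2 * w i

/-- The numerator of `∑ cᵢ uᵢ vᵢ / bᵢ²`. -/
def elimP (w c u v : Fin 3 → S) : S := ∑ i, c i * (u i * v i) * w i ^ 2

/-- The numerator of the rational part of the eliminant. -/
def elimN (s : S) (w c u v : Fin 3 → S) : S :=
  (∑ i, c i * v i ^ 2 * w i ^ 2) * elimR w u + s * elimT w c v * ∑ i, c i * u i ^ 2 * w i ^ 2

/-- The numerator of the eliminant. -/
def elimG (s : S) (w c u v : Fin 3 → S) : S :=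
  4 * s * elimR w u * elimT w c v * elimP w c u v ^ 2 - elimN s w c u v ^ 2

lemma map_elimR (f : S →+* S') (w u : Fin 3 → S) :
    f (elimR w u) = elimR (fun i => f (w i)) (fun i => f (u i)) := by
  simp [elimR]

lemma map_elimT (f : S →+* S') (w c v : Fin 3 → S) :
    f (elimT w c v) = elimT (fun i => f (w i)) (fun i => f (c i)) (fun i => f (v i)) := by
  simp [elimT]

lemma map_elimG (f : S →+* S') (s : S) (w c u v : Fin 3 → S) :
    f (elimG s w c u v) = elimG (f s) (fun i => f (w i)) (fun i => f (c i)) (fun i => f (u i))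
      (fun i => f (v i)) := by
  have h4 : f 4 = 4 := map_ofNat f 4
  simp [elimG, elimR, elimT, elimP, elimN, h4]

end Numerators

/-! ### From zeros of the eliminant to roots of a polynomial -/

section Specialized

variable {c : Fin 3 → ℝ} {u v : Fin 3 → ℂ} {w : Fin 3 → Polynomial ℂ} {B D F : Polynomial ℂ}

/-- The coefficients `cᵢ` as constant polynomials. -/
noncomputable def constC (x : Fin 3 → ℂ) : Fin 3 → Polynomial ℂ := fun i => Polynomial.C (x i)

lemma poleSum_mul {s : ℂ} (hw : ∀ i, w i * (1 - Polynomial.X * Polynomial.C (c i : ℂ)) = B)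
    (hb : ∀ i, 1 - s * c i ≠ 0) (k : ℕ) (x : Fin 3 → ℂ) :
    poleSum c s k x * B.eval s ^ k = ∑ i, x i * (w i).eval s ^ k := by
  rw [poleSum, Finset.sum_mul]
  refine Finset.sum_congr rfl fun i _ => ?_
  have := hb i
  have h := congrArg (Polynomial.eval s) (hw i)
  simp only [Polynomial.eval_mul, Polynomial.eval_sub, Polynomial.eval_one, Polynomial.eval_X,
    Polynomial.eval_C] at h
  rw [← h, mul_pow]
  field_simp

/-- The zeros of the eliminant are the roots of a polynomial `F` whose product with a square is the
numerator of the eliminant. -/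
lemma eliminantZeros_eq (hw : ∀ i, w i * (1 - Polynomial.X * Polynomial.C (c i : ℂ)) = B)
    (hB : ∀ s : ℂ, (∀ i, 1 - s * c i ≠ 0) → B.eval s ≠ 0)
    (hD : ∀ s : ℂ, (∀ i, 1 - s * c i ≠ 0) → D.eval s ≠ 0)
    (hG : D ^ 2 * F = elimG Polynomial.X w (constC fun i => c i) (constC u) (constC v))
    (hF : IsCoprime F (Polynomial.derivative F)) (hFr : IsCoprime F (elimR w (constC u)))
    (hFt : IsCoprime F (elimT w (constC fun i => c i) (constC v)))
    (hFb : IsCoprime F (Polynomial.X * ∏ i, (1 - Polynomial.X * Polynomial.C (c i : ℂ)))) :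
    (∀ s : ℂ, s ≠ 0 → (∀ i, 1 - s * c i ≠ 0) → eliminant c u v s = 0 →
      poleSum c s 1 (fun i => u i ^ 2) ≠ 0 ∧ poleSum c s 1 (fun i => c i * v i ^ 2) ≠ 0 ∧
        poleSum c s 2 (fun i => c i * (u i * v i)) ≠ 0) ∧
      eliminantZeros c u v = {s | F.eval s = 0} := by
  have hroot : ∀ {Q : Polynomial ℂ}, IsCoprime F Q → ∀ s, F.eval s = 0 → Q.eval s ≠ 0 := by
    rintro Q ⟨a, b, hab⟩ s h1 h2
    have := congrArg (Polynomial.eval s) hab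
    simp [h1, h2] at this
  have hr : ∀ s : ℂ, (∀ i, 1 - s * c i ≠ 0) →
      (elimR w (constC u)).eval s = poleSum c s 1 (fun i => u i ^ 2) * B.eval s := by
    intro s hb
    have := poleSum_mul hw hb 1 (fun i => u i ^ 2)
    simp only [pow_one] at this
    rw [this]
    simp [elimR, constC, Polynomial.eval_finsetSum]
  have ht : ∀ s : ℂ, (∀ i, 1 - s * c i ≠ 0) →
      (elimT w (constC fun i => c i) (constC v)).eval s =
        poleSum c s 1 (fun i => c i * v i ^ 2) * B.eval s := by
    intro s hb
    have := poleSum_mul hw hb 1 (fun i => c i * v i ^ 2)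
    simp only [pow_one] at this
    rw [this]
    simp [elimT, constC, Polynomial.eval_finsetSum]
  have hp : ∀ s : ℂ, (∀ i, 1 - s * c i ≠ 0) →
      (elimP w (constC fun i => c i) (constC u) (constC v)).eval s =
        poleSum c s 2 (fun i => c i * (u i * v i)) * B.eval s ^ 2 := by
    intro s hb
    rw [poleSum_mul hw hb 2]
    simp [elimP, constC, Polynomial.eval_finsetSum]
  have hn : ∀ s : ℂ, (∀ i, 1 - s * c i ≠ 0) →
      (elimN Polynomial.X w (constC fun i => c i) (constC u) (constC v)).eval s =
      (poleSum c s 2 (fun i => c i * v i ^ 2) * poleSum c s 1 (fun i => u i ^ 2) +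
        s * poleSum c s 1 (fun i => c i * v i ^ 2) * poleSum c s 2 (fun i => c i * u i ^ 2)) *
        B.eval s ^ 3 := by
    intro s hb
    have h0 := poleSum_mul hw hb 2 (fun i => c i * v i ^ 2)
    have h2 := poleSum_mul hw hb 2 (fun i => c i * u i ^ 2)
    rw [elimN, Polynomial.eval_add, Polynomial.eval_mul, Polynomial.eval_mul, Polynomial.eval_mul,
      hr s hb, ht s hb, Polynomial.eval_X]
    have h0' : (∑ i, constC (fun i => (c i : ℂ)) i * constC v i ^ 2 * w i ^ 2).eval s =
        ∑ i, (c i * v i ^ 2) * (w i).eval s ^ 2 := by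
      simp [constC, Polynomial.eval_finsetSum]
    have h2' : (∑ i, constC (fun i => (c i : ℂ)) i * constC u i ^ 2 * w i ^ 2).eval s =
        ∑ i, (c i * u i ^ 2) * (w i).eval s ^ 2 := by
      simp [constC, Polynomial.eval_finsetSum]
    rw [h0', h2', ← h0, ← h2]
    ring
  -- The exponent 6 is `1 + 1 + 2·2` for the product `R T P²` and `2·3` for `N²`.
  have hE : ∀ s : ℂ, (∀ i, 1 - s * c i ≠ 0) →
      D.eval s ^ 2 * F.eval s = eliminant c u v s * B.eval s ^ 6 := by
    intro s hb
    have := congrArg (Polynomial.eval s) hG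
    rw [Polynomial.eval_mul, Polynomial.eval_pow] at this
    rw [this, elimG, Polynomial.eval_sub, Polynomial.eval_pow, hn s hb, eliminant]
    simp only [Polynomial.eval_mul, Polynomial.eval_pow, hr s hb, ht s hb, hp s hb,
      Polynomial.eval_X, Polynomial.eval_ofNat]
    ring
  have hEF : ∀ s : ℂ, (∀ i, 1 - s * c i ≠ 0) → (eliminant c u v s = 0 ↔ F.eval s = 0) := by
    intro s hb
    have h := hE s hb
    constructor
    · intro h0
      rw [h0, zero_mul] at h
      exact (mul_eq_zero.1 h).resolve_left (pow_ne_zero 2 (hD s hb))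
    · intro h0
      rw [h0, mul_zero] at h
      exact (mul_eq_zero.1 h.symm).resolve_right (pow_ne_zero 6 (hB s hb))
  constructor
  · intro s hs hb hes
    have hFs := (hEF s hb).1 hes
    refine ⟨fun h0 => hroot hFr s hFs ?_, fun h0 => hroot hFt s hFs ?_, fun h0 => ?_⟩
    · rw [hr s hb, h0, zero_mul]
    · rw [ht s hb, h0, zero_mul]
    · have hp0 := hp s hb
      rw [h0, zero_mul] at hp0
      -- If `P` vanishes at a root of `F`, so does `N`. Then `4 s R T P² - N²` vanishes to second
      -- order, which makes the root of `F` multiple.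
      have hn0 : (elimN Polynomial.X w (constC fun i => c i) (constC u) (constC v)).eval s = 0 := by
        have := congrArg (Polynomial.eval s) hG
        rw [Polynomial.eval_mul, hFs, mul_zero, elimG, Polynomial.eval_sub, Polynomial.eval_mul,
          Polynomial.eval_pow, Polynomial.eval_pow, hp0] at this
        simpa using this.symm
      have hder := congrArg (fun p => Polynomial.eval s (Polynomial.derivative p)) hG
      simp only [elimG, Polynomial.derivative_mul, Polynomial.derivative_sub,
        Polynomial.derivative_pow, Polynomial.eval_add, Polynomial.eval_sub, Polynomial.eval_mul,
        Polynomial.eval_pow, hFs, hp0, hn0] at hder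
      have hDF : D.eval s ^ 2 * (Polynomial.derivative F).eval s = 0 := by
        simpa using hder
      exact hroot hF s hFs ((mul_eq_zero.1 hDF).resolve_left (pow_ne_zero 2 (hD s hb)))
  · ext s
    simp only [eliminantZeros, Set.mem_ofPred_eq]
    constructor
    · rintro ⟨-, hb, hes⟩
      exact (hEF s hb).1 hes
    · intro hFs
      have h := hroot hFb s hFs
      rw [Polynomial.eval_mul, Polynomial.eval_X, Polynomial.eval_prod] at h
      have hb : ∀ i, 1 - s * c i ≠ 0 := fun i => by
        have := Finset.prod_ne_zero_iff.1 (right_ne_zero_of_mul h) i (Finset.mem_univ i)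
        simpa only [Polynomial.eval_sub, Polynomial.eval_one, Polynomial.eval_mul,
          Polynomial.eval_X, Polynomial.eval_C] using this
      exact ⟨left_ne_zero_of_mul h, hb, (hEF s hb).2 hFs⟩

end Specialized

/-! ### The generic number of critical pairs as a degree -/

section GenericCount

/-- Coefficients `ℂ[u, v]`. -/
abbrev ParamRing : Type := MvPolynomial (Fin 3 ⊕ Fin 3) ℂ

/-- Polynomials with constant coefficients as polynomials over `ℂ[u, v]`. -/
noncomputable def liftPoly : Polynomial ℂ →+* Polynomial ParamRing := Polynomial.mapRingHom C

/-- The coordinates of `u` as constant polynomials. -/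
noncomputable def paramU : Fin 3 → Polynomial ParamRing := fun i => Polynomial.C (X (Sum.inl i))

/-- The coordinates of `v` as constant polynomials. -/
noncomputable def paramV : Fin 3 → Polynomial ParamRing := fun i => Polynomial.C (X (Sum.inr i))

/-- The numerator of the eliminant as a polynomial over `ℂ[u, v]`. -/
noncomputable def paramG (c : Fin 3 → ℝ) (w : Fin 3 → Polynomial ℂ) : Polynomial ParamRing :=
  elimG Polynomial.X (fun i => liftPoly (w i)) (fun i => liftPoly (constC (fun i => c i) i))
    paramU paramV

/-- Specialization of the parameters. -/
noncomputable def specialize (u v : Fin 3 → ℂ) : Polynomial ParamRing →+* Polynomial ℂ :=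
  Polynomial.mapRingHom (eval (Sum.elim u v))

@[simp] lemma specialize_liftPoly (u v : Fin 3 → ℂ) (p : Polynomial ℂ) :
    specialize u v (liftPoly p) = p := by
  have : (eval (Sum.elim u v)).comp C = RingHom.id ℂ := by ext x; simp
  simp [specialize, liftPoly, Polynomial.map_map, this]

@[simp] lemma specialize_X (u v : Fin 3 → ℂ) : specialize u v Polynomial.X = Polynomial.X := by
  simp [specialize]

@[simp] lemma specialize_paramU (u v : Fin 3 → ℂ) (i : Fin 3) :
    specialize u v (paramU i) = constC u i := by
  simp [specialize, paramU, constC]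

@[simp] lemma specialize_paramV (u v : Fin 3 → ℂ) (i : Fin 3) :
    specialize u v (paramV i) = constC v i := by
  simp [specialize, paramV, constC]

lemma specialize_paramG (c : Fin 3 → ℝ) (w : Fin 3 → Polynomial ℂ) (u v : Fin 3 → ℂ) :
    specialize u v (paramG c w) =
      elimG Polynomial.X w (constC fun i => c i) (constC u) (constC v) := by
  simp only [paramG, map_elimG, specialize_liftPoly, specialize_X, specialize_paramU,
    specialize_paramV]

lemma Generic.isCoprime_specialize {F Q : Polynomial ParamRing} {u₀ v₀ : Fin 3 → ℂ}
    (hdeg : (specialize u₀ v₀ F).natDegree = F.natDegree) (hpos : F.natDegree ≠ 0)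
    (hco : IsCoprime (specialize u₀ v₀ F) (specialize u₀ v₀ Q)) :
    Generic fun u v => IsCoprime (specialize u v F) (specialize u v Q) :=
  Generic.isCoprime hdeg hpos hco

lemma generic_quadrics (c : Fin 3 → ℝ) (hc : ∀ i, c i ≠ 0) :
    Generic fun u v : Fin 3 → ℂ => ∑ i, u i ^ 2 ≠ 0 ∧ ∑ i, v i ^ 2 ≠ 0 ∧
      ∑ i, u i ^ 2 / (c i : ℂ) ≠ 0 ∧ ∑ i, (c i : ℂ) * v i ^ 2 ≠ 0 := by
  have hc' : ∀ i, (c i : ℂ) ≠ 0 := fun i => Complex.ofReal_ne_zero.2 (hc i)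
  refine Generic.and ?_ (Generic.and ?_ (Generic.and ?_ ?_))
  · refine (Generic.of_eval (∑ i, X (Sum.inl i) ^ 2) (u₀ := ![1, 0, 0]) (v₀ := 0) ?_).mono ?_
    · simp [Fin.sum_univ_three]
    · intro u v h; simpa using h
  · refine (Generic.of_eval (∑ i, X (Sum.inr i) ^ 2) (u₀ := 0) (v₀ := ![1, 0, 0]) ?_).mono ?_
    · simp [Fin.sum_univ_three]
    · intro u v h; simpa using h
  · refine (Generic.of_eval (∑ i, X (Sum.inl i) ^ 2 * C ((c i : ℂ)⁻¹)) (u₀ := ![1, 0, 0])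
      (v₀ := 0) ?_).mono ?_
    · simp [Fin.sum_univ_three, hc]
    · intro u v h; simpa [div_eq_mul_inv] using h
  · refine (Generic.of_eval (∑ i, C (c i : ℂ) * X (Sum.inr i) ^ 2) (u₀ := 0)
      (v₀ := ![1, 0, 0]) ?_).mono ?_
    · simp [Fin.sum_univ_three, hc]
    · intro u v h; simpa using h

/-- The generic number of critical pairs is the degree of the reduced eliminant `F`, if `F` is
nondegenerate at suitable special parameters. -/
lemma generic_encard_diagPairs {c : Fin 3 → ℝ} (hc : ∀ i, c i ≠ 0) {w : Fin 3 → Polynomial ℂ}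
    {B D : Polynomial ℂ} {F : Polynomial ParamRing} {d : ℕ}
    (hw : ∀ i, w i * (1 - Polynomial.X * Polynomial.C (c i : ℂ)) = B)
    (hB : ∀ s : ℂ, (∀ i, 1 - s * c i ≠ 0) → B.eval s ≠ 0)
    (hD : ∀ s : ℂ, (∀ i, 1 - s * c i ≠ 0) → D.eval s ≠ 0)
    (hG : liftPoly D ^ 2 * F = paramG c w) (hd : d ≠ 0) (hdeg : F.natDegree ≤ d)
    (hpole : Generic fun u v => ∀ (z w : Fin 3 → ℂ) (l m : ℂ), ∑ i, z i ^ 2 = 0 →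
      ∑ i, (c i : ℂ) * w i ^ 2 = 0 → (∀ i, v i - w i = l * z i) →
      (∀ i, u i - z i = m * (c i * w i)) → ∀ i, 1 - l * m * c i ≠ 0)
    {u₀ v₀ u₁ v₁ : Fin 3 → ℂ} (hdeg₀ : (specialize u₀ v₀ F).natDegree = d)
    (hr : IsCoprime (specialize u₀ v₀ F) (elimR w (constC u₀)))
    (ht : IsCoprime (specialize u₀ v₀ F) (elimT w (constC fun i => c i) (constC v₀)))
    (hb : IsCoprime (specialize u₀ v₀ F)
      (Polynomial.X * ∏ i, (1 - Polynomial.X * Polynomial.C (c i : ℂ))))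
    (hdeg₁ : (specialize u₁ v₁ F).natDegree = d)
    (hsep : IsCoprime (specialize u₁ v₁ F) (Polynomial.derivative (specialize u₁ v₁ F))) :
    Generic fun u v => (diagPairs c u v).encard = d := by
  have hFd : F.natDegree = d :=
    le_antisymm hdeg (hdeg₀ ▸ Polynomial.natDegree_map_le)
  have hpos : F.natDegree ≠ 0 := hFd ▸ hd
  have hder : ∀ u v, specialize u v (Polynomial.derivative F) =
      Polynomial.derivative (specialize u v F) := fun u v => by
    simp [specialize, Polynomial.derivative_map]
  -- Each coprimality condition spreads from one parameter value. Separability has its own value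
  -- `(u₁, v₁)`, as `F` may have multiple roots at `(u₀, v₀)`.
  have gr := Generic.isCoprime_specialize (Q := elimR (fun i => liftPoly (w i)) paramU)
    (hdeg₀.trans hFd.symm) hpos (by simpa [map_elimR] using hr)
  have gt := Generic.isCoprime_specialize
    (Q := elimT (fun i => liftPoly (w i)) (fun i => liftPoly (constC (fun i => c i) i)) paramV)
    (hdeg₀.trans hFd.symm) hpos (by simpa [map_elimT] using ht)
  have gb := Generic.isCoprime_specialize (Q := liftPoly
    (Polynomial.X * ∏ i, (1 - Polynomial.X * Polynomial.C (c i : ℂ))))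
    (hdeg₀.trans hFd.symm) hpos (by rw [specialize_liftPoly]; exact hb)
  have gs := Generic.isCoprime_specialize (Q := Polynomial.derivative F)
    (hdeg₁.trans hFd.symm) hpos (by rw [hder]; exact hsep)
  have gl : Generic fun u v => (specialize u v F).natDegree = d := by
    refine (Generic.of_eval F.leadingCoeff (u₀ := u₀) (v₀ := v₀) ?_).mono fun u v h => ?_
    · have : (specialize u₀ v₀ F).coeff d ≠ 0 := by
        rw [← hdeg₀, Polynomial.coeff_natDegree, Polynomial.leadingCoeff_ne_zero]
        intro h0
        rw [h0, Polynomial.natDegree_zero] at hdeg₀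
        exact hd hdeg₀.symm
      rw [← hFd] at this
      simpa [specialize] using this
    · rw [← hFd]
      exact Polynomial.natDegree_map_of_leadingCoeff_ne_zero _ h
  refine ((((((generic_quadrics c hc).and hpole).and gr).and gt).and gb).and (gs.and gl)).mono ?_
  rintro u v ⟨⟨⟨⟨⟨⟨h1, h2, h3, h4⟩, h5⟩, h6⟩, h7⟩, h8⟩, h9, h10⟩
  rw [hder] at h9
  simp only [map_elimR, specialize_liftPoly, specialize_paramU] at h6
  simp only [map_elimT, specialize_liftPoly, specialize_paramV] at h7
  rw [specialize_liftPoly] at h8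
  have hGs : D ^ 2 * specialize u v F =
      elimG Polynomial.X w (constC fun i => c i) (constC u) (constC v) := by
    rw [← specialize_paramG, ← hG, map_mul, map_pow, specialize_liftPoly]
  obtain ⟨k1, k2⟩ := eliminantZeros_eq hw hB hD hGs h9 h6 h7 h8
  have hadm : Admissible c u v := ⟨h1, h2, h3, h4, h5, k1⟩
  rw [hadm.encard_diagPairs hc, k2, encard_zeros_of_isCoprime h9, h10]
  rintro h0
  rw [h0, Polynomial.natDegree_zero] at h10
  exact hd h10.symm

end GenericCount

/-! ### Absence of critical pairs at the poles `l m cᵢ = 1` -/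

section Poles

lemma sum_eq_of_ne {M : Type*} [AddCommMonoid M] {i j k : Fin 3} (hij : i ≠ j) (hik : i ≠ k)
    (hjk : j ≠ k) (f : Fin 3 → M) : ∑ a, f a = f i + f j + f k := by
  have h : (Finset.univ : Finset (Fin 3)) = {i, j, k} := by
    revert i j k; decide
  rw [h, Finset.sum_insert (by simp [hij, hik]), Finset.sum_pair hjk, add_assoc]

/-- The condition on `(u, v)` for critical pairs with `l m cᵢ = 1`; here `κ = cⱼ / cᵢ` and
`β = 1 / (1 - κ)`. -/
def poleCondition {S : Type*} [CommRing S] (κ κ' β β' x y y' p q q' : S) : S :=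
  4 * (x * p) ^ 2 * ((β * (y * p - κ * x * q)) ^ 2 + (β' * (y' * p - κ' * x * q')) ^ 2) +
    ((x * p) ^ 2 - ((β * (y * p - κ * x * q)) ^ 2 + (β' * (y' * p - κ' * x * q')) ^ 2) +
      (κ * (β * (y * p - x * q)) ^ 2 + κ' * (β' * (y' * p - x * q')) ^ 2)) ^ 2

lemma map_poleCondition {S S' : Type*} [CommRing S] [CommRing S'] (f : S →+* S')
    (κ κ' β β' x y y' p q q' : S) : f (poleCondition κ κ' β β' x y y' p q q') =
      poleCondition (f κ) (f κ') (f β) (f β') (f x) (f y) (f y') (f p) (f q) (f q') := by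
  have h4 : f 4 = 4 := map_ofNat f 4
  simp [poleCondition, h4]

lemma poleCondition_eq_zero {c c' c'' κ κ' β β' x y y' p q q' z z' z'' w w' w'' l m : ℂ}
    (hc : c ≠ 0) (hκ : κ * c = c') (hκ' : κ' * c = c'') (hβ : β * (1 - κ) = 1)
    (hβ' : β' * (1 - κ') = 1) (hz : z ^ 2 + z' ^ 2 + z'' ^ 2 = 0)
    (hw : c * w ^ 2 + c' * w' ^ 2 + c'' * w'' ^ 2 = 0)
    (h1 : p - w = l * z) (h2 : q - w' = l * z') (h3 : q' - w'' = l * z'')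
    (h4 : x - z = m * (c * w)) (h5 : y - z' = m * (c' * w')) (h6 : y' - z'' = m * (c'' * w''))
    (hs : 1 - l * m * c = 0) : poleCondition κ κ' β β' x y y' p q q' = 0 := by
  subst hκ hκ'
  -- At the pole the two equations of this index become dependent and leave `z` free. The other
  -- coordinates, scaled by `p` or `x`, are determined by `u` and `v`.
  have hx : x = m * c * p := by linear_combination h4 + z * hs - m * c * h1
  have hp : p = l * x := by linear_combination p * hs - l * hx
  have ez' : p * z' = β * (y * p - κ * x * q) := by
    linear_combination (-p * z') * hβ - β * κ * z' * p * hs - β * p * h5 + β * q * κ * hx +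
      β * p * m * κ * c * h2
  have ez'' : p * z'' = β' * (y' * p - κ' * x * q') := by
    linear_combination (-p * z'') * hβ' - β' * κ' * z'' * p * hs - β' * p * h6 +
      β' * q' * κ' * hx + β' * p * m * κ' * c * h3
  have ew' : x * w' = -(β * (y * p - x * q)) := by
    linear_combination (-x * w') * hβ - β * κ * w' * x * hs - β * x * h2 + β * y * hp +
      β * x * l * h5
  have ew'' : x * w'' = -(β' * (y' * p - x * q')) := by
    linear_combination (-x * w'') * hβ' - β' * κ' * w'' * x * hs - β' * x * h3 + β' * y' * hp +
      β' * x * l * h6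
  have hw' : w ^ 2 + κ * w' ^ 2 + κ' * w'' ^ 2 = 0 := by
    refine (mul_eq_zero.1 (?_ : c * _ = 0)).resolve_left hc
    linear_combination hw
  have ew : x * w = x * p - p * z := by linear_combination (-x) * h1 + z * hp
  have hα : (p * z) ^ 2 = -((p * z') ^ 2 + (p * z'') ^ 2) := by linear_combination p ^ 2 * hz
  have hβ2 : (x * p - p * z) ^ 2 = -(κ * (x * w') ^ 2 + κ' * (x * w'') ^ 2) := by
    rw [← ew]; linear_combination x ^ 2 * hw'
  rw [ez', ez''] at hα
  rw [ew', ew''] at hβ2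
  rw [poleCondition]
  -- The two conics prescribe the squares of `p z` and of `x p - p z`. Their difference is linear in
  -- `p z`; squaring it eliminates this last unknown.
  have key : (x * p) ^ 2 - ((β * (y * p - κ * x * q)) ^ 2 + (β' * (y' * p - κ' * x * q')) ^ 2) +
      (κ * (β * (y * p - x * q)) ^ 2 + κ' * (β' * (y' * p - x * q')) ^ 2) =
      2 * (x * p) * (p * z) := by linear_combination hβ2 - hα
  rw [key]
  linear_combination (4 * (x * p) ^ 2) * hα

variable {c : Fin 3 → ℝ}

/-- For generic `(u, v)` there are no critical pairs with `l m cᵢ = 1`, if `cᵢ` differs from the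
other coefficients. -/
lemma generic_pole_ne {i j k : Fin 3} (hij : i ≠ j) (hik : i ≠ k) (hjk : j ≠ k)
    (hc : ∀ i, 0 < c i) (h1 : c i ≠ c j) (h2 : c i ≠ c k) :
    Generic fun u v => ∀ (z w : Fin 3 → ℂ) (l m : ℂ), ∑ i, z i ^ 2 = 0 →
      ∑ i, (c i : ℂ) * w i ^ 2 = 0 → (∀ i, v i - w i = l * z i) →
      (∀ i, u i - z i = m * (c i * w i)) → 1 - l * m * c i ≠ 0 := by
  have hci : (c i : ℂ) ≠ 0 := Complex.ofReal_ne_zero.2 (hc i).ne'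
  set κ : ℂ := c j / c i with hκ
  set κ' : ℂ := c k / c i with hκ'
  have hb : 1 - κ ≠ 0 := by
    rw [hκ, one_sub_div hci]
    exact div_ne_zero (sub_ne_zero.2 (by exact_mod_cast h1)) hci
  have hb' : 1 - κ' ≠ 0 := by
    rw [hκ', one_sub_div hci]
    exact div_ne_zero (sub_ne_zero.2 (by exact_mod_cast h2)) hci
  set g : MvPolynomial (Fin 3 ⊕ Fin 3) ℂ := poleCondition (C κ) (C κ') (C (1 - κ)⁻¹)
    (C (1 - κ')⁻¹) (X (Sum.inl i)) (X (Sum.inl j)) (X (Sum.inl k)) (X (Sum.inr i))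
    (X (Sum.inr j)) (X (Sum.inr k)) with hg
  have hev : ∀ u v, eval (Sum.elim u v) g = poleCondition κ κ' (1 - κ)⁻¹ (1 - κ')⁻¹
      (u i) (u j) (u k) (v i) (v j) (v k) := by
    intro u v
    simp only [hg, map_poleCondition, eval_C, eval_X, Sum.elim_inl, Sum.elim_inr]
  -- The point `u = eᵢ + κ' eₖ`, `v = eᵢ + eₖ` makes both numerators `y p - κ x q` and `y' p - κ' x
  -- q'` vanish. The value is `(1 + κ')²`, nonzero because `κ' > 0`.
  refine (Generic.of_eval g (u₀ := fun a => if a = i then 1 else if a = k then κ' else 0)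
    (v₀ := fun a => if a = i then 1 else if a = k then 1 else 0) ?_).mono ?_
  · rw [hev]
    simp only [if_true, if_neg hij.symm, if_neg hik.symm, if_neg hjk]
    have hval : poleCondition κ κ' (1 - κ)⁻¹ (1 - κ')⁻¹ 1 0 κ' 1 0 1 = (1 + κ') ^ 2 := by
      rw [poleCondition]
      field_simp
      ring
    rw [hval]
    have : (1 + κ') = ((1 + c k / c i : ℝ) : ℂ) := by push_cast; rfl
    rw [this]
    have hpos : (0 : ℝ) < 1 + c k / c i := by have := hc i; have := hc k; positivity
    exact pow_ne_zero 2 (Complex.ofReal_ne_zero.2 hpos.ne')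
  · intro u v huv z w l m hz hw hl hm hs
    rw [hev] at huv
    rw [sum_eq_of_ne hij hik hjk] at hz hw
    exact huv (poleCondition_eq_zero hci (div_mul_cancel₀ _ hci) (div_mul_cancel₀ _ hci)
      (inv_mul_cancel₀ hb) (inv_mul_cancel₀ hb') hz hw (hl i) (hl j) (hl k) (hm i) (hm j) (hm k)
      hs)

/-- For generic `(u, v)` there are no critical pairs with `l m cᵢ = 1`, if `cᵢ` coincides with
another coefficient. -/
lemma generic_pole_ne_of_eq {i j : Fin 3} (hij : i ≠ j) (h : c i = c j) :
    Generic fun u v => ∀ (z w : Fin 3 → ℂ) (l m : ℂ), ∑ i, z i ^ 2 = 0 →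
      ∑ i, (c i : ℂ) * w i ^ 2 = 0 → (∀ i, v i - w i = l * z i) →
      (∀ i, u i - z i = m * (c i * w i)) → 1 - l * m * c i ≠ 0 := by
  refine (Generic.of_eval (X (Sum.inl i) * X (Sum.inr j) - X (Sum.inl j) * X (Sum.inr i))
    (u₀ := fun a => if a = i then 1 else 0) (v₀ := fun a => if a = j then 1 else 0) ?_).mono ?_
  · simp [hij, hij.symm]
  · intro u v huv z w l m _ _ hl hm hs
    simp only [map_sub, map_mul, eval_X, Sum.elim_inl, Sum.elim_inr] at huv
    -- Every index with the same coefficient has a pole, so `u` and `v` are proportional in the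
    -- coordinates `i` and `j`.
    have e : ∀ a, c a = c i → u a = m * c a * v a := fun a ha => by
      have h1 := hl a
      have h2 := hm a
      rw [ha] at h2 ⊢
      linear_combination h2 + z a * hs - m * c i * h1
    refine huv ?_
    rw [e i rfl, e j h.symm, h]
    ring

end Poles

/-! ### Divisibility of the numerator by `bᵢ²` -/

section Divisibility

/-- Modulo `b²` only the `β`-terms of `P`, `Q₀`, `Q₂` count, and the numerator becomes `c²β⁴ (4 s
u²v² R T - (v² R + s u² T)²) = -c²β⁴ (v² R - s u² T)²`. The `β`-part of `v² R - s u² T` is `u²v²β (1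
- s c)`, so `b` divides this difference. -/
lemma sq_dvd_eliminant_numerator {S : Type*} [CommRing S]
    (s c u v b β r' t' p' q q' R T P Q₀ Q₂ : S) (hb : b = 1 - s * c)
    (hR : R = u ^ 2 * β + b * r') (hT : T = c * v ^ 2 * β + b * t')
    (hP : P = c * (u * v) * β ^ 2 + b ^ 2 * p') (hQ₀ : Q₀ = c * v ^ 2 * β ^ 2 + b ^ 2 * q)
    (hQ₂ : Q₂ = c * u ^ 2 * β ^ 2 + b ^ 2 * q') :
    b ^ 2 ∣ 4 * s * R * T * P ^ 2 - (Q₀ * R + s * T * Q₂) ^ 2 := by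
  refine ⟨-(c * β ^ 2 * (u ^ 2 * v ^ 2 * β + v ^ 2 * r' - s * u ^ 2 * t')) ^ 2 +
    4 * s * R * T * (2 * c * (u * v) * β ^ 2 * p' + b ^ 2 * p' ^ 2) -
    2 * (c * v ^ 2 * β ^ 2 * R + s * c * u ^ 2 * β ^ 2 * T) * (q * R + s * T * q') -
    b ^ 2 * (q * R + s * T * q') ^ 2, ?_⟩
  have h1 : 4 * s * c ^ 2 * (u ^ 2 * v ^ 2) * β ^ 4 * R * T -
      (c * v ^ 2 * β ^ 2 * R + s * c * u ^ 2 * β ^ 2 * T) ^ 2 =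
      b ^ 2 * -(c * β ^ 2 * (u ^ 2 * v ^ 2 * β + v ^ 2 * r' - s * u ^ 2 * t')) ^ 2 := by
    rw [hR, hT, hb]; ring
  rw [hP, hQ₀, hQ₂]
  linear_combination h1

end Divisibility

/-! ### Degree bounds and the factors `1 - s cᵢ` -/

section Reduction

lemma sq_dvd_elimG {S : Type*} [CommRing S] {i j k : Fin 3} (hij : i ≠ j) (hik : i ≠ k)
    (hjk : j ≠ k) {s b p q : S} {w c : Fin 3 → S} (u v : Fin 3 → S) (hb : b = 1 - s * c i)
    (hj : w j = b * p) (hk : w k = b * q) : b ^ 2 ∣ elimG s w c u v := by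
  have := sq_dvd_eliminant_numerator s (c i) (u i) (v i) b (w i) (u j ^ 2 * p + u k ^ 2 * q)
    (c j * v j ^ 2 * p + c k * v k ^ 2 * q)
    (c j * (u j * v j) * p ^ 2 + c k * (u k * v k) * q ^ 2)
    (c j * v j ^ 2 * p ^ 2 + c k * v k ^ 2 * q ^ 2) (c j * u j ^ 2 * p ^ 2 + c k * u k ^ 2 * q ^ 2)
    (elimR w u) (elimT w c v) (elimP w c u v) (∑ i, c i * v i ^ 2 * w i ^ 2)
    (∑ i, c i * u i ^ 2 * w i ^ 2) hb
    (by rw [elimR, sum_eq_of_ne hij hik hjk, hj, hk]; ring)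
    (by rw [elimT, sum_eq_of_ne hij hik hjk, hj, hk]; ring)
    (by rw [elimP, sum_eq_of_ne hij hik hjk, hj, hk]; ring)
    (by rw [sum_eq_of_ne hij hik hjk, hj, hk]; ring)
    (by rw [sum_eq_of_ne hij hik hjk, hj, hk]; ring)
  rwa [elimG, elimN]

/-- The polynomial `1 - s c`. -/
noncomputable def poleFactor (c : ℂ) : Polynomial ℂ := 1 - Polynomial.X * Polynomial.C c

lemma poleFactor_eval (c s : ℂ) : (poleFactor c).eval s = 1 - s * c := by 
  simp [poleFactor, mul_comm s]

lemma natDegree_poleFactor {c : ℂ} (hc : c ≠ 0) : (poleFactor c).natDegree = 1 := by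
  unfold poleFactor
  compute_degree!

lemma natDegree_poleFactor_le (c : ℂ) : (poleFactor c).natDegree ≤ 1 := by
  unfold poleFactor
  compute_degree

lemma poleFactor_ne_zero (c : ℂ) : poleFactor c ≠ 0 := fun h => by
  simpa [poleFactor_eval] using congrArg (Polynomial.eval 0) h

lemma isCoprime_poleFactor {c d : ℂ} (h : c ≠ d) : IsCoprime (poleFactor c) (poleFactor d) := by
  have hd : d - c ≠ 0 := sub_ne_zero.2 h.symm
  refine ⟨Polynomial.C (d / (d - c)), -Polynomial.C (c / (d - c)), ?_⟩
  have e : Polynomial.C (d / (d - c)) - Polynomial.C (c / (d - c)) = 1 := by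
    rw [← Polynomial.C_sub, ← sub_div, div_self hd, Polynomial.C_1]
  have e' : Polynomial.C (d / (d - c)) * Polynomial.C c =
      Polynomial.C (c / (d - c)) * Polynomial.C d := by
    rw [← Polynomial.C_mul, ← Polynomial.C_mul]; congr 1; ring
  rw [poleFactor, poleFactor]
  linear_combination e - Polynomial.X * e'

lemma isCoprime_of_forall_eval {p q : Polynomial ℂ}
    (h : ∀ s, p.eval s = 0 → q.eval s ≠ 0) : IsCoprime p q := by
  rw [Polynomial.isCoprime_iff_aeval_ne_zero_of_isAlgClosed ℂ ℂ]
  intro s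
  by_cases hs : p.eval s = 0
  · exact Or.inr (by simpa [Polynomial.coe_aeval_eq_eval] using h s hs)
  · exact Or.inl (by simpa [Polynomial.coe_aeval_eq_eval] using hs)

lemma natDegree_liftPoly (p : Polynomial ℂ) : (liftPoly p).natDegree = p.natDegree :=
  Polynomial.natDegree_map_eq_of_injective (C_injective _ _) p

lemma natDegree_le_of_sq_mul {D : Polynomial ℂ} {F G : Polynomial ParamRing} {a b : ℕ}
    (hD : D.natDegree = a) (hD0 : D ≠ 0) (h : liftPoly D ^ 2 * F = G) (hG : G.natDegree ≤ 2 * a + b) :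
    F.natDegree ≤ b := by
  by_cases hF : F = 0
  · simp [hF]
  have hl : liftPoly D ≠ 0 := (Polynomial.map_ne_zero_iff (C_injective _ _)).2 hD0
  have := congrArg Polynomial.natDegree h
  rw [Polynomial.natDegree_mul (pow_ne_zero 2 hl) hF, Polynomial.natDegree_pow, natDegree_liftPoly,
    hD] at this
  omega

lemma constC_vec (x y z : ℂ) :
    constC ![x, y, z] = ![Polynomial.C x, Polynomial.C y, Polynomial.C z] := by
  funext i
  fin_cases i <;> rfl

/-- A bound for the degree of the numerator of the eliminant. -/
lemma natDegree_paramG_le {c : Fin 3 → ℝ} {w : Fin 3 → Polynomial ℂ} {k : ℕ}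
    (hw : ∀ i, (w i).natDegree ≤ k) : (paramG c w).natDegree ≤ 6 * k + 2 := by
  have hW : ∀ i, (liftPoly (w i)).natDegree ≤ k := fun i => (natDegree_liftPoly _).trans_le (hw i)
  have hC : ∀ i, (liftPoly (constC (fun i => (c i : ℂ)) i)).natDegree = 0 := fun i => by
    rw [natDegree_liftPoly]; exact Polynomial.natDegree_C _
  have hU : ∀ i, (paramU i).natDegree = 0 := fun i => Polynomial.natDegree_C _
  have hV : ∀ i, (paramV i).natDegree = 0 := fun i => Polynomial.natDegree_C _
  have hmul : ∀ {p q : Polynomial ParamRing} {a b n : ℕ}, p.natDegree ≤ a → q.natDegree ≤ b →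
      a + b ≤ n → (p * q).natDegree ≤ n := fun hp hq h =>
    (Polynomial.natDegree_mul_le_of_le hp hq).trans h
  have hpow : ∀ {p : Polynomial ParamRing} {a n : ℕ}, p.natDegree ≤ a → 2 * a ≤ n →
      (p ^ 2).natDegree ≤ n := fun hp h => (Polynomial.natDegree_pow_le_of_le 2 hp).trans (by omega)
  have hsum : ∀ {f g : Fin 3 → Polynomial ParamRing} {b : ℕ}, (∀ i, (f i).natDegree = 0) →
      (∀ i, (g i).natDegree ≤ b) → (∑ i, f i * g i).natDegree ≤ b := fun hf hg =>
    Polynomial.natDegree_sum_le_of_forall_le _ _ fun i _ => hmul (hf i).le (hg i) (by omega)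
  have hsq : ∀ {x : Fin 3 → Polynomial ParamRing}, (∀ i, (x i).natDegree = 0) →
      ∀ i, (x i ^ 2).natDegree = 0 := fun hx i => Nat.le_zero.1 (hpow (hx i).le le_rfl)
  have hcx : ∀ {x y : Fin 3 → Polynomial ParamRing}, (∀ i, (x i).natDegree = 0) →
      (∀ i, (y i).natDegree = 0) → ∀ i, (x i * y i).natDegree = 0 := fun hx hy i =>
    Nat.le_zero.1 (hmul (hx i).le (hy i).le le_rfl)
  have hW2 : ∀ i, (liftPoly (w i) ^ 2).natDegree ≤ 2 * k := fun i => hpow (hW i) le_rfl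
  have hX : (Polynomial.X : Polynomial ParamRing).natDegree ≤ 1 := Polynomial.natDegree_X_le
  have h4 : (4 : Polynomial ParamRing).natDegree ≤ 0 := (Polynomial.natDegree_ofNat 4).le
  have hR := hsum (hsq hU) hW
  have hT := hsum (hcx hC (hsq hV)) hW
  have hP := hsum (hcx hC (hcx hU hV)) hW2
  have hQ₀ := hsum (hcx hC (hsq hV)) hW2
  have hQ₂ := hsum (hcx hC (hsq hU)) hW2
  -- `N` has degree at most `3k + 1`, so `N²` accounts for `6k + 2`; the other term `4 s R T P²` has
  -- degree at most `1 + k + k + 4k`.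
  have hN := hpow (n := 6 * k + 2) (Polynomial.natDegree_add_le_of_degree_le
    (hmul (n := 3 * k + 1) hQ₀ hR (by omega))
    (hmul (hmul (n := k + 1) hX hT (by omega)) hQ₂ (by omega))) (by omega)
  exact Polynomial.natDegree_sub_le_of_le (hmul (hmul (n := 2 * k + 1)
    (hmul (n := k + 1) (hmul (n := 1) h4 hX (by omega)) hR (by omega)) hT (by omega))
    (hpow (n := 4 * k) hP (by omega)) (by omega)) hN |>.trans (max_self _).le

end Reduction

/-! ### Three distinct coefficients: degree 8 -/

section DistinctCoefficients

/-- The parameters are sparse so that at `ε = 0` both `P` and the first term vanish and only `-N²`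
remains. The numerator of the rational part is `N = b₁b₂ (c₂b₀ m + ε² c₀b₂² k)`. The quotients in `m
= b₁²b₂ + b₀ν` and `k = 2b₁² + b₀κ` make the factor `b₀²` visible. -/
lemma elimG_special_of_distinct {S : Type*} [CommRing S] {s y ε : S} {b c : Fin 3 → S}
    (h : ∀ i, s * c i = 1 - b i) {m k κ ν : S}
    (hm : m = b 1 ^ 2 * (b 0 + (1 - b 0) * b 2) + y ^ 2 * b 0 ^ 2 * (b 1 + (1 - b 1) * b 2))
    (hk : k = b 1 ^ 2 * (2 - b 0) + y ^ 2 * b 0 * (b 1 + (1 - b 1) * b 0))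
    (hκ : κ = -b 1 ^ 2 + y ^ 2 * (b 1 + (1 - b 1) * b 0))
    (hν : ν = b 1 ^ 2 * (1 - b 2) + y ^ 2 * b 0 * (b 1 + (1 - b 1) * b 2)) :
    elimG s ![b 1 * b 2, b 0 * b 2, b 0 * b 1] c ![1, y, 0] ![ε, 0, 1] =
      (b 0 * b 1 * b 2) ^ 2 * (-(c 2 ^ 2 * m ^ 2) + ε ^ 2 *
        (c 0 * c 2 * b 2 ^ 2 * (4 * b 1 ^ 3 * b 2 * y ^ 2 - 4 * b 1 ^ 3 * b 2 *
          (b 1 + y ^ 2 * b 0) - 2 * (b 1 ^ 2 * b 2 * κ + 2 * b 1 ^ 2 * ν + b 0 * ν * κ))) +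
        (ε ^ 2) ^ 2 * (c 0 ^ 2 * b 2 ^ 4 * (-(4 * y ^ 2 * b 1 ^ 2) - κ ^ 2))) := by
  have hR : elimR ![b 1 * b 2, b 0 * b 2, b 0 * b 1] ![1, y, 0] = b 2 * (b 1 + y ^ 2 * b 0) := by
    simp [elimR, Fin.sum_univ_three]; ring
  have hT : elimT ![b 1 * b 2, b 0 * b 2, b 0 * b 1] c ![ε, 0, 1] =
      b 1 * (c 0 * ε ^ 2 * b 2 + c 2 * b 0) := by
    simp [elimT, Fin.sum_univ_three]; ring
  have hP : elimP ![b 1 * b 2, b 0 * b 2, b 0 * b 1] c ![1, y, 0] ![ε, 0, 1] =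
      c 0 * ε * (b 1 * b 2) ^ 2 := by
    simp [elimP, Fin.sum_univ_three]
  have hN : elimN s ![b 1 * b 2, b 0 * b 2, b 0 * b 1] c ![1, y, 0] ![ε, 0, 1] =
      b 1 * b 2 * (c 2 * b 0 * m + ε ^ 2 * c 0 * b 2 ^ 2 * k) := by
    rw [elimN, hR, hT]
    simp only [Fin.sum_univ_three, Matrix.cons_val]
    rw [hm, hk]
    linear_combination (b 1 * (c 0 * ε ^ 2 * b 2 + c 2 * b 0)) *
      (b 2 ^ 2 * b 1 ^ 2 * h 0 + y ^ 2 * b 2 ^ 2 * b 0 ^ 2 * h 1)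
  rw [elimG, hR, hT, hP, hN]
  have e1 : m = b 1 ^ 2 * b 2 + b 0 * ν := by rw [hm, hν]; ring
  have e2 : k = 2 * b 1 ^ 2 + b 0 * κ := by rw [hk, hκ]; ring
  have e3 : 4 * (1 - b 0) * b 1 ^ 3 * b 2 * (b 1 + y ^ 2 * b 0) - 2 * m * k = b 0 *
      (4 * b 1 ^ 3 * b 2 * y ^ 2 - 4 * b 1 ^ 3 * b 2 * (b 1 + y ^ 2 * b 0) -
        2 * (b 1 ^ 2 * b 2 * κ + 2 * b 1 ^ 2 * ν + b 0 * ν * κ)) := by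
    rw [e1, e2]; ring
  have e4 : 4 * (1 - b 0) * b 1 ^ 3 * (b 1 + y ^ 2 * b 0) - k ^ 2 =
      b 0 ^ 2 * (-(4 * y ^ 2 * b 1 ^ 2) - κ ^ 2) := by
    rw [e2, hκ]; ring
  linear_combination (4 * c 0 * ε ^ 2 * (b 1 * b 2) ^ 4 * (b 2 * (b 1 + y ^ 2 * b 0)) *
    (b 1 * (c 0 * ε ^ 2 * b 2 + c 2 * b 0))) * h 0 +
    ((b 1 * b 2) ^ 2 * ε ^ 2 * c 0 * c 2 * b 0 * b 2 ^ 2) * e3 +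
    ((b 1 * b 2) ^ 2 * (ε ^ 2) ^ 2 * c 0 ^ 2 * b 2 ^ 4) * e4

end DistinctCoefficients

section DistinctCoefficients

variable {c : Fin 3 → ℝ}

lemma coprime_values_poleFactor {c d s : ℂ} (h : c ≠ d) (hc : 1 - s * c = 0) : 1 - s * d ≠ 0 :=
  fun hd => h (by
    have hs : s ≠ 0 := by rintro rfl; simp at hc
    exact mul_left_cancel₀ hs (by linear_combination hd - hc))

lemma natDegree_mul_three {c : Fin 3 → ℂ} (hc : ∀ i, c i ≠ 0) :
    (poleFactor (c 0) * poleFactor (c 1) * poleFactor (c 2)).natDegree = 3 := by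
  rw [Polynomial.natDegree_mul (mul_ne_zero (poleFactor_ne_zero _) (poleFactor_ne_zero _))
    (poleFactor_ne_zero _), Polynomial.natDegree_mul (poleFactor_ne_zero _) (poleFactor_ne_zero _),
    natDegree_poleFactor (hc 0), natDegree_poleFactor (hc 1), natDegree_poleFactor (hc 2)]

lemma sq_dvd_elimG_of_pairwise_isCoprime {S : Type*} [CommRing S] {s : S} {b w c : Fin 3 → S}
    (u v : Fin 3 → S) (hb : ∀ i, b i = 1 - s * c i) (hco : ∀ i j, i ≠ j → IsCoprime (b i) (b j))
    (h0 : w 0 = b 1 * b 2) (h1 : w 1 = b 0 * b 2) (h2 : w 2 = b 0 * b 1) :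
    (b 0 * b 1 * b 2) ^ 2 ∣ elimG s w c u v := by
  have d0 := sq_dvd_elimG (i := 0) (j := 1) (k := 2) (by decide) (by decide) (by decide) u v
    (hb 0) h1 h2
  have d1 := sq_dvd_elimG (i := 1) (j := 0) (k := 2) (by decide) (by decide) (by decide) u v
    (hb 1) h0 (h2.trans (mul_comm _ _))
  have d2 := sq_dvd_elimG (i := 2) (j := 0) (k := 1) (by decide) (by decide) (by decide) u v
    (hb 2) (h0.trans (mul_comm _ _)) (h1.trans (mul_comm _ _))
  have h01 := (hco 0 1 (by decide)).pow (m := 2) (n := 2)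
  have h02 := (hco 0 2 (by decide)).pow (m := 2) (n := 2)
  have h12 := (hco 1 2 (by decide)).pow (m := 2) (n := 2)
  rw [mul_pow, mul_pow]
  exact (h02.mul_left h12).mul_dvd (h01.mul_dvd d0 d1) d2

lemma exists_sq_poleFactor_mul_eq_paramG (hinj : Function.Injective c) {W : Fin 3 → Polynomial ℂ}
    (h0 : W 0 = poleFactor (c 1) * poleFactor (c 2))
    (h1 : W 1 = poleFactor (c 0) * poleFactor (c 2))
    (h2 : W 2 = poleFactor (c 0) * poleFactor (c 1)) :
    ∃ F, liftPoly (poleFactor (c 0) * poleFactor (c 1) * poleFactor (c 2)) ^ 2 * F =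
      paramG c W := by
  obtain ⟨F, hF⟩ := sq_dvd_elimG_of_pairwise_isCoprime
    (b := fun i => liftPoly (poleFactor (c i))) (w := fun i => liftPoly (W i))
    (c := fun i => liftPoly (constC (fun i => (c i : ℂ)) i)) (s := Polynomial.X) paramU paramV
    (fun i => by simp [poleFactor, constC, liftPoly])
    (fun i j hij => (isCoprime_poleFactor fun h => hij (hinj (by exact_mod_cast h))).map liftPoly)
    (by rw [h0, map_mul]) (by rw [h1, map_mul]) (by rw [h2, map_mul])
  exact ⟨F, by rw [paramG, hF, map_mul, map_mul]⟩

/-- With `u = (1, y, 0)`, `v = (ε, 0, 1)` the reduced eliminant is `F₀ + ε² F₁ + ε⁴ F₂`, and `F₀ =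
-c₂² m²` has the full degree 8. Its double roots split because `F₁` does not vanish at the roots of
`m`. -/
lemma generic_encard_diagPairs_of_injective (hc : ∀ i, 0 < c i) (hinj : Function.Injective c) :
    Generic fun u v => (diagPairs c u v).encard = (8 : ℕ) := by
  have hne : ∀ i j, i ≠ j → (c i : ℂ) ≠ c j := fun i j hij h => hij (hinj (by exact_mod_cast h))
  have hc0 : ∀ i, (c i : ℂ) ≠ 0 := fun i => Complex.ofReal_ne_zero.2 (hc i).ne'
  -- The inequality keeps `m` from vanishing at the pole `s = 1/c₂`. A real `y` ensures `1 + y² ≠ 0`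
  -- and a nonzero leading coefficient of `m`.
  obtain ⟨y, hy0, hy⟩ : ∃ y : ℝ, y ≠ 0 ∧ (c 2 - c 1) + y ^ 2 * (c 2 - c 0) ≠ 0 := by
    by_contra! h
    have h1 := h 1 one_ne_zero
    have h2 := h 2 two_ne_zero
    exact hinj.ne (by decide : (2 : Fin 3) ≠ 0) (by linarith)
  obtain ⟨F, hF⟩ := exists_sq_poleFactor_mul_eq_paramG (W := ![poleFactor (c 1) * poleFactor (c 2),
    poleFactor (c 0) * poleFactor (c 2), poleFactor (c 0) * poleFactor (c 1)]) hinj rfl rfl rfl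
  set b : Fin 3 → Polynomial ℂ := fun i => poleFactor (c i) with hb
  set C' : Fin 3 → Polynomial ℂ := constC fun i => (c i : ℂ) with hC'
  set Y : Polynomial ℂ := Polynomial.C (y : ℂ) with hY
  set D : Polynomial ℂ := b 0 * b 1 * b 2 with hD
  set W : Fin 3 → Polynomial ℂ := ![b 1 * b 2, b 0 * b 2, b 0 * b 1] with hW
  have hD0 : D ≠ 0 := mul_ne_zero (mul_ne_zero (poleFactor_ne_zero _) (poleFactor_ne_zero _))
    (poleFactor_ne_zero _)
  have hXb : ∀ i, Polynomial.X * C' i = 1 - b i := fun i => by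
    simp [hb, hC', poleFactor, constC]
  set m : Polynomial ℂ :=
    b 1 ^ 2 * (b 0 + (1 - b 0) * b 2) + Y ^ 2 * b 0 ^ 2 * (b 1 + (1 - b 1) * b 2) with hm
  set k : Polynomial ℂ := b 1 ^ 2 * (2 - b 0) + Y ^ 2 * b 0 * (b 1 + (1 - b 1) * b 0) with hk
  set κ : Polynomial ℂ := -b 1 ^ 2 + Y ^ 2 * (b 1 + (1 - b 1) * b 0) with hκ
  set ν : Polynomial ℂ := b 1 ^ 2 * (1 - b 2) + Y ^ 2 * b 0 * (b 1 + (1 - b 1) * b 2) with hν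
  set F₀ : Polynomial ℂ := -(C' 2 ^ 2 * m ^ 2) with hF₀
  set F₁ : Polynomial ℂ := C' 0 * C' 2 * b 2 ^ 2 * (4 * b 1 ^ 3 * b 2 * Y ^ 2 -
    4 * b 1 ^ 3 * b 2 * (b 1 + Y ^ 2 * b 0) -
    2 * (b 1 ^ 2 * b 2 * κ + 2 * b 1 ^ 2 * ν + b 0 * ν * κ)) with hF₁
  set F₂ : Polynomial ℂ := C' 0 ^ 2 * b 2 ^ 4 * (-(4 * Y ^ 2 * b 1 ^ 2) - κ ^ 2) with hF₂
  have hspec : ∀ ε : ℂ, specialize ![1, y, 0] ![ε, 0, 1] F =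
      F₀ + Polynomial.C (ε ^ 2) * F₁ + Polynomial.C ((ε ^ 2) ^ 2) * F₂ := by
    intro ε
    have h := congrArg (specialize ![1, (y : ℂ), 0] ![ε, 0, 1]) hF
    rw [map_mul, map_pow, specialize_liftPoly, specialize_paramG, constC_vec, constC_vec,
      Polynomial.C_1, Polynomial.C_0, elimG_special_of_distinct hXb hm hk hκ hν] at h
    rw [mul_left_cancel₀ (pow_ne_zero 2 hD0) h]
    simp only [Polynomial.C_pow, hF₀, hF₁, hF₂]
  have hmdeg : m.natDegree = 4 := by
    simp only [hm, hb, hY, poleFactor]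
    compute_degree
    · rw [← neg_add, neg_ne_zero]
      have h0 := hc 0
      have h1 := hc 1
      have h2 := hc 2
      have : 0 < c 1 ^ 2 * (c 0 * c 2) + y ^ 2 * c 0 ^ 2 * (c 1 * c 2) := by positivity
      exact_mod_cast this.ne'
    all_goals simp
  have hdF₀ : F₀.natDegree = 8 := by
    have : C' 2 = Polynomial.C (c 2 : ℂ) := rfl
    rw [hF₀, this, ← Polynomial.C_pow, Polynomial.natDegree_neg,
      Polynomial.natDegree_C_mul (pow_ne_zero 2 (hc0 2)), Polynomial.natDegree_pow, hmdeg]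
  have hdF₁ : F₁.natDegree ≤ 8 := by
    simp only [hF₁, hκ, hν, hb, hY, hC', constC, poleFactor]
    compute_degree
  have hdF₂ : F₂.natDegree ≤ 8 := by
    simp only [hF₂, hκ, hb, hY, hC', constC, poleFactor]
    compute_degree
  have hev : ∀ i s, (b i).eval s = 1 - s * c i := fun i s => poleFactor_eval _ s
  have hroot : ∀ s, m.eval s = 0 → s ≠ 0 ∧ (∀ i, (b i).eval s ≠ 0) ∧
      (b 1).eval s + y ^ 2 * (b 0).eval s ≠ 0 := by
    intro s hs
    have hY2 : (1 + (y : ℂ) ^ 2) ≠ 0 := by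
      have : (0 : ℝ) < 1 + y ^ 2 := by positivity
      exact_mod_cast this.ne'
    have hy0' : (y : ℂ) ≠ 0 := Complex.ofReal_ne_zero.2 hy0
    have hm0 : (b 1).eval s ^ 2 * ((b 0).eval s + (1 - (b 0).eval s) * (b 2).eval s) +
        y ^ 2 * (b 0).eval s ^ 2 * ((b 1).eval s + (1 - (b 1).eval s) * (b 2).eval s) = 0 := by
      simpa [hm, hY] using hs
    have hcv : ∀ i j, i ≠ j → (b i).eval s = 0 → (b j).eval s ≠ 0 := fun i j hij h => by
      rw [hev] at h ⊢
      exact coprime_values_poleFactor (hne i j hij) h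
    have hs0 : s ≠ 0 := by
      rintro rfl
      simp only [hev, zero_mul, sub_zero] at hm0
      exact hY2 (by linear_combination hm0)
    have h0 : (b 0).eval s ≠ 0 := fun h => by
      have h1 := hcv 0 1 (by decide) h
      have h2 := hcv 0 2 (by decide) h
      rw [h] at hm0
      exact mul_ne_zero (pow_ne_zero 2 h1) h2 (by linear_combination hm0)
    have h1 : (b 1).eval s ≠ 0 := fun h => by
      have h2 := hcv 1 2 (by decide) h
      rw [h] at hm0
      exact mul_ne_zero (mul_ne_zero (pow_ne_zero 2 hy0') (pow_ne_zero 2 h0)) h2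
        (by linear_combination hm0)
    have h2 : (b 2).eval s ≠ 0 := fun h => by
      have h3 : (b 1).eval s + y ^ 2 * (b 0).eval s = 0 := by
        rw [h] at hm0
        exact (mul_eq_zero.1 (show (b 0).eval s * (b 1).eval s * ((b 1).eval s +
          y ^ 2 * (b 0).eval s) = 0 by linear_combination hm0)).resolve_left (mul_ne_zero h0 h1)
      rw [hev] at h h3
      rw [hev] at h3
      have h4 : ((c 2 : ℂ) - c 1) + y ^ 2 * (c 2 - c 0) = 0 := by
        linear_combination c 2 * h3 - (c 1 + y ^ 2 * c 0) * h
      exact hy (by exact_mod_cast h4)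
    refine ⟨hs0, ?_, fun h => ?_⟩
    · intro i
      fin_cases i
      exacts [h0, h1, h2]
    · refine mul_ne_zero (mul_ne_zero (mul_ne_zero (pow_ne_zero 2 hy0') (pow_ne_zero 2 h0)) h2) hY2
        ?_
      rw [eq_neg_of_add_eq_zero_left h] at hm0
      linear_combination hm0
  have hF₀root : ∀ s, F₀.eval s = 0 → m.eval s = 0 := by
    intro s hs
    simpa [hF₀, hC', constC, hc0, (hc _).ne'] using hs
  have hF₁root : ∀ s, F₀.eval s = 0 → F₁.eval s ≠ 0 := by
    intro s hs hs1
    have hms := hF₀root s hs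
    obtain ⟨hs0, hbs, hr⟩ := hroot s hms
    -- Modulo `m` only `4 s c₀ b₁³ b₂ (b₁ + y² b₀)` remains in the bracket; by `hroot` none of its
    -- factors vanishes at a root of `m`.
    have e : b 0 * F₁ = C' 0 * C' 2 * b 2 ^ 2 *
        (4 * (Polynomial.X * C' 0) * b 1 ^ 3 * b 2 * (b 1 + Y ^ 2 * b 0) - 2 * m * k) := by
      rw [hXb, hF₁, hm, hk, hκ, hν]
      ring
    have := congrArg (Polynomial.eval s) e
    simp [hs1, hms, hC', hY, constC, hs0, hbs, hr, (hc _).ne'] at this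
  have hDs : ∀ s : ℂ, (∀ i, 1 - s * c i ≠ 0) → D.eval s ≠ 0 := by
    intro s hs
    rw [hD, Polynomial.eval_mul, Polynomial.eval_mul, hev, hev, hev]
    exact mul_ne_zero (mul_ne_zero (hs 0) (hs 1)) (hs 2)
  have h0 := hspec 0
  simp only [ne_eq, OfNat.ofNat_ne_zero, not_false_eq_true, zero_pow, Polynomial.C_0, zero_mul,
    add_zero] at h0
  obtain ⟨e, he1, he2⟩ := exists_isCoprime_derivative (by rw [hdF₀]; norm_num)
    (hdF₁.trans hdF₀.ge) (hdF₂.trans hdF₀.ge) hF₁root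
  -- The deformation parameter is `e = ε²`, as only even powers of `ε` occur.
  obtain ⟨ε, rfl⟩ := IsAlgClosed.exists_pow_nat_eq e (n := 2) (by norm_num)
  refine generic_encard_diagPairs (fun i => (hc i).ne') (w := W) (B := D) (D := D) (F := F)
    (u₀ := ![1, y, 0]) (v₀ := ![0, 0, 1]) (u₁ := ![1, y, 0]) (v₁ := ![ε, 0, 1])
    ?_ ?_ ?_ hF (by norm_num) ?_ ?_ ?_ ?_ ?_ ?_ ?_ ?_
  · intro i
    fin_cases i
    · show b 1 * b 2 * b 0 = D
      rw [hD]; ring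
    · show b 0 * b 2 * b 1 = D
      rw [hD]; ring
    · rfl
  · exact hDs
  · exact hDs
  · refine natDegree_le_of_sq_mul (natDegree_mul_three hc0) hD0 hF
      (natDegree_paramG_le (k := 2) fun i => ?_)
    have h2 : ∀ i j, (b i * b j).natDegree ≤ 2 := fun i j =>
      Polynomial.natDegree_mul_le_of_le (natDegree_poleFactor_le _) (natDegree_poleFactor_le _)
    fin_cases i
    exacts [h2 1 2, h2 0 2, h2 0 1]
  · have g0 := generic_pole_ne (i := 0) (j := 1) (k := 2) (by decide) (by decide) (by decide) hc
      (hinj.ne (by decide)) (hinj.ne (by decide))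
    have g1 := generic_pole_ne (i := 1) (j := 0) (k := 2) (by decide) (by decide) (by decide) hc
      (hinj.ne (by decide)) (hinj.ne (by decide))
    have g2 := generic_pole_ne (i := 2) (j := 0) (k := 1) (by decide) (by decide) (by decide) hc
      (hinj.ne (by decide)) (hinj.ne (by decide))
    refine ((g0.and g1).and g2).mono ?_
    rintro u v ⟨⟨g0, g1⟩, g2⟩ z w l m h1 h2 h3 h4 i
    fin_cases i
    exacts [g0 z w l m h1 h2 h3 h4, g1 z w l m h1 h2 h3 h4, g2 z w l m h1 h2 h3 h4]
  · rw [h0, hdF₀]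
  · rw [h0, constC_vec]
    refine isCoprime_of_forall_eval fun s hs => ?_
    obtain ⟨hs0, hbs, hr⟩ := hroot s (hF₀root s hs)
    have : elimR W ![Polynomial.C 1, Polynomial.C (y : ℂ), Polynomial.C 0] =
        b 2 * (b 1 + Y ^ 2 * b 0) := by
      simp [elimR, Fin.sum_univ_three, hW, hY]; ring
    rw [this]
    simp [hY, hbs, hr]
  · rw [h0, constC_vec]
    refine isCoprime_of_forall_eval fun s hs => ?_
    obtain ⟨hs0, hbs, hr⟩ := hroot s (hF₀root s hs)
    have : elimT W C' ![Polynomial.C 0, Polynomial.C 0, Polynomial.C 1] =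
        C' 2 * (b 0 * b 1) := by
      simp [elimT, Fin.sum_univ_three, hW]
    rw [this]
    simp [hC', constC, hbs, (hc _).ne']
  · rw [h0]
    refine isCoprime_of_forall_eval fun s hs => ?_
    obtain ⟨hs0, hbs, hr⟩ := hroot s (hF₀root s hs)
    rw [Polynomial.eval_mul, Polynomial.eval_X, Polynomial.eval_prod]
    exact mul_ne_zero hs0 (Finset.prod_ne_zero_iff.2 fun i _ => hbs i)
  · rw [hspec, he1, hdF₀]
  · rw [hspec]; exact he2

end DistinctCoefficients

/-! ### Two distinct coefficients: degree 6 -/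

section TwoCoefficients

variable {c : Fin 3 → ℝ}

/-- Since `c₀ = c₁`, the constraint `x² + y² = 1` makes `R`, `T` and `N` independent of `x`; only `P
= c₀ x b'²` varies. Hence the reduced eliminant is linear in `x²`, and up to a constant a square at
`x = 0`. -/
lemma elimG_special_of_eq {S : Type*} [CommRing S] {s x y b b' : S} {c : Fin 3 → S}
    (h01 : c 1 = c 0) (h0 : s * c 0 = 1 - b) (h2 : s * c 2 = 1 - b') (hxy : x ^ 2 + y ^ 2 = 1) :
    elimG s ![b', b', b] c ![1, 0, 1] ![x, y, 0] =
      b' ^ 2 * (-(c 0 ^ 2 * (b' ^ 2 * (2 - b) + b * (b' + b - b' * b)) ^ 2) +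
        x ^ 2 * (4 * c 0 ^ 2 * (1 - b) * (b + b') * b' ^ 3)) := by
  have hR : elimR ![b', b', b] ![1, 0, 1] = b + b' := by
    simp [elimR, Fin.sum_univ_three]; ring
  have hT : elimT ![b', b', b] c ![x, y, 0] = c 0 * b' := by
    simp only [elimT, Fin.sum_univ_three, Matrix.cons_val, h01]
    linear_combination c 0 * b' * hxy
  have hP : elimP ![b', b', b] c ![1, 0, 1] ![x, y, 0] = c 0 * x * b' ^ 2 := by
    simp [elimP, Fin.sum_univ_three]
  have hN : elimN s ![b', b', b] c ![1, 0, 1] ![x, y, 0] =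
      c 0 * b' * (b' ^ 2 * (2 - b) + b * (b' + b - b' * b)) := by
    rw [elimN, hR, hT]
    simp only [Fin.sum_univ_three, Matrix.cons_val, h01]
    linear_combination c 0 * b' ^ 2 * (b + b') * hxy + c 0 * b' * (b' ^ 2 * h0 + b ^ 2 * h2)
  rw [elimG, hR, hT, hP, hN]
  linear_combination (4 * (b + b') * b' * c 0 ^ 2 * x ^ 2 * b' ^ 4) * h0

lemma exists_sq_poleFactor_two_mul_eq_paramG {W : Fin 3 → Polynomial ℂ}
    (h0 : W 0 = poleFactor (c 2)) (h1 : W 1 = poleFactor (c 2)) :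
    ∃ F, liftPoly (poleFactor (c 2)) ^ 2 * F = paramG c W := by
  obtain ⟨F, hF⟩ := sq_dvd_elimG (i := 2) (j := 0) (k := 1) (by decide) (by decide) (by decide)
    (b := liftPoly (poleFactor (c 2))) (w := fun i => liftPoly (W i)) (p := 1) (q := 1)
    (c := fun i => liftPoly (constC (fun i => (c i : ℂ)) i)) (s := Polynomial.X) paramU paramV
    (by simp [poleFactor, constC, liftPoly]) (by rw [h0, mul_one]) (by rw [h1, mul_one])
  exact ⟨F, by rw [paramG, hF]⟩

/-- The common denominator `b b'` has two factors, and only the simple coefficient `c₂` contributes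
a square factor `b'²`, leaving degree `8 - 2`. The term linear in `x²` is nonzero at the double
roots and splits them. -/
lemma generic_encard_diagPairs_of_eq (hc : ∀ i, 0 < c i) (h01 : c 0 = c 1) (h02 : c 0 ≠ c 2) :
    Generic fun u v => (diagPairs c u v).encard = (6 : ℕ) := by
  have hc0 : ∀ i, (c i : ℂ) ≠ 0 := fun i => Complex.ofReal_ne_zero.2 (hc i).ne'
  have hne : (c 0 : ℂ) ≠ c 2 := by exact_mod_cast h02
  obtain ⟨F, hF⟩ := exists_sq_poleFactor_two_mul_eq_paramG
    (W := ![poleFactor (c 2), poleFactor (c 2), poleFactor (c 0)]) (c := c) rfl rfl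
  set b : Polynomial ℂ := poleFactor (c 0) with hb
  set b' : Polynomial ℂ := poleFactor (c 2) with hb'
  set C' : Fin 3 → Polynomial ℂ := constC fun i => (c i : ℂ) with hC'
  set W : Fin 3 → Polynomial ℂ := ![b', b', b] with hW
  have hX0 : Polynomial.X * C' 0 = 1 - b := by simp [hb, hC', poleFactor, constC]
  have hX2 : Polynomial.X * C' 2 = 1 - b' := by simp [hb', hC', poleFactor, constC]
  have hC01 : C' 1 = C' 0 := by simp [hC', constC, h01]
  set k : Polynomial ℂ := b' ^ 2 * (2 - b) + b * (b' + b - b' * b) with hk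
  set F₀ : Polynomial ℂ := -(C' 0 ^ 2 * k ^ 2) with hF₀
  set F₁ : Polynomial ℂ := 4 * C' 0 ^ 2 * (1 - b) * (b + b') * b' ^ 3 with hF₁
  have hspec : ∀ x y : ℂ, x ^ 2 + y ^ 2 = 1 → specialize ![1, 0, 1] ![x, y, 0] F =
      F₀ + Polynomial.C (x ^ 2) * F₁ := by
    intro x y hxy
    have h := congrArg (specialize ![1, 0, 1] ![x, y, 0]) hF
    rw [map_mul, map_pow, specialize_liftPoly, specialize_paramG, constC_vec, constC_vec,
      Polynomial.C_1, Polynomial.C_0, elimG_special_of_eq hC01 hX0 hX2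
        (by rw [← Polynomial.C_pow, ← Polynomial.C_pow, ← Polynomial.C_add, hxy,
          Polynomial.C_1])] at h
    rw [mul_left_cancel₀ (pow_ne_zero 2 (poleFactor_ne_zero _)) h]
    simp only [Polynomial.C_pow, hF₀, hF₁, hk]
  have hkdeg : k.natDegree = 3 := by
    simp only [hk, hb, hb', poleFactor]
    compute_degree
    · have h0 := hc 0
      have h2 := hc 2
      have : 0 < c 2 ^ 2 * c 0 + c 0 * (c 2 * c 0) := by positivity
      intro h
      refine this.ne' ?_
      have h' : ((c 2 : ℂ) ^ 2 * c 0 + c 0 * (c 2 * c 0)) = 0 := by linear_combination h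
      exact_mod_cast h'
    all_goals simp
  have hdF₀ : F₀.natDegree = 6 := by
    have : C' 0 = Polynomial.C (c 0 : ℂ) := rfl
    rw [hF₀, this, ← Polynomial.C_pow, Polynomial.natDegree_neg,
      Polynomial.natDegree_C_mul (pow_ne_zero 2 (hc0 0)), Polynomial.natDegree_pow, hkdeg]
  have hdF₁ : F₁.natDegree ≤ 6 := by
    simp only [hF₁, hb, hb', hC', constC, poleFactor]
    compute_degree!
  have hev : ∀ s, b.eval s = 1 - s * c 0 := fun s => poleFactor_eval _ s
  have hev' : ∀ s, b'.eval s = 1 - s * c 2 := fun s => poleFactor_eval _ s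
  have hroot : ∀ s, k.eval s = 0 →
      s ≠ 0 ∧ b.eval s ≠ 0 ∧ b'.eval s ≠ 0 ∧ b.eval s + b'.eval s ≠ 0 := by
    intro s hs
    have hk0 : b'.eval s ^ 2 * (2 - b.eval s) +
        b.eval s * (b'.eval s + b.eval s - b'.eval s * b.eval s) = 0 := by
      simpa [hk] using hs
    have hs0 : s ≠ 0 := by
      rintro rfl
      simp only [hev, hev', zero_mul, sub_zero] at hk0
      norm_num at hk0
    have hcv : b.eval s = 0 → b'.eval s ≠ 0 := by
      rw [hev, hev']
      exact coprime_values_poleFactor hne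
    have h0 : b.eval s ≠ 0 := fun h => by
      have h2 := hcv h
      rw [h] at hk0
      exact mul_ne_zero two_ne_zero (pow_ne_zero 2 h2) (by linear_combination hk0)
    refine ⟨hs0, h0, fun h => ?_, fun h => ?_⟩
    · rw [h] at hk0
      exact pow_ne_zero 2 h0 (by linear_combination hk0)
    · rw [eq_neg_of_add_eq_zero_right h] at hk0
      exact mul_ne_zero two_ne_zero (pow_ne_zero 2 h0) (by linear_combination hk0)
  have hF₀root : ∀ s, F₀.eval s = 0 → k.eval s = 0 := by
    intro s hs
    simpa [hF₀, hC', constC, hc0, (hc _).ne'] using hs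
  have hF₁root : ∀ s, F₀.eval s = 0 → F₁.eval s ≠ 0 := by
    intro s hs
    obtain ⟨hs0, h0, h2, h3⟩ := hroot s (hF₀root s hs)
    rw [hF₁, ← hX0]
    simp [hC', constC, (hc _).ne', hs0, h2, h3]
  have h0 := hspec 0 1 (by norm_num)
  simp only [ne_eq, OfNat.ofNat_ne_zero, not_false_eq_true, zero_pow, Polynomial.C_0, zero_mul,
    add_zero] at h0
  obtain ⟨e, he1, he2⟩ := exists_isCoprime_derivative (F₂ := 0) (by rw [hdF₀]; norm_num)
    (hdF₁.trans hdF₀.ge) (by simp) hF₁root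
  rw [mul_zero, add_zero] at he1 he2
  obtain ⟨x, rfl⟩ := IsAlgClosed.exists_pow_nat_eq e (n := 2) (by norm_num)
  obtain ⟨y, hy⟩ := IsAlgClosed.exists_pow_nat_eq (1 - x ^ 2) (n := 2) (by norm_num)
  have hxy : x ^ 2 + y ^ 2 = 1 := by rw [hy]; ring
  refine generic_encard_diagPairs (fun i => (hc i).ne') (w := W) (B := b * b') (D := b') (F := F)
    (u₀ := ![1, 0, 1]) (v₀ := ![0, 1, 0]) (u₁ := ![1, 0, 1]) (v₁ := ![x, y, 0])
    ?_ ?_ ?_ hF (by norm_num) ?_ ?_ ?_ ?_ ?_ ?_ ?_ ?_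
  · intro i
    fin_cases i
    · exact mul_comm b' b
    · show b' * poleFactor (c 1) = _
      rw [← h01]
      exact mul_comm b' b
    · rfl
  · intro s hs
    rw [Polynomial.eval_mul, hev, hev']
    exact mul_ne_zero (hs 0) (hs 2)
  · intro s hs
    rw [hev']
    exact hs 2
  · refine natDegree_le_of_sq_mul (natDegree_poleFactor (hc0 2)) (poleFactor_ne_zero _) hF
      (natDegree_paramG_le (k := 1) fun i => ?_)
    fin_cases i
    exacts [natDegree_poleFactor_le _, natDegree_poleFactor_le _, natDegree_poleFactor_le _]
  · have g0 := generic_pole_ne_of_eq (c := c) (i := 0) (j := 1) (by decide) h01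
    have g1 := generic_pole_ne_of_eq (c := c) (i := 1) (j := 0) (by decide) h01.symm
    have g2 := generic_pole_ne (i := 2) (j := 0) (k := 1) (by decide) (by decide) (by decide) hc
      h02.symm (h01 ▸ h02.symm)
    refine ((g0.and g1).and g2).mono ?_
    rintro u v ⟨⟨g0, g1⟩, g2⟩ z w l m h1 h2 h3 h4 i
    fin_cases i
    exacts [g0 z w l m h1 h2 h3 h4, g1 z w l m h1 h2 h3 h4, g2 z w l m h1 h2 h3 h4]
  · rw [h0, hdF₀]
  · rw [h0, constC_vec]
    refine isCoprime_of_forall_eval fun s hs => ?_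
    obtain ⟨hs0, hb0, hb2, hr⟩ := hroot s (hF₀root s hs)
    have : elimR W ![Polynomial.C 1, Polynomial.C 0, Polynomial.C 1] = b + b' := by
      simp [elimR, Fin.sum_univ_three, hW]; ring
    rw [this, Polynomial.eval_add]
    exact hr
  · rw [h0, constC_vec]
    refine isCoprime_of_forall_eval fun s hs => ?_
    obtain ⟨hs0, hb0, hb2, hr⟩ := hroot s (hF₀root s hs)
    have : elimT W C' ![Polynomial.C 0, Polynomial.C 1, Polynomial.C 0] = C' 0 * b' := by
      simp [elimT, Fin.sum_univ_three, hW, hC01]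
    rw [this]
    simp [hC', constC, hb2, (hc _).ne']
  · rw [h0]
    refine isCoprime_of_forall_eval fun s hs => ?_
    obtain ⟨hs0, hb0, hb2, hr⟩ := hroot s (hF₀root s hs)
    rw [hev] at hb0
    rw [hev'] at hb2
    rw [Polynomial.eval_mul, Polynomial.eval_X, Polynomial.eval_prod]
    refine mul_ne_zero hs0 (Finset.prod_ne_zero_iff.2 fun i _ => ?_)
    refine (poleFactor_eval _ s).trans_ne ?_
    fin_cases i
    · exact hb0
    · exact h01 ▸ hb0
    · exact hb2
  · rw [hspec x y hxy, he1, hdF₀]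
  · rw [hspec x y hxy]; exact he2

end TwoCoefficients

/-! ### A single coefficient: degree 2 -/

section OneCoefficient

variable {c : Fin 3 → ℝ}

lemma generic_encard_diagPairs_of_const {a : ℝ} (ha : 0 < a) (hca : ∀ i, c i = a) :
    Generic fun u v => (diagPairs c u v).encard = (2 : ℕ) := by
  have hc : ∀ i, 0 < c i := fun i => (hca i).symm ▸ ha
  have ha0 : (a : ℂ) ≠ 0 := Complex.ofReal_ne_zero.2 ha.ne'
  -- For `u = (1, 0, 0)`, `v = (2, x, 0)` with `x² = -3` one has `∑ uᵢ² = ∑ vᵢ² = 1` and `∑ uᵢvᵢ =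
  -- 2`, so the eliminant has explicit coefficients.
  obtain ⟨x, hx⟩ := IsAlgClosed.exists_pow_nat_eq (-3 : ℂ) (n := 2) (by norm_num)
  have hC : (constC fun i => (c i : ℂ)) = fun _ => Polynomial.C (a : ℂ) := by
    funext i; simp [constC, hca]
  set F : Polynomial ℂ := specialize ![1, 0, 0] ![2, x, 0] (paramG c fun _ => 1) with hF
  have hFe : F = Polynomial.C (-(a : ℂ) ^ 4) * Polynomial.X ^ 2 +
      Polynomial.C (14 * (a : ℂ) ^ 3) * Polynomial.X + Polynomial.C (-(a : ℂ) ^ 2) := by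
    have hx' : Polynomial.C x ^ 2 = -3 := by
      rw [← Polynomial.C_pow, hx, Polynomial.C_neg, map_ofNat]
    have h2 : (Polynomial.C 2 : Polynomial ℂ) = 2 := map_ofNat _ 2
    rw [hF, specialize_paramG, hC, constC_vec, constC_vec]
    have hR : elimR (fun _ => 1) ![Polynomial.C (1 : ℂ), Polynomial.C 0, Polynomial.C 0] = 1 := by
      simp [elimR, Fin.sum_univ_three]
    have hT : elimT (fun _ => 1) (fun _ => Polynomial.C (a : ℂ))
        ![Polynomial.C 2, Polynomial.C x, Polynomial.C 0] = Polynomial.C (a : ℂ) := by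
      simp only [elimT, Fin.sum_univ_three, Matrix.cons_val, h2, Polynomial.C_0]
      linear_combination Polynomial.C (a : ℂ) * hx'
    have hP : elimP (fun _ => 1) (fun _ => Polynomial.C (a : ℂ))
        ![Polynomial.C (1 : ℂ), Polynomial.C 0, Polynomial.C 0]
        ![Polynomial.C 2, Polynomial.C x, Polynomial.C 0] = 2 * Polynomial.C (a : ℂ) := by
      simp only [elimP, Fin.sum_univ_three, Matrix.cons_val, h2, Polynomial.C_0, Polynomial.C_1]
      ring
    have hN : elimN Polynomial.X (fun _ => 1) (fun _ => Polynomial.C (a : ℂ))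
        ![Polynomial.C (1 : ℂ), Polynomial.C 0, Polynomial.C 0]
        ![Polynomial.C 2, Polynomial.C x, Polynomial.C 0] =
        Polynomial.C (a : ℂ) + Polynomial.X * Polynomial.C (a : ℂ) ^ 2 := by
      rw [elimN, hR, hT]
      simp only [Fin.sum_univ_three, Matrix.cons_val, h2, Polynomial.C_0, Polynomial.C_1]
      linear_combination Polynomial.C (a : ℂ) * hx'
    rw [elimG, hR, hT, hP, hN]
    simp only [Polynomial.C_neg, Polynomial.C_mul, Polynomial.C_pow, map_ofNat]
    ring
  have hdeg : F.natDegree = 2 := by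
    rw [hFe]
    exact Polynomial.natDegree_quadratic (neg_ne_zero.2 (pow_ne_zero 4 ha0))
  -- In `t = s a` the equation is `t² - 14t + 1 = 0`. It fails at `t = 0`, at the pole `t = 1` and
  -- at the critical value `t = 7`.
  have hroot : ∀ s, F.eval s = 0 → (s * a) ^ 2 - 14 * (s * a) + 1 = 0 := by
    intro s hs
    rw [hFe] at hs
    simp only [Polynomial.eval_add, Polynomial.eval_mul, Polynomial.eval_C, Polynomial.eval_pow,
      Polynomial.eval_X] at hs
    refine (mul_eq_zero.1 (?_ : -(a : ℂ) ^ 2 * _ = 0)).resolve_left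
      (neg_ne_zero.2 (pow_ne_zero 2 ha0))
    linear_combination hs
  refine generic_encard_diagPairs (fun i => (hc i).ne') (w := fun _ => 1) (B := poleFactor a)
    (D := 1) (F := paramG c fun _ => 1) (u₀ := ![1, 0, 0]) (v₀ := ![2, x, 0]) (u₁ := ![1, 0, 0])
    (v₁ := ![2, x, 0]) ?_ ?_ ?_ ?_ (by norm_num) ?_ ?_ hdeg ?_ ?_ ?_ hdeg ?_
  · intro i
    rw [one_mul, hca]; rfl
  · intro s hs
    rw [poleFactor_eval]
    simpa [hca] using hs 0
  · simp
  · simp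
  · exact (natDegree_paramG_le (k := 0) (by simp)).trans (by norm_num)
  · have hp : ∀ i j, i ≠ j → _ := fun i j hij => generic_pole_ne_of_eq (c := c) (i := i) (j := j)
      hij ((hca i).trans (hca j).symm)
    refine (((hp 0 1 (by decide)).and (hp 1 0 (by decide))).and (hp 2 0 (by decide))).mono ?_
    rintro u v ⟨⟨g0, g1⟩, g2⟩ z w l m h1 h2 h3 h4 i
    fin_cases i
    exacts [g0 z w l m h1 h2 h3 h4, g1 z w l m h1 h2 h3 h4, g2 z w l m h1 h2 h3 h4]
  · refine isCoprime_of_forall_eval fun s _ => ?_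
    simp [elimR, constC, Fin.sum_univ_three]
  · refine isCoprime_of_forall_eval fun s _ => ?_
    simp only [elimT, constC, Fin.sum_univ_three, Matrix.cons_val, hca, Polynomial.eval_add,
      Polynomial.eval_mul, Polynomial.eval_C, Polynomial.eval_pow, hx, Polynomial.eval_one]
    intro h
    exact ha0 (by linear_combination h)
  · refine isCoprime_of_forall_eval fun s hs => ?_
    have h := hroot s hs
    rw [Polynomial.eval_mul, Polynomial.eval_X, Polynomial.eval_prod]
    refine mul_ne_zero ?_ (Finset.prod_ne_zero_iff.2 fun i _ => ?_)
    · rintro rfl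
      norm_num at h
    · simp only [hca, Polynomial.eval_sub, Polynomial.eval_one, Polynomial.eval_mul,
        Polynomial.eval_X, Polynomial.eval_C]
      intro h1
      rw [← sub_eq_zero.1 h1] at h
      norm_num at h
  · refine isCoprime_of_forall_eval fun s hs h1 => ?_
    have h := hroot s hs
    rw [← hF, hFe] at h1
    simp only [Polynomial.derivative_add, Polynomial.derivative_C_mul_X_pow,
      Polynomial.derivative_C_mul_X, Polynomial.derivative_C, Polynomial.eval_add,
      Polynomial.eval_mul, Polynomial.eval_C, Polynomial.eval_pow, Polynomial.eval_X,
      Polynomial.eval_zero] at h1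
    norm_num at h1
    have h7 : s * a = 7 := by
      have : (-2 * (a : ℂ) ^ 3) * (s * a - 7) = 0 := by linear_combination h1
      exact sub_eq_zero.1 ((mul_eq_zero.1 this).resolve_left
        (mul_ne_zero (by norm_num) (pow_ne_zero 3 ha0)))
    rw [h7] at h
    norm_num at h

end OneCoefficient

/-! ### Density of the pairs `(u, ū)` -/

section RealPoints

variable {n : ℕ}

/-- A nonzero polynomial in `(u, v)` does not vanish on all pairs `(u, star u)`, `u` in a non-empty
open set. -/
lemma exists_mem_eval_star_ne_zero {g : MvPolynomial (Fin n ⊕ Fin n) ℂ} (hg : g ≠ 0)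
    {V : Set (Fin n → ℂ)} (hV : IsOpen V) (hne : V.Nonempty) :
    ∃ u ∈ V, eval (Sum.elim u (star u)) g ≠ 0 := by
  obtain ⟨u₀, hu₀⟩ := hne
  obtain ⟨ε, hε, hball⟩ := Metric.isOpen_iff.1 hV u₀ hu₀
  -- Under the invertible substitution `u = x + i y`, `v = x - i y`, the pairs `(u, ū)` are those
  -- with real `x`, `y`. A nonzero polynomial cannot vanish on a product of infinite sets, here real
  -- intervals around the coordinates of `u₀`.
  set φ : Fin n ⊕ Fin n → MvPolynomial (Fin n ⊕ Fin n) ℂ :=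
    Sum.elim (fun i => X (Sum.inl i) + C Complex.I * X (Sum.inr i))
      (fun i => X (Sum.inl i) - C Complex.I * X (Sum.inr i)) with hφ
  have hev : ∀ x, eval x (bind₁ φ g) = eval (Sum.elim
      (fun i => x (Sum.inl i) + Complex.I * x (Sum.inr i))
      (fun i => x (Sum.inl i) - Complex.I * x (Sum.inr i))) g := by
    intro x
    rw [← aeval_eq_eval, aeval_bind₁, ← aeval_eq_eval]
    congr 1
    congr 1
    ext i
    rcases i with i | i <;> simp [hφ, aeval_eq_eval]
  have hI : Complex.I * Complex.I = -1 := Complex.I_mul_I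
  have hh : bind₁ φ g ≠ 0 := by
    intro h0
    refine hg (MvPolynomial.funext fun y => ?_)
    have h1 := hev (Sum.elim (fun i => (y (Sum.inl i) + y (Sum.inr i)) / 2)
      (fun i => -Complex.I * ((y (Sum.inl i) - y (Sum.inr i)) / 2)))
    rw [h0, map_zero] at h1
    rw [map_zero, h1]
    congr 2
    ext i
    rcases i with i | i
    · simp only [Sum.elim_inl, Sum.elim_inr]
      linear_combination ((y (Sum.inl i) - y (Sum.inr i)) / 2) * hI
    · simp only [Sum.elim_inl, Sum.elim_inr]
      linear_combination (-(y (Sum.inl i) - y (Sum.inr i)) / 2) * hI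
  set s : Fin n ⊕ Fin n → Set ℂ := Sum.elim
    (fun i => Complex.ofReal '' Metric.ball (u₀ i).re (ε / 2))
    (fun i => Complex.ofReal '' Metric.ball (u₀ i).im (ε / 2)) with hs
  have hinf : ∀ r : ℝ, (Complex.ofReal '' Metric.ball r (ε / 2)).Infinite := fun r => by
    refine Set.Infinite.image Complex.ofReal_injective.injOn ?_
    rw [Real.ball_eq_Ioo]
    exact Set.Ioo_infinite (by linarith)
  have hsinf : ∀ i, (s i).Infinite := by
    rintro (i | i)
    exacts [hinf _, hinf _]
  obtain ⟨x, hx, hxne⟩ : ∃ x ∈ Set.pi Set.univ s, eval x (bind₁ φ g) ≠ 0 := by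
    by_contra! h
    exact hh (MvPolynomial.funext_set s hsinf fun x hx => by rw [h x hx, map_zero])
  choose r hr hrx using fun i => hx (Sum.inl i) trivial
  choose t ht htx using fun i => hx (Sum.inr i) trivial
  refine ⟨fun i => r i + Complex.I * t i, hball ?_, ?_⟩
  · rw [Metric.mem_ball, dist_pi_lt_iff hε]
    intro i
    rw [Complex.dist_eq]
    have h1 := hr i
    have h2 := ht i
    rw [Metric.mem_ball, Real.dist_eq] at h1 h2
    refine (Complex.norm_le_abs_re_add_abs_im _).trans_lt ?_
    simp only [Complex.sub_re, Complex.add_re, Complex.ofReal_re, Complex.mul_re, Complex.I_re,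
      Complex.I_im, Complex.ofReal_im, Complex.sub_im, Complex.add_im, Complex.mul_im]
    ring_nf at h1 h2 ⊢
    linarith
  · rw [hev] at hxne
    convert hxne using 3
    funext i
    rcases i with i | i <;> simp [← hrx, ← htx, sub_eq_add_neg]

/-- The locus `g(u, ū) ≠ 0` is open and meets every non-empty open set. So `N` occurs, and no other
number can be constant on an open set. -/
lemma HD_of_generic {Y : Set (Fin n → ℂ)} {N : ℕ}
    (h : Generic fun u v => v = star u → criticalCount Y u = N) : HD Y = {N} := by
  obtain ⟨g, hg, h⟩ := h
  ext k
  simp only [HD, Set.mem_ofPred_eq, Set.mem_singleton_iff]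
  constructor
  · rintro ⟨U, hU, hne, hk⟩
    obtain ⟨u, hu, hgu⟩ := exists_mem_eval_star_ne_zero hg hU hne
    exact_mod_cast (hk u hu).symm.trans (h u _ hgu rfl)
  · rintro rfl
    obtain ⟨u, -, hgu⟩ := exists_mem_eval_star_ne_zero hg isOpen_univ Set.univ_nonempty
    refine ⟨{u | eval (Sum.elim u (star u)) g ≠ 0}, ?_, ⟨u, hgu⟩, fun u hu => h u _ hu rfl⟩
    refine isOpen_ne_fun ((MvPolynomial.continuous_eval g).comp ?_) continuous_const
    refine continuous_pi ?_
    rintro (i | i)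
    · exact continuous_apply i
    · exact Complex.continuous_conj.comp (continuous_apply i)

end RealPoints

/-! ### One singular value: all solutions over `(u, ū)` are critical points -/

section ScalarCase

/-- If both conics are `∑ zᵢ² = 0`, every pair belonging to a general pair `(u, ū)` is of the form
`(z, z̄)`. -/
lemma eq_star_of_isotropic {u z ω : Fin 3 → ℂ} {Λ M : ℂ} (hz : ∑ i, z i ^ 2 = 0)
    (hω : ∑ i, ω i ^ 2 = 0) (h1 : ∀ i, star (u i) - ω i = Λ * z i)
    (h2 : ∀ i, u i - z i = M * ω i) (hu : ∑ i, u i ^ 2 ≠ 0)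
    (hn : (∑ i, u i * star (u i)) ^ 2 ≠ (∑ i, u i ^ 2) * ∑ i, star (u i) ^ 2) (i : Fin 3) :
    ω i = star (z i) := by
  set p := ∑ i, z i * ω i with hp
  have e1 : ∀ i, star (u i) = ω i + Λ * z i := fun i => by linear_combination h1 i
  have e2 : ∀ i, u i = z i + M * ω i := fun i => by linear_combination h2 i
  have hU : ∑ i, u i ^ 2 = 2 * M * p := by
    simp only [hp, Fin.sum_univ_three, e2] at *
    linear_combination hz + M ^ 2 * hω
  have hV : ∑ i, star (u i) ^ 2 = 2 * Λ * p := by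
    simp only [hp, Fin.sum_univ_three, e1] at *
    linear_combination hω + Λ ^ 2 * hz
  have hN : ∑ i, u i * star (u i) = (1 + Λ * M) * p := by
    have : ∀ i, u i * star (u i) = (z i + M * ω i) * (ω i + Λ * z i) := fun i => by
      rw [← e1, ← e2]
    simp only [this, hp, Fin.sum_univ_three] at *
    linear_combination Λ * hz + M * hω
  have hp0 : p ≠ 0 := fun h => hu (by rw [hU, h, mul_zero])
  have hstarU : star (∑ i, u i ^ 2) = ∑ i, star (u i) ^ 2 := by simp
  have hstarN : star (∑ i, u i * star (u i)) = ∑ i, u i * star (u i) := by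
    simp [mul_comm]
  -- The relations `a1` to `a3` express that `∑ ūᵢ²` is the conjugate of `∑ uᵢ²` and that `∑ uᵢūᵢ`
  -- is real.
  have a1 : star M * star p = Λ * p := by
    rw [hU, hV] at hstarU
    have : star (2 * M * p) = 2 * (star M * star p) := by
      simp [mul_assoc]
    rw [this] at hstarU
    linear_combination hstarU / 2
  have a2 : M * p = star Λ * star p := by
    have := congrArg star a1
    simpa using this
  have a3 : star p + star Λ * star M * star p = p + Λ * M * p := by
    rw [hN] at hstarN
    have : star ((1 + Λ * M) * p) = star p + star Λ * star M * star p := by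
      simp [add_mul]
    rw [this] at hstarN
    linear_combination hstarN
  have a4 : (p - star p) * (1 - Λ * star Λ) = 0 := by
    linear_combination (-1) * a3 + star Λ * a1 - Λ * a2
  -- If `|Λ| = 1`, then `(∑ uᵢūᵢ)² - |∑ uᵢ²|² = (p - p̄)² ≤ 0`. The triangle inequality shows that
  -- the left side is nonnegative, so it vanishes, against `hn`.
  have a5 : Λ * star Λ ≠ 1 := by
    intro hΛ
    have b1 : (∑ i, u i * star (u i)) ^ 2 - (∑ i, u i ^ 2) * ∑ i, star (u i) ^ 2 =
        (p - star p) ^ 2 := by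
      have c1 : Λ * M * p = star p := by linear_combination Λ * a2 + star p * hΛ
      rw [hN, hU, hV]
      linear_combination ((1 + Λ * M) * p + p + star p - 4 * p) * c1
    have b2 : ∑ i, u i * star (u i) = ((∑ i, ‖u i‖ ^ 2 : ℝ) : ℂ) := by
      push_cast
      exact Finset.sum_congr rfl fun i _ => Complex.mul_conj' (u i)
    have b3 : (∑ i, u i ^ 2) * ∑ i, star (u i) ^ 2 = ((‖∑ i, u i ^ 2‖ ^ 2 : ℝ) : ℂ) := by
      rw [← hstarU]
      push_cast
      exact Complex.mul_conj' _
    have b4 : (p - star p) ^ 2 = ((-(4 * p.im ^ 2) : ℝ) : ℂ) := by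
      have : p - star p = (2 * p.im : ℝ) * Complex.I := Complex.sub_conj p
      rw [this, mul_pow, Complex.I_sq]
      push_cast
      ring
    rw [b2, b3, b4] at b1
    have b5 : (∑ i, ‖u i‖ ^ 2) ^ 2 - ‖∑ i, u i ^ 2‖ ^ 2 = -(4 * p.im ^ 2) := by exact_mod_cast b1
    have b6 : ‖∑ i, u i ^ 2‖ ≤ ∑ i, ‖u i‖ ^ 2 :=
      (norm_sum_le _ _).trans_eq (by simp only [norm_pow])
    have b7 := pow_le_pow_left₀ (norm_nonneg _) b6 2
    refine hn ?_
    rw [b2, b3]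
    have b8 : (∑ i, ‖u i‖ ^ 2) ^ 2 = ‖∑ i, u i ^ 2‖ ^ 2 := by
      nlinarith [sq_nonneg p.im]
    exact_mod_cast b8
  have a6 : p = star p :=
    sub_eq_zero.1 ((mul_eq_zero.1 a4).resolve_right (sub_ne_zero.2 a5.symm))
  have a7 : star M = Λ := by
    rw [← a6] at a1
    exact mul_right_cancel₀ hp0 a1
  -- With `M̄ = Λ`, conjugating the second equation and comparing it with the first shows that `δ =
  -- ωᵢ - z̄ᵢ` satisfies `δ = Λ δ̄`, hence `δ (1 - |Λ|²) = 0`.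
  have a8 : ω i - star (z i) = Λ * (star (ω i) - z i) := by
    have := congrArg star (e2 i)
    rw [star_add, star_mul', a7, e1] at this
    linear_combination this
  have a9 : star (ω i) - z i = star Λ * (ω i - star (z i)) := by
    have := congrArg star a8
    simpa using this
  have a10 : (ω i - star (z i)) * (1 - Λ * star Λ) = 0 := by
    linear_combination a8 + Λ * a9
  exact sub_eq_zero.1 ((mul_eq_zero.1 a10).resolve_right (sub_ne_zero.2 a5.symm))

lemma takagi_mulVec_star {U : Matrix (Fin 3) (Fin 3) ℂ} {a : Fin 3 → ℝ} (ha : ∀ i, 0 < a i)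
    (x : Fin 3 → ℂ) (i : Fin 3) :
    (Matrix.diagonal (fun i => ((√(a i))⁻¹ : ℂ)) * U.map star).mulVec (star x) i =
      star ((Matrix.diagonal (fun i => (√(a i) : ℂ)) * U).mulVec x i) / a i := by
  have hs : (√(a i) : ℂ) * √(a i) = a i := by
    rw [← Complex.ofReal_mul, Real.mul_self_sqrt (ha i).le]
  have hs0 : (√(a i) : ℂ) ≠ 0 := Complex.ofReal_ne_zero.2 (Real.sqrt_pos.2 (ha i)).ne'
  have h1 : (U.map star).mulVec (star x) i = star (U.mulVec x i) := by
    simp [Matrix.mulVec, dotProduct]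
  have h2 : star (√(a i) : ℂ) = √(a i) := Complex.conj_ofReal _
  rw [← Matrix.mulVec_mulVec, ← Matrix.mulVec_mulVec, Matrix.mulVec_diagonal,
    Matrix.mulVec_diagonal, h1, star_mul', h2, ← hs]
  field_simp

lemma generic_discriminant : Generic fun u v : Fin 3 → ℂ =>
    ∑ i, u i ^ 2 ≠ 0 ∧ (∑ i, u i * v i) ^ 2 ≠ (∑ i, u i ^ 2) * ∑ i, v i ^ 2 := by
  refine Generic.and ?_ ?_
  · refine (Generic.of_eval (∑ i, X (Sum.inl i) ^ 2) (u₀ := ![1, 0, 0]) (v₀ := 0) ?_).mono ?_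
    · simp [Fin.sum_univ_three]
    · intro u v h; simpa using h
  · refine (Generic.of_eval ((∑ i, X (Sum.inl i) * X (Sum.inr i)) ^ 2 -
      (∑ i, X (Sum.inl i) ^ 2) * ∑ i, X (Sum.inr i) ^ 2) (u₀ := ![1, 0, 0]) (v₀ := ![0, 1, 0])
      ?_).mono ?_
    · simp [Fin.sum_univ_three]
    · intro u v h
      simpa [sub_eq_zero] using h

/-- The degrees of a nonsingular conic with a single singular value. -/
lemma degrees_of_takagi_const {A U : Matrix (Fin 3) (Fin 3) ℂ} {a : ℝ}
    (hU : U * U.conjTranspose = 1) (ha : 0 < a)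
    (hAU : A = U.transpose * Matrix.diagonal (fun _ => (a : ℂ)) * U) :
    HasVirtualHD (conic A) 2 ∧ HD (conic A) = {2} := by
  have ha0 : (a : ℂ) ≠ 0 := Complex.ofReal_ne_zero.2 ha.ne'
  have hd := diagonalizes_takagi (a := fun _ => a) hU (fun _ => ha) hAU
  have hst := takagi_mulVec_star (U := U) (a := fun _ => a) (fun _ => ha)
  set L := Matrix.diagonal (fun _ : Fin 3 => (√a : ℂ)) * U with hL
  set K := Matrix.diagonal (fun _ : Fin 3 => ((√a)⁻¹ : ℂ)) * U.map star with hK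
  have hgen := generic_encard_diagPairs_of_const (c := fun _ => a ^ 2) (pow_pos ha 2)
    (fun _ => rfl)
  refine ⟨hd.hasVirtualHD hgen, HD_of_generic ?_⟩
  refine ((hgen.and generic_discriminant).comp_mulVec hd.L_mul hd.mul_transpose).mono ?_
  rintro u v ⟨h1, h2, h3⟩ rfl
  -- Setting `ω = a · K w`, `Λ = a l`, `M = a m` removes the factors `a` and brings both conics to
  -- `∑ zᵢ² = 0`.
  have key : ∀ z w, (z, w) ∈ normalPairs A u (star u) → w = star z := by
    intro z w hzw
    obtain ⟨-, -, hz, hw, ⟨l, hl⟩, m, hm⟩ := hd.mem_normalPairs_iff.1 hzw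
    refine hd.K_injective (_root_.funext fun i => ?_)
    rw [hst z i, eq_div_iff ha0]
    simp only [hst] at h3
    simp only [hst] at hl
    refine (mul_comm _ _).trans (eq_star_of_isotropic (ω := fun i => a * K.mulVec w i)
      (Λ := a * l) (M := a * m) hz ?_ (fun i => ?_) (fun i => ?_) h2 (fun h => h3 ?_) i)
    · simp only [mul_pow]
      push_cast at hw
      exact hw
    · have := hl i
      field_simp at this
      linear_combination this
    · have := hm i
      push_cast at this
      linear_combination this
    · have e1 : ∑ i, L.mulVec u i * (star (L.mulVec u i) / (a : ℂ)) =
          (∑ i, L.mulVec u i * star (L.mulVec u i)) / a := by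
        rw [Finset.sum_div]
        exact Finset.sum_congr rfl fun i _ => by ring
      have e2 : ∑ i, (star (L.mulVec u i) / (a : ℂ)) ^ 2 =
          (∑ i, star (L.mulVec u i) ^ 2) / a ^ 2 := by
        rw [Finset.sum_div]
        exact Finset.sum_congr rfl fun i _ => by ring
      rw [e1, e2, div_pow, h]
      ring
  have himg : normalPairs A u (star u) =
      (fun z => (z, star z)) '' {z | (z, star z) ∈ normalPairs A u (star u)} := by
    ext ⟨z, w⟩
    constructor
    · intro h
      obtain rfl := key z w h
      exact ⟨z, h, rfl⟩
    · rintro ⟨z', h, heq⟩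
      rw [← heq]
      exact h
  rw [criticalCount_conic hd.isSymm hd.det_ne_zero, ← h1, ← hd.encard_normalPairs]
  conv_rhs => rw [himg]
  exact (Function.Injective.encard_image (fun x y h => congrArg Prod.fst h) _).symm

end ScalarCase

/-! ### Degenerate conics and the cases by number of singular values -/

section Takagi

variable {A U : Matrix (Fin 3) (Fin 3) ℂ} {a : Fin 3 → ℝ}

lemma conic_takagi (hAU : A = U.transpose * Matrix.diagonal (fun i => (a i : ℂ)) * U) :
    conic A = {z | ∑ i, (a i : ℂ) * U.mulVec z i ^ 2 = 0} := by
  ext z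
  have : z ⬝ᵥ A.mulVec z = ∑ i, (a i : ℂ) * U.mulVec z i ^ 2 := by
    rw [hAU, Matrix.mul_assoc, ← Matrix.mulVec_mulVec, Matrix.dotProduct_mulVec,
      Matrix.vecMul_transpose, ← Matrix.mulVec_mulVec, dotProduct]
    refine Finset.sum_congr rfl fun i _ => ?_
    rw [Matrix.mulVec_diagonal]
    ring
  rw [conic, Set.mem_ofPred_eq, Set.mem_ofPred_eq, this]

lemma exists_mulVec_eq (hU : U * U.conjTranspose = 1) (y : Fin 3 → ℂ) : ∃ z, U.mulVec z = y :=
  ⟨U.conjTranspose.mulVec y, by rw [Matrix.mulVec_mulVec, hU, Matrix.one_mulVec]⟩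

/-- The degrees of a double line. -/
lemma degrees_of_rank_eq_one (hU : U * U.conjTranspose = 1)
    (hAU : A = U.transpose * Matrix.diagonal (fun i => (a i : ℂ)) * U) (hr : A.rank = 1) :
    HasVirtualHD (conic A) 1 ∧ HD (conic A) = {1} := by
  rw [rank_takagi hU hAU, Fintype.card_eq_one_iff] at hr
  obtain ⟨⟨i, hi⟩, h⟩ := hr
  have hne : U i ≠ 0 := fun h0 => by
    obtain ⟨z, hz⟩ := exists_mulVec_eq hU 1
    have := congrFun hz i
    simp [Matrix.mulVec, h0] at this
  refine degrees_of_linForm hne ?_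
  rw [conic_takagi hAU]
  ext z
  have hs : ∑ j, (a j : ℂ) * U.mulVec z j ^ 2 = a i * U.mulVec z i ^ 2 := by
    refine Finset.sum_eq_single i (fun j _ hj => ?_) (by simp)
    have : a j = 0 := by
      by_contra h0
      exact hj (congrArg Subtype.val (h ⟨j, h0⟩))
    simp [this]
  rw [Set.mem_ofPred_eq, hs]
  simp [hi, Matrix.mulVec]

/-- The degrees of a pair of lines. -/
lemma degrees_of_rank_eq_two (hU : U * U.conjTranspose = 1) (ha : ∀ i, 0 ≤ a i)
    (hAU : A = U.transpose * Matrix.diagonal (fun i => (a i : ℂ)) * U) (hr : A.rank = 2) :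
    HasVirtualHD (conic A) 2 ∧ HD (conic A) = {2} := by
  classical
  rw [rank_takagi hU hAU, Fintype.card_subtype_compl fun i => a i = 0, Fintype.card_fin] at hr
  have h1 : Fintype.card {i // a i = 0} = 1 := by omega
  rw [Fintype.card_eq_one_iff] at h1
  obtain ⟨⟨k, hk⟩, h⟩ := h1
  obtain ⟨i, j, hij, hik, hjk⟩ : ∃ i j, i ≠ j ∧ i ≠ k ∧ j ≠ k :=
    (by decide : ∀ k : Fin 3, ∃ i j, i ≠ j ∧ i ≠ k ∧ j ≠ k) k
  have hpos : ∀ j, j ≠ k → 0 < a j := fun j hj => by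
    refine lt_of_le_of_ne (ha j) fun h0 => hj (congrArg Subtype.val (h ⟨j, h0.symm⟩))
  -- The cone `aᵢ X² + aⱼ Y² = 0` splits as `(α X + β Y)(α X - β Y)` with `α = √aᵢ` and `β = i √aⱼ`.
  set α : ℂ := (√(a i) : ℂ) with hα
  set β : ℂ := Complex.I * (√(a j) : ℂ) with hβ
  have hα0 : α ≠ 0 := Complex.ofReal_ne_zero.2 (Real.sqrt_pos.2 (hpos i hik)).ne'
  have hβ0 : β ≠ 0 := mul_ne_zero Complex.I_ne_zero
    (Complex.ofReal_ne_zero.2 (Real.sqrt_pos.2 (hpos j hjk)).ne')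
  have hα2 : α ^ 2 = a i := by
    rw [hα, ← Complex.ofReal_pow, Real.sq_sqrt (ha i)]
  have hβ2 : β ^ 2 = -a j := by
    rw [hβ, mul_pow, Complex.I_sq, ← Complex.ofReal_pow, Real.sq_sqrt (ha j)]
    ring
  have hl : ∀ γ z, (α • U i + γ • U j) ⬝ᵥ z = α * U.mulVec z i + γ * U.mulVec z j := by
    intro γ z
    rw [add_dotProduct, smul_dotProduct, smul_dotProduct]
    rfl
  -- The point with `(U z)ᵢ = γ`, `(U z)ⱼ = -α` lies on the line of `γ` and takes the value `α (γ -
  -- δ)` on the form of `δ`. This separates the two forms and shows that they are nonzero.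
  have hval : ∀ γ δ : ℂ, ∃ z, (α • U i + γ • U j) ⬝ᵥ z = α * γ + γ * -α ∧
      (α • U i + δ • U j) ⬝ᵥ z = α * γ + δ * -α := by
    intro γ δ
    obtain ⟨z, hz⟩ := exists_mulVec_eq hU (fun x => if x = i then γ else -α)
    refine ⟨z, ?_, ?_⟩ <;> simp [hl, hz, hij.symm]
  have hne : ∀ γ : ℂ, α • U i + γ • U j ≠ 0 := by
    intro γ h0
    obtain ⟨z, -, hz⟩ := hval (γ + 1) γ
    rw [h0, zero_dotProduct] at hz
    exact hα0 (by linear_combination -hz)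
  refine degrees_of_linForm_mul (hne β) (hne (-β)) ?_ ?_
  · obtain ⟨z, h1, h2⟩ := hval β (-β)
    refine ⟨z, by rw [h1]; ring, fun h0 => ?_⟩
    rw [h2] at h0
    exact mul_ne_zero (mul_ne_zero two_ne_zero hα0) hβ0 (by linear_combination h0)
  · rw [conic_takagi hAU]
    ext z
    rw [Set.mem_ofPred_eq, Set.mem_ofPred_eq, sum_eq_of_ne hij hik hjk, hl, hl, hk]
    have : (α * U.mulVec z i + β * U.mulVec z j) * (α * U.mulVec z i + -β * U.mulVec z j) =
        (a i : ℂ) * U.mulVec z i ^ 2 + a j * U.mulVec z j ^ 2 +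
          ((0 : ℝ) : ℂ) * U.mulVec z k ^ 2 := by
      rw [Complex.ofReal_zero]
      linear_combination U.mulVec z i ^ 2 * hα2 - U.mulVec z j ^ 2 * hβ2
    rw [this]

lemma takagi_pos (ha : ∀ i, 0 ≤ a i)
    (hAU : A = U.transpose * Matrix.diagonal (fun i => (a i : ℂ)) * U) (hdet : IsUnit A.det)
    (i : Fin 3) : 0 < a i := by
  refine lt_of_le_of_ne (ha i) fun h => hdet.ne_zero ?_
  rw [hAU, Matrix.det_mul, Matrix.det_mul, Matrix.det_diagonal,
    Finset.prod_eq_zero (Finset.mem_univ i) (by rw [← h, Complex.ofReal_zero]), mul_zero, zero_mul]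

/-- Permuting the rows of `U` allows two coinciding singular values to be placed in the positions 0
and 1. -/
lemma takagi_reindex (hU : U * U.conjTranspose = 1)
    (hAU : A = U.transpose * Matrix.diagonal (fun i => (a i : ℂ)) * U) (e : Fin 3 ≃ Fin 3) :
    U.submatrix e id * (U.submatrix e id).conjTranspose = 1 ∧
      A = (U.submatrix e id).transpose * Matrix.diagonal (fun i => (a (e i) : ℂ)) *
        U.submatrix e id := by
  constructor
  · rw [Matrix.conjTranspose_submatrix, ← Matrix.submatrix_mul _ _ _ _ _ Function.bijective_id, hU,
      Matrix.submatrix_one_equiv]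
  · have : Matrix.diagonal (fun i => (a (e i) : ℂ)) =
        (Matrix.diagonal (fun i => (a i : ℂ))).submatrix e e :=
      (Matrix.submatrix_diagonal_equiv (fun i => (a i : ℂ)) e).symm
    rw [this, Matrix.transpose_submatrix, Matrix.submatrix_mul_equiv, Matrix.submatrix_mul_equiv,
      ← hAU, Matrix.submatrix_id_id]

lemma degrees_of_ncard_eq_one (hU : U * U.conjTranspose = 1) (ha : ∀ i, 0 < a i)
    (hAU : A = U.transpose * Matrix.diagonal (fun i => (a i : ℂ)) * U)
    (h : (singularValueSet A).ncard = 1) : HasVirtualHD (conic A) 2 ∧ HD (conic A) = {2} := by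
  rw [singularValueSet_takagi hU (fun i => (ha i).le) hAU, Set.ncard_eq_one] at h
  obtain ⟨x, hx⟩ := h
  have hax : ∀ i, a i = x := fun i => by
    have : a i ∈ Set.range a := ⟨i, rfl⟩
    rwa [hx] at this
  refine degrees_of_takagi_const hU (hax 0 ▸ ha 0) ?_
  simpa only [hax] using hAU

lemma hasVirtualHD_of_ncard_eq_two (hU : U * U.conjTranspose = 1) (ha : ∀ i, 0 < a i)
    (hAU : A = U.transpose * Matrix.diagonal (fun i => (a i : ℂ)) * U)
    (h : (singularValueSet A).ncard = 2) : HasVirtualHD (conic A) 6 := by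
  rw [singularValueSet_takagi hU (fun i => (ha i).le) hAU] at h
  obtain ⟨i, j, hij', hij⟩ : ∃ i j, a i = a j ∧ i ≠ j := by
    by_contra! hcon
    have hinj : Function.Injective a := fun i j hij => hcon i j hij
    rw [← Set.image_univ, Set.ncard_image_of_injective _ hinj, Set.ncard_univ, Nat.card_fin] at h
    omega
  obtain ⟨k, hik, hjk⟩ : ∃ k, i ≠ k ∧ j ≠ k :=
    (by decide : ∀ i j : Fin 3, ∃ k, i ≠ k ∧ j ≠ k) i j
  have hne : a i ≠ a k := fun h0 => by
    have : Set.range a = {a i} := by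
      refine Set.Subset.antisymm ?_ (Set.singleton_subset_iff.2 ⟨i, rfl⟩)
      rintro _ ⟨x, rfl⟩
      have hx : x = i ∨ x = j ∨ x = k := (by decide : ∀ i j k : Fin 3, i ≠ j → i ≠ k → j ≠ k →
        ∀ x, x = i ∨ x = j ∨ x = k) i j k hij hik hjk x
      rcases hx with rfl | rfl | rfl
      exacts [rfl, hij'.symm, h0.symm]
    rw [this, Set.ncard_singleton] at h
    omega
  have hbij : Function.Bijective ![i, j, k] := Finite.injective_iff_bijective.1
    ((by decide : ∀ i j k : Fin 3, i ≠ j → i ≠ k → j ≠ k → Function.Injective ![i, j, k])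
      i j k hij hik hjk)
  obtain ⟨hU', hAU'⟩ := takagi_reindex hU hAU (Equiv.ofBijective _ hbij)
  have hd := diagonalizes_takagi hU' (fun x => ha _) hAU'
  refine hd.hasVirtualHD (generic_encard_diagPairs_of_eq (fun x => pow_pos (ha _) 2) ?_ ?_)
  · show a i ^ 2 = a j ^ 2
    rw [hij']
  · show a i ^ 2 ≠ a k ^ 2
    exact fun h0 => hne ((pow_left_inj₀ (ha i).le (ha k).le two_ne_zero).1 h0)

lemma hasVirtualHD_of_ncard_eq_three (hU : U * U.conjTranspose = 1) (ha : ∀ i, 0 < a i)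
    (hAU : A = U.transpose * Matrix.diagonal (fun i => (a i : ℂ)) * U)
    (h : (singularValueSet A).ncard = 3) : HasVirtualHD (conic A) 8 := by
  rw [singularValueSet_takagi hU (fun i => (ha i).le) hAU] at h
  have hinj : Function.Injective a := by
    rw [← Set.image_univ] at h
    exact Set.injOn_univ.1 (Set.injOn_of_ncard_image_eq (by rw [h, Set.ncard_univ, Nat.card_fin]))
  refine (diagonalizes_takagi hU ha hAU).hasVirtualHD
    (generic_encard_diagPairs_of_injective (fun x => pow_pos (ha x) 2) fun i j hij => hinj ?_)
  exact (pow_left_inj₀ (ha i).le (ha j).le two_ne_zero).1 hij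

end Takagi

end HermitianDistance

theorem mainTheorem5 (A : Matrix (Fin 3) (Fin 3) ℂ) (hA : A.IsSymm) :
    (A.rank = 1 →
      HermitianDistance.HasVirtualHD (HermitianDistance.conic A) 1 ∧
        HermitianDistance.HD (HermitianDistance.conic A) = {1}) ∧
    (A.rank = 2 →
      HermitianDistance.HasVirtualHD (HermitianDistance.conic A) 2 ∧
        HermitianDistance.HD (HermitianDistance.conic A) = {2}) ∧
    (IsUnit A.det →
      ((HermitianDistance.singularValueSet A).ncard = 1 →
        HermitianDistance.HasVirtualHD (HermitianDistance.conic A) 2 ∧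
          HermitianDistance.HD (HermitianDistance.conic A) = {2}) ∧
      ((HermitianDistance.singularValueSet A).ncard = 2 →
        HermitianDistance.HasVirtualHD (HermitianDistance.conic A) 6) ∧
      ((HermitianDistance.singularValueSet A).ncard = 3 →
        HermitianDistance.HasVirtualHD (HermitianDistance.conic A) 8)) := by
  obtain ⟨U, a, hU, ha, hAU⟩ := HermitianDistance.exists_takagi hA
  refine ⟨HermitianDistance.degrees_of_rank_eq_one hU hAU,
    HermitianDistance.degrees_of_rank_eq_two hU ha hAU, fun hdet => ?_⟩
  have hpos := HermitianDistance.takagi_pos ha hAU hdet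
  exact ⟨HermitianDistance.degrees_of_ncard_eq_one hU hpos hAU,
    HermitianDistance.hasVirtualHD_of_ncard_eq_two hU hpos hAU,
    HermitianDistance.hasVirtualHD_of_ncard_eq_three hU hpos hAU⟩
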